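/- Conventions. $\mathbb N_+=\{1,2,\dots\}$, $[n]=\{1,\dots,n\}$, $\mathfrak S_n$ is the set of permutations of $[n]$. A permutation $\pi$ of $\mathbb N_+$ (or of $\mathbb Z$) splits at $n$ if it maps $\{i: i\le n\}$ onto itself. A possibly delayed renewal process is $T_k=T_0+Y_1+\dots+Y_k$ ($k\ge 0$), where $T_0\in\{0,1,\dots\}$ and $Y_1,Y_2,\ldots\in\mathbb N_+\cup\{\infty\}$ are independent and the $Y_i$ are identically distributed; $R_n$ is the indicator of $\{T_k=n\text{ for some }k\}$; it has zero delay if $T_0=0$, and it is positive recurrent if $Y_1<\infty$ a.s. and $\mathbb E Y_1<\infty$. For a random permutation $\Pi$ of $\mathbb N_+$ put $\Pi^n_i=\Pi_{n+i}-n$, $i\ge1$. $\Pi$ is regenerative with respect to $(T_k)$ if it splits at every finite $T_k$ and, for each $n>0$ with $\mathbb P(R_n=1)>0$, conditionally given $R_n=1$, the pair $(\Pi^n,(R_{n+j})_{j\ge1})$ is independent of $(R_0,\dots,R_n)$ and is distributed as $(\Pi^0,(R^0_j)_{j\ge1})$, where $\Pi^0$ is some random permutation of $\mathbb N_+$ with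 renewal indicators $R^0_j$ of a renewal process with zero delay, the law of this pair not depending on $n$. $\Pi$ is recurrent regenerative with block length distribution $p$ on $\mathbb N_+$ and blocks governed by $(Q_n)$, $Q_n$ a probability distribution on $\mathfrak S_n$, if it is a concatenation of blocks on $[1,T_0]$ and $(T_{k-1},T_k]$, $k\ge1$, where $T_0$ is a.s. finite, the lengths $Y_k=T_k-T_{k-1}$, $k\ge1$, are i.i.d. with law $p$ and independent of $T_0$, and, conditionally given $T_0$ and all the $Y_k=n_k$, the reduced blocks of $\Pi$ on $(T_{k-1},T_k]$, $k\ge1$ (that is, $\Pi$ restricted to the block and shifted to $[n_k]$) are independent with laws $Q_{n_k}$. A stationary regenerative random permutation of $\mathbb Z$ is a random permutation $\Pi^*$ of $\mathbb Z$ together with random times $\cdots<T_{-1}<T_0<T_1<\cdots$ in $\mathbb Z$, $T_{-1}<0\le T_0$, with indicators $R^*_z=1(z\in\{T_k:k\in\mathbb Z\})$, such that $\Pi^*$ splits at every $T_k$, the process $(\Pi^*_z-z,R^*_z)_{z\in\mathbb Z}$ is stationary, and, for each $z$ with $\mathbb P(R^*_z=1)>0$, conditionally given $R^*_z=1$, the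 pair $(\Pi^{*,z},(R^*_{z+j})_{j\ge1})$, where $\Pi^{*,z}_i=\Pi^*_{z+i}-z$, $i\ge1$, is independent of $(R^*_{z-j})_{j\ge0}$ and is distributed as some random permutation of $\mathbb N_+$ with renewal indicators with zero delay, with a law that does not depend on $z$. It is a stationary version of $\Pi$ if, for all $z\in\mathbb Z$ and all $n\ge1$ with $\mathbb P(R_n=1)>0$, $$\big(\Pi^{*,z},(R^*_{z+j})_{j\ge1}\,\big|\,R^*_z=1\big)\stackrel{(d)}{=}\big(\Pi^{n},(R_{n+j})_{j\ge1}\,\big|\,R_n=1\big).\qquad(1)$$ Theorem. Let $\Pi$ be a recurrent regenerative random permutation of $\mathbb N_+$ with block length distribution $p$ and blocks governed by $(Q_n)$, and suppose that it is positive recurrent: $\mu:=\sum_n n p_n<\infty$. (i) $\Pi$ has a stationary version $\Pi^*$. It is unique: the joint law of $\Pi^*$ and $(R^*_z)_{z\in\mathbb Z}$ is the same for all stationary versions; moreover any two stationary regenerative random permutations of $\mathbb Z$ that satisfy (1) without the renewal indicators, that is $(\Pi^{*,z}\mid R^*_z=1)\stackrel{(d)}{=}(\Pi^n\mid R_n=1)$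 for all such $z,n$, have the same law as random permutations of $\mathbb Z$. For every stationary version, $\mathbb P(R^*_z=1)=1/\mu$ for all $z\in\mathbb Z$, and the conditional law of $(\Pi^{*,z},(R^*_{z+j})_{j\ge1})$ given $R^*_z=1$ is the law of $(\Pi^0,(R^0_j)_{j\ge1})$ for a recurrent regenerative permutation $\Pi^0$ with zero delay, block length distribution $p$ and blocks governed by $(Q_n)$. (ii) For every stationary version, the block lengths $Y_z=T_z-T_{z-1}$, $z\in\mathbb Z$, are independent; $Y_z$ has law $p$ for $z\ne0$, and $\mathbb P(Y_0=n)=np_n/\mu$ for $n\ge1$. Conditionally given all the block lengths, $T_0$ is uniformly distributed on $\{0,1,\dots,Y_0-1\}$. Conditionally given all the block lengths, $Y_z=n_z$ say, and $T_0$, the reduced permutations of $\Pi^*$ on the blocks $(T_{z-1},T_z]$, $z\in\mathbb Z$, are independent with laws $Q_{n_z}$. Conversely, let $\Pi$ be a random permutation of $\mathbb N_+$ that is regenerative with respect to a possibly delayed renewal process (which may be transient). If there is a stationary regenerative random permutation of $\mathbb Z$ for which (1) holds for all $z\in\mathbb Z$ and some $n\ge0$ with $\mathbb P(R_n=1)>0$,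 then the renewal process is positive recurrent. -/

import Mathlib

open MeasureTheory ProbabilityTheory
open scoped ENNReal

noncomputable section

namespace RegenPerm

/-! ### Deterministic notions -/

/-- A permutation of `ℕ+` splits at `n ≥ 0` if it maps `{1, …, n}` onto itself. -/
def SplitsAt (σ : Equiv.Perm ℕ+) (n : ℕ) : Prop :=
  ∀ i : ℕ+, (i : ℕ) ≤ n ↔ (σ i : ℕ) ≤ n

/-- A permutation of `ℤ` splits at `z` if it maps `(-∞, z]` onto itself. -/
def SplitsAtInt (σ : Equiv.Perm ℤ) (z : ℤ) : Prop :=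
  ∀ i : ℤ, i ≤ z ↔ σ i ≤ z

/-- The positive integer `n + i`. -/
def shiftPNat (n : ℕ) (i : ℕ+) : ℕ+ := ⟨n + i, Nat.add_pos_right n i.pos⟩

/-- The residual sequence `i ↦ σ (n + i) - n`, for `i ≥ 1`. It takes values in `ℤ`; if `σ` splits
at `n`, these values are positive and form the residual permutation of `ℕ+`. -/
def residual (σ : Equiv.Perm ℕ+) (n : ℕ) : ℕ+ → ℤ :=
  fun i => ((σ (shiftPNat n i) : ℕ) : ℤ) - n

/-- The same for a permutation of `ℤ`: the sequence `i ↦ σ (z + i) - z`, for `i ≥ 1`. -/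
def residualInt (σ : Equiv.Perm ℤ) (z : ℤ) : ℕ+ → ℤ :=
  fun i => σ (z + (i : ℕ)) - z

/-- `{a + 1, …, a + n}` is mapped to itself by `σ`, and the reduced permutation of `n` points
obtained by shifting it back is `τ`. Here `Fin n` stands for `{1, …, n}`, through `j ↦ j + 1`. -/
def HasReducedBlock (σ : Equiv.Perm ℕ+) (a n : ℕ) (τ : Equiv.Perm (Fin n)) : Prop :=
  ∀ j : Fin n, (σ (shiftPNat a (Nat.succPNat j)) : ℕ) = a + ((τ j : ℕ) + 1)

/-- The same for a permutation of `ℤ` and the interval `{a + 1, …, a + n}` of `ℤ`. -/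
def HasReducedBlockInt (σ : Equiv.Perm ℤ) (a : ℤ) (n : ℕ) (τ : Equiv.Perm (Fin n)) : Prop :=
  ∀ j : Fin n, σ (a + ((j : ℕ) + 1)) = a + (((τ j : ℕ) : ℤ) + 1)

/-! ### Delayed renewal processes and regenerative permutations of `ℕ+` -/

section OneSided

variable {Ω : Type*} [MeasurableSpace Ω]

/-- A random permutation of `ℕ+`. -/
def IsRandomPerm (π : Ω → Equiv.Perm ℕ+) : Prop :=
  ∀ i : ℕ+, Measurable fun ω => (π ω i : ℕ)

/-- The renewal times `T_k = L_0 + L_1 + ⋯ + L_k`, where `L_0 = T_0` is the delay and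
`L_k = Y_k`, for `k ≥ 1`, are the block lengths. -/
def renewalTime (L : ℕ → Ω → ℕ∞) (k : ℕ) (ω : Ω) : ℕ∞ :=
  ∑ j ∈ Finset.range (k + 1), L j ω

/-- The random set of (finite) renewal times; the renewal indicator `R_n` is that of the event
that `n` belongs to it. -/
def renewalSet (L : ℕ → Ω → ℕ∞) (ω : Ω) : Set ℕ :=
  {n | ∃ k, renewalTime L k ω = n}

/-- The event `{R_n = 1}`. -/
def renewalEvent (L : ℕ → Ω → ℕ∞) (n : ℕ) : Set Ω :=
  {ω | n ∈ renewalSet L ω}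

/-- The delay and the block lengths of a possibly delayed, possibly transient renewal process:
a delay `L 0` in `{0, 1, …}` and identically distributed `L 1, L 2, …` in `{1, 2, …, ∞}`, all
independent. -/
structure IsDelayedRenewal (P : Measure Ω) (L : ℕ → Ω → ℕ∞) : Prop where
  measurable : ∀ k, Measurable (L k)
  indep : iIndepFun L P
  delay_finite : ∀ᵐ ω ∂P, L 0 ω ≠ ⊤
  length_pos : ∀ k, ∀ᵐ ω ∂P, L (k + 1) ω ≠ 0
  identDistrib : ∀ k, IdentDistrib (L (k + 1)) (L 1) P P

/-- The pair `(Π^n, (R_{n+1}, R_{n+2}, …))`. -/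
def future (π : Ω → Equiv.Perm ℕ+) (L : ℕ → Ω → ℕ∞) (n : ℕ) (ω : Ω) :
    (ℕ+ → ℤ) × (ℕ+ → Prop) :=
  (residual (π ω) n, fun i => n + (i : ℕ) ∈ renewalSet L ω)

/-- The initial segment `(R_0, …, R_n)` of the renewal indicators. -/
def past (L : ℕ → Ω → ℕ∞) (n : ℕ) (ω : Ω) : Fin (n + 1) → Prop :=
  fun j => (j : ℕ) ∈ renewalSet L ω

/-- The law of `(Π^n, (R_{n+1}, R_{n+2}, …))` conditionally given `R_n = 1`. -/
def palmLaw (P : Measure Ω) (π : Ω → Equiv.Perm ℕ+) (L : ℕ → Ω → ℕ∞) (n : ℕ) :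
    Measure ((ℕ+ → ℤ) × (ℕ+ → Prop)) :=
  (P[|renewalEvent L n]).map (future π L n)

/-- `ρ` is the joint law of some random permutation `Π^0` of `ℕ+` with renewal indicators
`(R^0_1, R^0_2, …)` with zero delay. -/
def IsZeroDelayLaw (ρ : Measure ((ℕ+ → ℤ) × (ℕ+ → Prop))) : Prop :=
  ∃ (Ω₀ : Type) (_ : MeasurableSpace Ω₀) (P₀ : Measure Ω₀) (π₀ : Ω₀ → Equiv.Perm ℕ+)
    (L₀ : ℕ → Ω₀ → ℕ∞),
    IsProbabilityMeasure P₀ ∧ IsRandomPerm π₀ ∧ IsDelayedRenewal P₀ L₀ ∧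
    (∀ᵐ ω ∂P₀, L₀ 0 ω = 0) ∧ ρ = P₀.map (future π₀ L₀ 0)

/-- The random permutation `π` of `ℕ+` is regenerative with respect to the possibly delayed
renewal process with delay and block lengths `L`. -/
structure IsRegenerative (P : Measure Ω) (π : Ω → Equiv.Perm ℕ+) (L : ℕ → Ω → ℕ∞) : Prop where
  randomPerm : IsRandomPerm π
  renewal : IsDelayedRenewal P L
  splits : ∀ᵐ ω ∂P, ∀ n ∈ renewalSet L ω, SplitsAt (π ω) n
  regenerates : ∃ ρ, IsZeroDelayLaw ρ ∧ ∀ n, 0 < n → P (renewalEvent L n) ≠ 0 →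
    palmLaw P π L n = ρ ∧ IndepFun (past L n) (future π L n) (P[|renewalEvent L n])

/-- The renewal process with block lengths `L 1, L 2, …` is positive recurrent: the block lengths
are almost surely finite, with finite mean. -/
def IsPositiveRecurrent (P : Measure Ω) (L : ℕ → Ω → ℕ∞) : Prop :=
  (∀ᵐ ω ∂P, L 1 ω ≠ ⊤) ∧ ∫⁻ ω, (L 1 ω : ℝ≥0∞) ∂P < ⊤

/-- The event that the block `(T_k, T_{k+1}]`, which has number `k + 1`, has length `n` and
reduced permutation `τ`. -/
def blockEvent (π : Ω → Equiv.Perm ℕ+) (L : ℕ → Ω → ℕ∞) (k n : ℕ) (τ : Equiv.Perm (Fin n)) :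
    Set Ω :=
  {ω | ∃ a : ℕ, renewalTime L k ω = a ∧ L (k + 1) ω = n ∧ HasReducedBlock (π ω) a n τ}

/-- The σ-algebra generated by the delay and all the block lengths. -/
abbrev lengthAlgebra (L : ℕ → Ω → ℕ∞) : MeasurableSpace Ω :=
  MeasurableSpace.comap (fun ω k => L k ω) MeasurableSpace.pi

open Classical in
/-- The random permutation `π` of `ℕ+` is recurrent regenerative with block length distribution
`p` and blocks governed by `(Q n)`: it is a concatenation of blocks of lengths `L 0, L 1, …`, where
`L 1, L 2, …` are i.i.d. with law `p` and independent of the almost surely finite length `L 0`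
of the initial block, and conditionally given all these lengths the reduced blocks number
`1, 2, …` are independent with laws `Q (L 1), Q (L 2), …`. Nothing is assumed on the action of
`π` on the initial block. -/
structure IsRecurrentRegenerative (P : Measure Ω) (π : Ω → Equiv.Perm ℕ+) (L : ℕ → Ω → ℕ∞)
    (p : PMF ℕ+) (Q : ∀ n : ℕ, PMF (Equiv.Perm (Fin n))) : Prop where
  randomPerm : IsRandomPerm π
  measurable : ∀ k, Measurable (L k)
  indep : iIndepFun L P
  delay_finite : ∀ᵐ ω ∂P, L 0 ω ≠ ⊤
  length_law : ∀ (k : ℕ) (n : ℕ+), P {ω | L (k + 1) ω = ((n : ℕ) : ℕ∞)} = p n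
  splits : ∀ᵐ ω ∂P, ∀ n ∈ renewalSet L ω, SplitsAt (π ω) n
  blocks : ∀ (s : Finset ℕ) (n : ℕ → ℕ) (τ : ∀ k, Equiv.Perm (Fin (n k))),
    P⟦⋂ k ∈ s, blockEvent π L k (n k) (τ k) | lengthAlgebra L⟧ =ᵐ[P]
      fun ω => ∏ k ∈ s, if L (k + 1) ω = n k then (Q (n k) (τ k)).toReal else 0

end OneSided

/-- The mean `μ = ∑ n p_n` of the block length distribution. -/
def meanLength (p : PMF ℕ+) : ℝ≥0∞ := ∑' n : ℕ+, ((n : ℕ) : ℝ≥0∞) * p n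

/-! ### Stationary regenerative permutations of `ℤ` -/

section TwoSided

variable {Ω : Type*} [MeasurableSpace Ω]

/-- The random set `{⋯ < T_{-1} < T_0 < T_1 < ⋯}` of renewal times in `ℤ`. -/
def renewalSetInt (T : ℤ → Ω → ℤ) (ω : Ω) : Set ℤ :=
  {z | ∃ k, T k ω = z}

/-- The event `{R*_z = 1}`. -/
def renewalEventInt (T : ℤ → Ω → ℤ) (z : ℤ) : Set Ω :=
  {ω | z ∈ renewalSetInt T ω}

/-- The pair `(Π^{*,z}, (R*_{z+1}, R*_{z+2}, …))`. -/
def futureInt (π : Ω → Equiv.Perm ℤ) (T : ℤ → Ω → ℤ) (z : ℤ) (ω : Ω) :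
    (ℕ+ → ℤ) × (ℕ+ → Prop) :=
  (residualInt (π ω) z, fun i => z + ((i : ℕ) : ℤ) ∈ renewalSetInt T ω)

/-- The past `(R*_z, R*_{z-1}, …)` of the renewal indicators. -/
def pastInt (T : ℤ → Ω → ℤ) (z : ℤ) (ω : Ω) : ℕ → Prop :=
  fun j => z - (j : ℤ) ∈ renewalSetInt T ω

/-- The law of `(Π^{*,z}, (R*_{z+1}, R*_{z+2}, …))` conditionally given `R*_z = 1`. -/
def palmLawInt (P : Measure Ω) (π : Ω → Equiv.Perm ℤ) (T : ℤ → Ω → ℤ) (z : ℤ) :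
    Measure ((ℕ+ → ℤ) × (ℕ+ → Prop)) :=
  (P[|renewalEventInt T z]).map (futureInt π T z)

/-- The law of the random permutation, as a random element of `ℤ → ℤ`. -/
def permLaw (P : Measure Ω) (π : Ω → Equiv.Perm ℤ) : Measure (ℤ → ℤ) :=
  P.map fun ω z => π ω z

/-- The joint law of the random permutation and of the renewal indicators. -/
def jointLaw (P : Measure Ω) (π : Ω → Equiv.Perm ℤ) (T : ℤ → Ω → ℤ) :
    Measure ((ℤ → ℤ) × (ℤ → Prop)) :=
  P.map fun ω => (fun z => π ω z, fun z => z ∈ renewalSetInt T ω)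

/-- The process of displacements and renewal indicators, seen from the site `a`. -/
def displacements (π : Ω → Equiv.Perm ℤ) (T : ℤ → Ω → ℤ) (a : ℤ) (ω : Ω) : ℤ → ℤ × Prop :=
  fun z => (π ω (a + z) - (a + z), a + z ∈ renewalSetInt T ω)

/-- The random permutation `π` of `ℤ` is stationary regenerative with associated stationary
renewal process `(T k)`, indexed so that `T (-1) < 0 ≤ T 0`: displacements and renewal indicators
are jointly stationary, `π` splits at every renewal time, and conditionally given a renewal at `z`
the future after `z` has the law of a random permutation of `ℕ+` with renewal indicators with zero
delay and is independent of the renewal indicators up to `z`. -/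
structure IsStationaryRegenerative (P : Measure Ω) (π : Ω → Equiv.Perm ℤ) (T : ℤ → Ω → ℤ) :
    Prop where
  measurable_perm : ∀ i, Measurable fun ω => π ω i
  measurable_time : ∀ k, Measurable (T k)
  strictMono : ∀ᵐ ω ∂P, StrictMono fun k => T k ω
  indexing : ∀ᵐ ω ∂P, T (-1) ω < 0 ∧ 0 ≤ T 0 ω
  stationary : ∀ a : ℤ, P.map (displacements π T a) = P.map (displacements π T 0)
  splits : ∀ᵐ ω ∂P, ∀ z ∈ renewalSetInt T ω, SplitsAtInt (π ω) z
  regenerates : ∃ ρ, IsZeroDelayLaw ρ ∧ ∀ z, P (renewalEventInt T z) ≠ 0 →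
    palmLawInt P π T z = ρ ∧ IndepFun (pastInt T z) (futureInt π T z) (P[|renewalEventInt T z])

/-- The block length `Y_z = T_z - T_{z-1}`. -/
def blockLength (T : ℤ → Ω → ℤ) (z : ℤ) (ω : Ω) : ℤ := T z ω - T (z - 1) ω

/-- The σ-algebra generated by all the block lengths. -/
abbrev lengthAlgebraInt (T : ℤ → Ω → ℤ) : MeasurableSpace Ω :=
  MeasurableSpace.comap (fun ω z => blockLength T z ω) MeasurableSpace.pi

/-- The σ-algebra generated by all the block lengths and `T_0`. -/
abbrev lengthDelayAlgebra (T : ℤ → Ω → ℤ) : MeasurableSpace Ω :=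
  lengthAlgebraInt T ⊔ MeasurableSpace.comap (T 0) inferInstance

/-- The event that the block `(T_{k-1}, T_k]` has length `n` and reduced permutation `τ`. -/
def blockEventInt (π : Ω → Equiv.Perm ℤ) (T : ℤ → Ω → ℤ) (k : ℤ) (n : ℕ)
    (τ : Equiv.Perm (Fin n)) : Set Ω :=
  {ω | blockLength T k ω = n ∧ HasReducedBlockInt (π ω) (T (k - 1) ω) n τ}

open Classical in
/-- The block structure of the stationary version: the block lengths are independent, `Y_z` for
`z ≠ 0` with law `p` and `Y_0` with the size-biased law; given all the block lengths, `T_0` is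
uniform on `{0, …, Y_0 - 1}`; given all the block lengths and `T_0`, the reduced blocks are
independent with laws `Q (Y_z)`. -/
structure HasBlockStructure (P : Measure Ω) (π : Ω → Equiv.Perm ℤ) (T : ℤ → Ω → ℤ)
    (p : PMF ℕ+) (Q : ∀ n : ℕ, PMF (Equiv.Perm (Fin n))) : Prop where
  indep : iIndepFun (blockLength T) P
  length_law : ∀ z : ℤ, z ≠ 0 → ∀ n : ℕ+, P {ω | blockLength T z ω = (n : ℕ)} = p n
  size_biased : ∀ n : ℕ+,
    P {ω | blockLength T 0 ω = (n : ℕ)} = ((n : ℕ) : ℝ≥0∞) * p n / meanLength p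
  delay_uniform : ∀ j : ℕ, P⟦{ω | T 0 ω = j} | lengthAlgebraInt T⟧ =ᵐ[P]
    fun ω => if (j : ℤ) < blockLength T 0 ω then 1 / (blockLength T 0 ω : ℝ) else 0
  blocks : ∀ (s : Finset ℤ) (n : ℤ → ℕ) (τ : ∀ k, Equiv.Perm (Fin (n k))),
    P⟦⋂ k ∈ s, blockEventInt π T k (n k) (τ k) | lengthDelayAlgebra T⟧ =ᵐ[P]
      fun ω => ∏ k ∈ s, if blockLength T k ω = n k then (Q (n k) (τ k)).toReal else 0

end TwoSided

/-- `(π', T')` is a stationary version on `ℤ` of the regenerative permutation `(π, L)` of `ℕ+`: it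
is stationary regenerative, and its future given a renewal at any `z` has the same law as the
future of `(π, L)` given a renewal at any `n ≥ 1` where a renewal is possible. -/
def IsStationaryVersion {Ω Ω' : Type*} [MeasurableSpace Ω] [MeasurableSpace Ω']
    (P : Measure Ω) (π : Ω → Equiv.Perm ℕ+) (L : ℕ → Ω → ℕ∞)
    (P' : Measure Ω') (π' : Ω' → Equiv.Perm ℤ) (T' : ℤ → Ω' → ℤ) : Prop :=
  IsStationaryRegenerative P' π' T' ∧
    ∀ (z : ℤ) (n : ℕ), 0 < n → P (renewalEvent L n) ≠ 0 →
      palmLawInt P' π' T' z = palmLaw P π L n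

/-- The same, where only the laws of the residual permutations are compared, without their
renewal indicators. -/
def IsWeakStationaryVersion {Ω Ω' : Type*} [MeasurableSpace Ω] [MeasurableSpace Ω']
    (P : Measure Ω) (π : Ω → Equiv.Perm ℕ+) (L : ℕ → Ω → ℕ∞)
    (P' : Measure Ω') (π' : Ω' → Equiv.Perm ℤ) (T' : ℤ → Ω' → ℤ) : Prop :=
  IsStationaryRegenerative P' π' T' ∧
    ∀ (z : ℤ) (n : ℕ), 0 < n → P (renewalEvent L n) ≠ 0 →
      (palmLawInt P' π' T' z).map Prod.fst = (palmLaw P π L n).map Prod.fst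

end RegenPerm

end

/-!
A block is a length together with a permutation of that many points; `p` and `Q` give a law for
blocks, and `canonicalLaw p Q` is the law of the concatenation of i.i.d. blocks, as a sequence of
values together with its renewal indicators. Such a law is determined by the probabilities of the
events `startsWith b K` that the first `K` blocks are given ones (`trajectory_law_ext`). For a
recurrent regenerative permutation these probabilities, given a renewal at `n`, are obtained by
summing over the number of the renewal; so its Palm law is canonical, for every `n`
(`IsRecurrentRegenerative.palmLaw_eq`).

For a stationary regenerative permutation of `ℤ`, decompose according to the last renewal before a
site: `1 = P(R_0 = 1) * ∑ j, P(no renewal in 1, …, j | R_0 = 1)` (`intensity_mul_tsum`). The last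
factor is the mean block length, which gives the intensity `1 / μ` in the direct part and positive
recurrence in the converse. The same decomposition of an arbitrary event `B` of the future, and its
version given a renewal at the origin, show that the probabilities of the futures after `0, 1, 2, …`
given this renewal converge to the stationary probability of `B`, in the sense of Cesàro
(`tendsto_cesaro`); the point is that the renewal equations for `B` and for the sure event differ
by a summable sequence with sum zero, convolved with numbers in `[0, 1]`. Hence the Palm law
determines the stationary law, and if only permutations are observed, the Palm law of the residual
permutation determines the law of the permutation, whatever the renewal times.

The stationary version is built on pairs `(j, b)` of the right end `j` of the block which contains
the origin and a doubly infinite sequence of blocks, under the product of counting measure and the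
i.i.d. law, restricted to `0 ≤ j < len (b 0)` and normalized. Moving the origin by one site
preserves this measure (`measurePreserving_translateOrigin`). The past and the future of a renewal
depend on disjoint sets of blocks, which gives regeneration.

The block structure of any stationary version follows by reading off a finite window of blocks from
the renewal at the left end of its first block (`IsStationaryRegenerative.measure_blocks`). The
conditional probabilities given the lengths and the delay are then identified on windows
(`condExp_eq_of_window`).
-/

namespace RegenPerm

/-! ### Measures and conditional probabilities on sequences of discrete variables -/

section DiscreteSequences

variable {ι E F : Type*} [MeasurableSpace E] [Countable E] [MeasurableSingletonClass E]
  [MeasurableSpace F] [Countable F] [MeasurableSingletonClass F]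

/-- The set of sequences which agree with `l` at the indices in `s`. -/
def window (s : Finset ι) (l : ι → E) : Set (ι → E) := {x | ∀ i ∈ s, x i = l i}

omit [Countable E] in
lemma measurableSet_window (s : Finset ι) (l : ι → E) : MeasurableSet (window s l) := by
  have : window s l = ⋂ i ∈ s, (fun x : ι → E => x i) ⁻¹' {l i} := by
    ext x; simp [window]
  rw [this]
  exact Finset.measurableSet_biInter s fun i _ => measurable_pi_apply i (measurableSet_singleton _)

/-- Finite measures on sequences of discrete variables are equal if they agree on the windows
over a cofinal family of finite index sets. -/
lemma measure_ext_of_window [Nonempty E] {μ ν : Measure (ι → E)} [IsFiniteMeasure μ]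
    [IsFiniteMeasure ν] (S : Set (Finset ι)) (hS : ∀ t : Finset ι, ∃ s ∈ S, t ⊆ s)
    (h : ∀ s ∈ S, ∀ l, μ (window s l) = ν (window s l)) : μ = ν := by
  classical
  have key : ∀ s ∈ S, μ.map s.restrict = ν.map s.restrict := by
    intro s hs
    refine Measure.ext_of_singleton fun a => ?_
    let l : ι → E := fun i => if hi : i ∈ s then a ⟨i, hi⟩ else Classical.arbitrary E
    have hpre : (s.restrict : (ι → E) → _) ⁻¹' {a} = window s l := by
      ext x
      simp only [Set.mem_preimage, Set.mem_singleton_iff, window, Set.mem_ofPred_eq]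
      constructor
      · rintro rfl i hi
        simp [l, hi]
      · intro hx
        ext ⟨i, hi⟩
        simpa [l, hi] using hx i hi
    rw [Measure.map_apply (Finset.measurable_restrict s) (measurableSet_singleton a),
      Measure.map_apply (Finset.measurable_restrict s) (measurableSet_singleton a), hpre]
    exact h s hs l
  have key2 : ∀ t : Finset ι, μ.map t.restrict = ν.map t.restrict := by
    intro t
    obtain ⟨s, hs, hts⟩ := hS t
    have hcomp : (t.restrict : (ι → E) → _) = Finset.restrict₂ hts ∘ s.restrict := rfl
    rw [hcomp, ← Measure.map_map (Finset.measurable_restrict₂ hts) (Finset.measurable_restrict s),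
      ← Measure.map_map (Finset.measurable_restrict₂ hts) (Finset.measurable_restrict s),
      key s hs]
  exact IsProjectiveLimit.unique (P := fun t => ν.map t.restrict) key2 fun _ => rfl

/-- The analogue of `measure_ext_of_window` for pairs of sequences. -/
lemma measure_ext_of_window_prod [Nonempty E] [Nonempty F] {μ ν : Measure ((ι → E) × (ι → F))}
    [IsFiniteMeasure μ] [IsFiniteMeasure ν] (S : Set (Finset ι))
    (hS : ∀ t : Finset ι, ∃ s ∈ S, t ⊆ s)
    (h : ∀ s ∈ S, ∀ (l : ι → E) (m : ι → F), μ {x | ∀ i ∈ s, x.1 i = l i ∧ x.2 i = m i}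
      = ν {x | ∀ i ∈ s, x.1 i = l i ∧ x.2 i = m i}) : μ = ν := by
  let e := (MeasurableEquiv.arrowProdEquivProdArrow E F ι).symm
  have hpre : ∀ (s : Finset ι) (l : ι → E × F),
      e ⁻¹' (window s l) = {x | ∀ i ∈ s, x.1 i = (l i).1 ∧ x.2 i = (l i).2} := by
    intro s l
    ext x
    simp only [Set.mem_preimage, window, Set.mem_ofPred_eq, Prod.ext_iff]
    rfl
  have : μ.map e = ν.map e := by
    refine measure_ext_of_window S hS fun s hs l => ?_
    rw [MeasurableEquiv.map_apply, MeasurableEquiv.map_apply, hpre]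
    exact h s hs _ _
  exact (MeasurableEquiv.map_measurableEquiv_injective e) this

/-- A function of a sequence of discrete variables which depends on finitely many coordinates is
measurable. -/
lemma measurable_of_finset_dependence [Nonempty E] {G : Type*} [MeasurableSpace G] (s : Finset ι)
    (g : (ι → E) → G) (hg : ∀ x y, (∀ i ∈ s, x i = y i) → g x = g y) : Measurable g := by
  classical
  let ext : (s → E) → ι → E := fun a i =>
    if hi : i ∈ s then a ⟨i, hi⟩ else Classical.arbitrary E
  have : g = (g ∘ ext) ∘ s.restrict := by
    funext x
    refine hg _ _ fun i hi => ?_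
    simp [ext, hi]
  rw [this]
  exact (measurable_of_countable _).comp (Finset.measurable_restrict s)

/-- Recognition of a conditional probability given a sequence `X` of discrete variables: it
suffices to check a candidate `g`, which depends on finitely many coordinates, on windows. -/
lemma condExp_eq_of_window [Nonempty E] {Ω : Type*} [MeasurableSpace Ω] {P : Measure Ω}
    [IsProbabilityMeasure P] {X : Ω → ι → E} (hX : Measurable X) {A : Set Ω}
    (hA : NullMeasurableSet A P)
    {g : (ι → E) → ℝ} (hg0 : ∀ x, 0 ≤ g x) (hg1 : ∀ x, g x ≤ 1) (s₀ : Finset ι)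
    (hg : ∀ x y, (∀ i ∈ s₀, x i = y i) → g x = g y)
    (h : ∀ s, s₀ ⊆ s → ∀ l,
      P (A ∩ X ⁻¹' window s l) = ENNReal.ofReal (g l) * P (X ⁻¹' window s l)) :
    P⟦A | MeasurableSpace.comap X MeasurableSpace.pi⟧ =ᵐ[P] fun ω => g (X ω) := by
  classical
  have hgm : Measurable g := measurable_of_finset_dependence s₀ g hg
  have hle : MeasurableSpace.comap X MeasurableSpace.pi ≤ (inferInstance : MeasurableSpace Ω) :=
    hX.comap_le
  have hfin : ∫⁻ x, ENNReal.ofReal (g x) ∂(P.map X) ≠ ∞ := by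
    rw [lintegral_map hgm.ennreal_ofReal hX]
    refine ne_of_lt (lt_of_le_of_lt (lintegral_mono (g := fun _ => 1) fun ω => ?_) ?_)
    · simpa using ENNReal.ofReal_le_ofReal (hg1 (X ω))
    · simp
  have hmeas : (P.restrict A).map X = (P.map X).withDensity fun x => ENNReal.ofReal (g x) := by
    have : IsFiniteMeasure ((P.map X).withDensity fun x => ENNReal.ofReal (g x)) :=
      isFiniteMeasure_withDensity hfin
    refine measure_ext_of_window {s | s₀ ⊆ s}
      (fun t => ⟨s₀ ∪ t, Finset.subset_union_left, Finset.subset_union_right⟩) fun s hs l => ?_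
    have hw := measurableSet_window s l
    rw [Measure.map_apply hX hw, withDensity_apply _ hw, Measure.restrict_apply (hX hw),
      Set.inter_comm, h s hs l, setLIntegral_congr_fun (g := fun _ => ENNReal.ofReal (g l)) hw,
      setLIntegral_const, Measure.map_apply hX hw]
    intro x hx
    have : g x = g l := hg x l fun i hi => hx i (hs hi)
    simp [this]
  have hgi : Integrable (fun ω => g (X ω)) P :=
    Integrable.of_bound (hgm.comp hX).aestronglyMeasurable 1 (Filter.Eventually.of_forall fun ω => by
      rw [Real.norm_eq_abs, abs_of_nonneg (hg0 _)]; exact hg1 _)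
  have hAi : Integrable (A.indicator fun _ => (1 : ℝ)) P :=
    (integrable_const (1 : ℝ)).indicator₀ hA
  refine (ae_eq_condExp_of_forall_setIntegral_eq hle hAi (fun _ _ _ => hgi.integrableOn)
    ?_ ?_).symm
  · rintro _ ⟨S, hS, rfl⟩ -
    have h1 : ∫ ω in X ⁻¹' S, g (X ω) ∂P
        = (∫⁻ ω in X ⁻¹' S, ENNReal.ofReal (g (X ω)) ∂P).toReal := by
      rw [integral_eq_lintegral_of_nonneg_ae (Filter.Eventually.of_forall fun ω => hg0 _)
        (hgm.comp hX).aestronglyMeasurable]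
    have h2 : ∫⁻ ω in X ⁻¹' S, ENNReal.ofReal (g (X ω)) ∂P = P (A ∩ X ⁻¹' S) := by
      have := congrArg (fun m => m S) hmeas
      rw [Measure.map_apply hX hS, withDensity_apply _ hS, Measure.restrict_apply (hX hS),
        Measure.restrict_map hX hS, lintegral_map hgm.ennreal_ofReal hX] at this
      rw [← this, Set.inter_comm]
    have h3 : ∫ ω in X ⁻¹' S, A.indicator (fun _ => (1 : ℝ)) ω ∂P
        = (P (A ∩ X ⁻¹' S)).toReal := by
      rw [integral_indicator₀ (hA.mono_ac Measure.absolutelyContinuous_restrict)]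
      rw [Measure.restrict_restrict₀ (hA.mono_ac Measure.absolutelyContinuous_restrict)]
      simp [Measure.real]
    rw [h1, h2, h3]
  · have : Measurable[MeasurableSpace.comap X MeasurableSpace.pi] fun ω => g (X ω) :=
      hgm.comp (comap_measurable X)
    exact (this.stronglyMeasurable).aestronglyMeasurable

end DiscreteSequences

/-! ### Blocks, and the law of an i.i.d. concatenation of blocks -/

/-- A block: its length, and a permutation of that many points. -/
structure Block where
  len : ℕ+
  perm : Equiv.Perm (Fin len)

instance : MeasurableSpace Block := ⊤

instance : DiscreteMeasurableSpace Block := ⟨fun _ => trivial⟩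

instance : Countable Block :=
  Function.Injective.countable (β := Σ n : ℕ+, Equiv.Perm (Fin n))
    (f := fun b => ⟨b.len, b.perm⟩) (by rintro ⟨n, σ⟩ ⟨m, τ⟩ h; cases h; rfl)

instance : Inhabited Block := ⟨⟨1, 1⟩⟩

/-- The law of a block with length distribution `p` and permutation governed by `Q`. -/
noncomputable def blockPMF (p : PMF ℕ+) (Q : ∀ n : ℕ, PMF (Equiv.Perm (Fin n))) : PMF Block :=
  p.bind fun n => (Q n).map (Block.mk n)

lemma blockPMF_apply (p : PMF ℕ+) (Q : ∀ n : ℕ, PMF (Equiv.Perm (Fin n))) (b : Block) :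
    blockPMF p Q b = p b.len * Q b.len b.perm := by
  obtain ⟨n, τ⟩ := b
  rw [blockPMF, PMF.bind_apply, tsum_eq_single n]
  · congr 1
    rw [PMF.map_apply, tsum_eq_single τ]
    · simp
    · intro σ hσ
      rw [if_neg]
      intro h
      cases h
      exact hσ rfl
  · intro m hm
    rw [PMF.map_apply, ENNReal.tsum_eq_zero.2, mul_zero]
    intro σ
    rw [if_neg]
    intro h
    cases h
    exact hm rfl

/-- `blockPMF` as a measure. -/
noncomputable def blockMeasure (p : PMF ℕ+) (Q : ∀ n : ℕ, PMF (Equiv.Perm (Fin n))) :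
    Measure Block := (blockPMF p Q).toMeasure

instance (p : PMF ℕ+) (Q : ∀ n : ℕ, PMF (Equiv.Perm (Fin n))) :
    IsProbabilityMeasure (blockMeasure p Q) :=
  PMF.toMeasure.isProbabilityMeasure _

lemma blockMeasure_singleton (p : PMF ℕ+) (Q : ∀ n : ℕ, PMF (Equiv.Perm (Fin n))) (b : Block) :
    blockMeasure p Q {b} = p b.len * Q b.len b.perm := by
  rw [blockMeasure, PMF.toMeasure_apply_singleton _ _ (measurableSet_singleton _), blockPMF_apply]

lemma blockMeasure_len_eq (p : PMF ℕ+) (Q : ∀ n : ℕ, PMF (Equiv.Perm (Fin n))) (n : ℕ+) :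
    blockMeasure p Q {b | b.len = n} = p n := by
  let _ : MeasurableSpace ℕ+ := ⊤
  have : DiscreteMeasurableSpace ℕ+ := ⟨fun _ => trivial⟩
  have hm : Measurable Block.len := measurable_of_countable _
  have hmap : (blockMeasure p Q).map Block.len = p.toMeasure := by
    rw [blockMeasure, PMF.toMeasure_map _ _ hm, blockPMF, PMF.map_bind]
    have : (fun n => PMF.map Block.len (PMF.map (Block.mk n) (Q n))) = PMF.pure := by
      funext n
      rw [PMF.map_comp]
      exact PMF.map_const _ _
    rw [this, PMF.bind_pure]
  have h2 := Measure.map_apply (μ := blockMeasure p Q) hm (measurableSet_singleton n)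
  rw [hmap, PMF.toMeasure_apply_singleton _ _ (measurableSet_singleton _)] at h2
  rw [h2]
  rfl

/-- The law of a doubly infinite sequence of i.i.d. blocks. -/
noncomputable def iidBlocks (p : PMF ℕ+) (Q : ∀ n : ℕ, PMF (Equiv.Perm (Fin n))) :
    Measure (ℤ → Block) := Measure.infinitePi fun _ => blockMeasure p Q

instance (p : PMF ℕ+) (Q : ∀ n : ℕ, PMF (Equiv.Perm (Fin n))) :
    IsProbabilityMeasure (iidBlocks p Q) := by
  unfold iidBlocks; infer_instance

lemma iidBlocks_window (p : PMF ℕ+) (Q : ∀ n : ℕ, PMF (Equiv.Perm (Fin n))) (s : Finset ℤ)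
    (b : ℤ → Block) :
    iidBlocks p Q (window s b) = ∏ z ∈ s, blockMeasure p Q {b z} := by
  rw [iidBlocks, ← Measure.infinitePi_pi _ fun z _ => measurableSet_singleton (b z)]
  congr 1

lemma iidBlocks_box (p : PMF ℕ+) (Q : ∀ n : ℕ, PMF (Equiv.Perm (Fin n))) (s : Finset ℤ)
    (A : ℤ → Set Block) :
    iidBlocks p Q {b | ∀ z ∈ s, b z ∈ A z} = ∏ z ∈ s, blockMeasure p Q (A z) := by
  rw [iidBlocks, ← Measure.infinitePi_pi _ fun z _ => (MeasurableSet.of_discrete (s := A z))]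
  congr 1

/-- Sequences of values of a residual permutation, with sequences of renewal indicators. -/
abbrev Trajectory : Type := (ℕ+ → ℤ) × (ℕ+ → Prop)

/-- In the trajectory `x`, the sites `a + 1, …, a + len` carry the block `β`. -/
def BlockAt (x : Trajectory) (a : ℕ) (β : Block) : Prop :=
  ∀ j : Fin β.len, x.1 (shiftPNat a (Nat.succPNat j)) = a + (((β.perm j : ℕ) : ℤ) + 1) ∧
    (x.2 (shiftPNat a (Nat.succPNat j)) ↔ (j : ℕ) + 1 = β.len)

/-- The total length of the blocks `b 0, …, b (K - 1)`. -/
def offset (b : ℕ → Block) (K : ℕ) : ℕ := ∑ k ∈ Finset.range K, ((b k).len : ℕ)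

/-- The set of trajectories whose first `K` blocks are `b 0, …, b (K - 1)`. -/
def startsWith (b : ℕ → Block) (K : ℕ) : Set Trajectory :=
  {x | ∀ k < K, BlockAt x (offset b k) (b k)}

@[simp] lemma offset_zero (b : ℕ → Block) : offset b 0 = 0 := rfl

lemma offset_succ (b : ℕ → Block) (K : ℕ) : offset b (K + 1) = offset b K + (b K).len :=
  Finset.sum_range_succ _ _

lemma le_offset (b : ℕ → Block) (K : ℕ) : K ≤ offset b K := by
  induction K with
  | zero => simp
  | succ K ih => have := (b K).len.pos; rw [offset_succ]; omega

lemma offset_congr {b b' : ℕ → Block} {K : ℕ} (h : ∀ k < K, b k = b' k) :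
    offset b K = offset b' K :=
  Finset.sum_congr rfl fun k hk => by rw [h k (Finset.mem_range.1 hk)]

lemma startsWith_congr {b b' : ℕ → Block} {K : ℕ} (h : ∀ k < K, b k = b' k) :
    startsWith b K = startsWith b' K := by
  ext x
  refine forall₂_congr fun k hk => ?_
  rw [h k hk, offset_congr fun i hi => h i (hi.trans hk)]

lemma measurableSet_blockAt (a : ℕ) (β : Block) :
    MeasurableSet {x : Trajectory | BlockAt x a β} := by
  simp only [BlockAt, Set.ofPred_forall]
  refine MeasurableSet.iInter fun j => ?_
  refine MeasurableSet.inter ?_ ?_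
  · exact measurableSet_eq_fun ((measurable_pi_apply _).comp measurable_fst) measurable_const
  · have : Measurable fun x : Trajectory => x.2 (shiftPNat a (Nat.succPNat j)) :=
      (measurable_pi_apply _).comp measurable_snd
    exact this (MeasurableSet.of_discrete (s := {q : Prop | q ↔ (j : ℕ) + 1 = β.len}))

lemma measurableSet_startsWith (b : ℕ → Block) (K : ℕ) : MeasurableSet (startsWith b K) := by
  simp only [startsWith, Set.ofPred_forall]
  exact MeasurableSet.iInter fun k => MeasurableSet.iInter fun _ => measurableSet_blockAt _ _

lemma BlockAt.len_le {x : Trajectory} {a : ℕ} {β β' : Block} (h : BlockAt x a β)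
    (h' : BlockAt x a β') : β'.len ≤ β.len := by
  by_contra! hlt
  have hpos := β.len.pos
  have hlt' : (β.len : ℕ) < β'.len := hlt
  have h1 := (h ⟨β.len - 1, by omega⟩).2
  have h2 := (h' ⟨β.len - 1, by omega⟩).2
  have h3 := h1.2 (by simp only; omega)
  have h4 := h2.1 h3
  simp only at h4
  omega

/-- A trajectory determines the block which starts at a given site. -/
lemma BlockAt.unique {x : Trajectory} {a : ℕ} {β β' : Block} (h : BlockAt x a β)
    (h' : BlockAt x a β') : β = β' := by
  have hlen : β.len = β'.len := le_antisymm (h'.len_le h) (h.len_le h')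
  obtain ⟨n, σ⟩ := β
  obtain ⟨m, τ⟩ := β'
  obtain rfl : n = m := hlen
  congr 1
  ext j
  have h1 := (h j).1
  have h2 := (h' j).1
  simp only at h1 h2
  omega

lemma startsWith_inj {b b' : ℕ → Block} {K : ℕ} {x : Trajectory} (h : x ∈ startsWith b K)
    (h' : x ∈ startsWith b' K) : ∀ k < K, b k = b' k := by
  intro k
  induction k using Nat.strong_induction_on with
  | _ k ih =>
    intro hk
    have h2 := h' k hk
    rw [← offset_congr (b := b) fun i hi => ih i hi (hi.trans hk)] at h2
    exact (h k hk).unique h2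

/-- Every site up to `offset b K` lies in one of the first `K` blocks. -/
lemma exists_block_of_le_offset (b : ℕ → Block) {K : ℕ} {i : ℕ+} (hi : (i : ℕ) ≤ offset b K) :
    ∃ k < K, ∃ j : Fin (b k).len, i = shiftPNat (offset b k) (Nat.succPNat j) := by
  induction K with
  | zero => have := i.pos; simp at hi
  | succ K ih =>
    by_cases h : (i : ℕ) ≤ offset b K
    · obtain ⟨k, hk, j, hj⟩ := ih h
      exact ⟨k, by omega, j, hj⟩
    · rw [offset_succ] at hi
      refine ⟨K, by omega, ⟨i - offset b K - 1, by have := (b K).len.pos; omega⟩, ?_⟩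
      apply PNat.coe_injective
      simp only [shiftPNat, PNat.mk_coe, Nat.succPNat_coe, Nat.succ_eq_add_one]
      omega

lemma startsWith_agree {b : ℕ → Block} {K : ℕ} {x y : Trajectory} (hx : x ∈ startsWith b K)
    (hy : y ∈ startsWith b K) {i : ℕ+} (hi : (i : ℕ) ≤ K) : x.1 i = y.1 i ∧ x.2 i = y.2 i := by
  obtain ⟨k, hk, j, rfl⟩ := exists_block_of_le_offset b (hi.trans (le_offset b K))
  have h1 := hx k hk j
  have h2 := hy k hk j
  exact ⟨h1.1.trans h2.1.symm, propext (h1.2.trans h2.2.symm)⟩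

/-- The law of a trajectory is determined by the laws of its initial blocks, if it almost surely is
a concatenation of blocks. -/
lemma trajectory_law_ext {ρ₁ ρ₂ : Measure Trajectory} [IsProbabilityMeasure ρ₁]
    [IsProbabilityMeasure ρ₂] (h : ∀ b K, ρ₁ (startsWith b K) = ρ₂ (startsWith b K))
    (hfull : ∀ᵐ x ∂ρ₂, ∀ K, ∃ b, x ∈ startsWith b K) : ρ₁ = ρ₂ := by
  classical
  let e : ∀ K : ℕ, (Fin K → Block) → ℕ → Block := fun K a k =>
    if hk : k < K then a ⟨k, hk⟩ else default
  have hdisj : ∀ K, Pairwise (Function.onFun Disjoint fun a => startsWith (e K a) K) := by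
    intro K a a' haa
    refine Set.disjoint_left.2 fun x hx hx' => haa ?_
    funext k
    simpa [e] using startsWith_inj hx hx' k k.2
  have hunion : ∀ K, ρ₂ (⋃ a, startsWith (e K a) K)ᶜ = 0 := by
    intro K
    rw [← mem_ae_iff]
    filter_upwards [hfull] with x hx
    obtain ⟨b, hb⟩ := hx K
    refine Set.mem_iUnion.2 ⟨fun k => b k, ?_⟩
    rwa [startsWith_congr (b' := b)]
    intro k hk
    simp [e, hk]
  have hms : ∀ K, MeasurableSet (⋃ a, startsWith (e K a) K) := fun K =>
    MeasurableSet.iUnion fun a => measurableSet_startsWith _ _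
  have hunion1 : ∀ K, ρ₁ (⋃ a, startsWith (e K a) K)ᶜ = 0 := by
    intro K
    rw [prob_compl_eq_zero_iff (hms K)]
    have := hunion K
    rw [prob_compl_eq_zero_iff (hms K)] at this
    rw [← this, measure_iUnion (hdisj K) fun a => measurableSet_startsWith _ _,
      measure_iUnion (hdisj K) fun a => measurableSet_startsWith _ _]
    exact tsum_congr fun a => h _ _
  refine measure_ext_of_window_prod {s | ∃ K : ℕ+, s = Finset.Icc 1 K} (fun t => ?_) ?_
  · refine ⟨Finset.Icc 1 (t.sup id + 1), ⟨_, rfl⟩, fun i hi => ?_⟩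
    have : i ≤ t.sup id := Finset.le_sup (f := id) hi
    exact Finset.mem_Icc.2 ⟨one_le, this.trans (PNat.lt_add_right _ _).le⟩
  · rintro _ ⟨K, rfl⟩ l m
    set C : Set Trajectory := {x | ∀ i ∈ Finset.Icc 1 K, x.1 i = l i ∧ x.2 i = m i} with hC
    have hCm : MeasurableSet C := by
      simp only [hC, Set.ofPred_forall]
      refine MeasurableSet.iInter fun i => MeasurableSet.iInter fun _ => MeasurableSet.inter ?_ ?_
      · exact measurableSet_eq_fun ((measurable_pi_apply _).comp measurable_fst) measurable_const
      · exact measurableSet_eq_fun ((measurable_pi_apply _).comp measurable_snd) measurable_const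
    have hint : ∀ a, ρ₁ (C ∩ startsWith (e K a) K) = ρ₂ (C ∩ startsWith (e K a) K) := by
      intro a
      by_cases hne : (C ∩ startsWith (e K a) K).Nonempty
      · obtain ⟨x, hxC, hx⟩ := hne
        have : C ∩ startsWith (e K a) K = startsWith (e K a) K := by
          refine Set.inter_eq_right.2 fun y hy i hi => ?_
          have := startsWith_agree hx hy (i := i) (PNat.coe_le_coe _ _ |>.2 (Finset.mem_Icc.1 hi).2)
          rw [← this.1, ← this.2]
          exact hxC i hi
        rw [this, h]
      · rw [Set.not_nonempty_iff_eq_empty.1 hne, measure_empty, measure_empty]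
    have hdec : ∀ ρ : Measure Trajectory, ρ (⋃ a, startsWith (e K a) K)ᶜ = 0 →
        ρ C = ∑' a, ρ (C ∩ startsWith (e K a) K) := by
      intro ρ hρ
      rw [← measure_iUnion, ← Set.inter_iUnion]
      · refine (measure_inter_conull ?_).symm
        exact hρ
      · intro a a' haa
        exact (hdisj K haa).mono Set.inter_subset_right Set.inter_subset_right
      · exact fun a => hCm.inter (measurableSet_startsWith _ _)
    rw [hdec ρ₁ (hunion1 K), hdec ρ₂ (hunion K)]
    exact tsum_congr hint

/-! ### Renewal processes and regenerative permutations of the positive integers -/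

section OneSidedLemmas

variable {Ω : Type*}

lemma renewalTime_succ (L : ℕ → Ω → ℕ∞) (k : ℕ) (ω : Ω) :
    renewalTime L (k + 1) ω = renewalTime L k ω + L (k + 1) ω :=
  Finset.sum_range_succ _ _

lemma renewalTime_mono (L : ℕ → Ω → ℕ∞) (ω : Ω) : Monotone fun k => renewalTime L k ω :=
  monotone_nat_of_le_succ fun k => by
    rw [renewalTime_succ]; exact le_self_add

/-- After a renewal time `m = T_k`, the next renewal is at `m + L (k + 1)`. -/
lemma length_le_of_mem_renewalSet {L : ℕ → Ω → ℕ∞} {ω : Ω} {k m i : ℕ}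
    (hk : renewalTime L k ω = m) (hi : 0 < i) (h : m + i ∈ renewalSet L ω) :
    L (k + 1) ω ≤ i := by
  obtain ⟨l, hl⟩ := h
  have hkl : k < l := by
    by_contra! hle
    have := renewalTime_mono L ω hle
    simp only [hl, hk] at this
    have : m + i ≤ m := by exact_mod_cast this
    omega
  have := renewalTime_mono L ω (Nat.succ_le_of_lt hkl)
  simp only [Nat.succ_eq_add_one, renewalTime_succ, hl, hk] at this
  rw [Nat.cast_add] at this
  exact (ENat.add_le_add_iff_left (ENat.natCast_ne_top m)).1 this

lemma mem_renewalSet_of_length_eq {L : ℕ → Ω → ℕ∞} {ω : Ω} {k m i : ℕ}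
    (hk : renewalTime L k ω = m) (h : L (k + 1) ω = i) : m + i ∈ renewalSet L ω :=
  ⟨k + 1, by rw [renewalTime_succ, hk, h, Nat.cast_add]⟩

lemma blockAt_future_iff {π : Ω → Equiv.Perm ℕ+} {L : ℕ → Ω → ℕ∞} {ω : Ω}
    (hpos : ∀ j, L (j + 1) ω ≠ 0) {k n a : ℕ} (hk : renewalTime L k ω = (n + a : ℕ)) (β : Block) :
    BlockAt (future π L n ω) a β ↔ ω ∈ blockEvent π L k β.len β.perm := by
  have hlen : (∀ j : Fin β.len, ((future π L n ω).2 (shiftPNat a (Nat.succPNat j)) ↔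
      (j : ℕ) + 1 = β.len)) ↔ L (k + 1) ω = (β.len : ℕ) := by
    have hmem : ∀ j : ℕ, (future π L n ω).2 (shiftPNat a (Nat.succPNat j)) ↔
        (n + a) + (j + 1) ∈ renewalSet L ω := by
      intro j
      simp [future, shiftPNat, add_assoc]
    constructor
    · intro h
      have hβ := β.len.pos
      have h1 := (h ⟨β.len - 1, by omega⟩).2 (by simp only; omega)
      rw [hmem] at h1
      have h2 := length_le_of_mem_renewalSet hk (by omega) h1
      obtain ⟨l, hl⟩ := ENat.ne_top_iff_exists.1 (ne_top_of_le_ne_top (ENat.natCast_ne_top _) h2)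
      have hl0 : l ≠ 0 := by
        rintro rfl
        exact hpos k hl.symm
      have hl1 : l ≤ β.len := by
        rw [← hl] at h2
        have : l ≤ (β.len - 1 : ℕ) + 1 := by exact_mod_cast h2
        omega
      have h3 := (h ⟨l - 1, by omega⟩).1 (by
        rw [hmem]
        exact mem_renewalSet_of_length_eq hk (by rw [← hl]; congr 1; simp only; omega))
      rw [← hl, ← h3]
      congr 1
      simp only
      omega
    · intro h j
      rw [hmem]
      constructor
      · intro hj
        have := length_le_of_mem_renewalSet hk (by omega) hj
        rw [h] at this
        have : (β.len : ℕ) ≤ j + 1 := by exact_mod_cast this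
        omega
      · intro hj
        exact mem_renewalSet_of_length_eq hk (by rw [h, hj])
  have hperm : (∀ j : Fin β.len, (future π L n ω).1 (shiftPNat a (Nat.succPNat j)) =
      a + (((β.perm j : ℕ) : ℤ) + 1)) ↔ HasReducedBlock (π ω) (n + a) β.len β.perm := by
    refine forall_congr' fun j => ?_
    have : shiftPNat n (shiftPNat a (Nat.succPNat j)) = shiftPNat (n + a) (Nat.succPNat j) := by
      apply PNat.coe_injective
      simp [shiftPNat, add_assoc]
    simp only [future, residual, this]
    omega
  simp only [BlockAt, forall_and, hlen, hperm, blockEvent, Set.mem_ofPred_eq]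
  constructor
  · rintro ⟨h1, h2⟩
    exact ⟨n + a, hk, h2, h1⟩
  · rintro ⟨a', ha', h2, h1⟩
    rw [hk] at ha'
    have : n + a = a' := by exact_mod_cast ha'
    exact ⟨this ▸ h1, h2⟩

lemma startsWith_succ (b : ℕ → Block) (K : ℕ) (x : Trajectory) :
    x ∈ startsWith b (K + 1) ↔ x ∈ startsWith b K ∧ BlockAt x (offset b K) (b K) := by
  simp only [startsWith, Set.mem_ofPred_eq, Nat.forall_lt_succ_right]

lemma startsWith_future_iff {π : Ω → Equiv.Perm ℕ+} {L : ℕ → Ω → ℕ∞} {ω : Ω}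
    (hpos : ∀ j, L (j + 1) ω ≠ 0) {k n : ℕ} (hk : renewalTime L k ω = n) (b : ℕ → Block) (K : ℕ) :
    future π L n ω ∈ startsWith b K ↔
      ∀ i < K, ω ∈ blockEvent π L (k + i) (b i).len (b i).perm := by
  suffices H : (future π L n ω ∈ startsWith b K ↔
      ∀ i < K, ω ∈ blockEvent π L (k + i) (b i).len (b i).perm) ∧
      ((∀ i < K, ω ∈ blockEvent π L (k + i) (b i).len (b i).perm) →
        renewalTime L (k + K) ω = (n + offset b K : ℕ)) from H.1
  induction K with
  | zero => simp [startsWith, hk]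
  | succ K ih =>
    rw [startsWith_succ, ih.1, Nat.forall_lt_succ_right]
    refine ⟨and_congr_right fun h => blockAt_future_iff hpos (ih.2 h) _, fun h => ?_⟩
    obtain ⟨a, -, h3, -⟩ := h.2
    rw [← add_assoc, renewalTime_succ, ih.2 h.1, h3, offset_succ]
    push_cast
    ring

variable [MeasurableSpace Ω]

lemma measurable_renewalTime {L : ℕ → Ω → ℕ∞} (hL : ∀ k, Measurable (L k)) (k : ℕ) :
    Measurable (renewalTime L k) := by
  unfold renewalTime
  exact Finset.measurable_fun_sum _ fun i _ => hL i

lemma measurableSet_renewalTime_eq {L : ℕ → Ω → ℕ∞} (hL : ∀ k, Measurable (L k)) (k n : ℕ) :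
    MeasurableSet {ω | renewalTime L k ω = n} :=
  measurable_renewalTime hL k (measurableSet_singleton _)

omit [MeasurableSpace Ω] in
lemma renewalEvent_eq_iUnion (L : ℕ → Ω → ℕ∞) (n : ℕ) :
    renewalEvent L n = ⋃ k, {ω | renewalTime L k ω = n} := by
  ext ω
  simp [renewalEvent, renewalSet]

lemma measurableSet_renewalEvent {L : ℕ → Ω → ℕ∞} (hL : ∀ k, Measurable (L k)) (n : ℕ) :
    MeasurableSet (renewalEvent L n) := by
  rw [renewalEvent_eq_iUnion]
  exact MeasurableSet.iUnion fun k => measurableSet_renewalTime_eq hL k n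

lemma measurable_future {π : Ω → Equiv.Perm ℕ+} (hπ : IsRandomPerm π) {L : ℕ → Ω → ℕ∞}
    (hL : ∀ k, Measurable (L k)) (n : ℕ) : Measurable (future π L n) := by
  refine Measurable.prodMk (measurable_pi_lambda _ fun i => ?_) (measurable_pi_lambda _ fun i => ?_)
  · exact ((measurable_of_countable fun m : ℕ => (m : ℤ)).comp (hπ _)).sub_const _
  · exact measurableSet_setOfPred.1 (measurableSet_renewalEvent hL (n + i))

lemma measurableSet_blockEvent {π : Ω → Equiv.Perm ℕ+} (hπ : IsRandomPerm π) {L : ℕ → Ω → ℕ∞}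
    (hL : ∀ k, Measurable (L k)) (k n : ℕ) (τ : Equiv.Perm (Fin n)) :
    MeasurableSet (blockEvent π L k n τ) := by
  simp only [blockEvent, Set.ofPred_exists, HasReducedBlock]
  refine MeasurableSet.iUnion fun a => (measurableSet_renewalTime_eq hL k a).inter
    (MeasurableSet.inter (hL _ (measurableSet_singleton _)) ?_)
  change MeasurableSet {ω | ∀ j : Fin n, _}
  rw [Set.ofPred_forall]
  exact MeasurableSet.iInter fun j => hπ _ (measurableSet_singleton _)

/-- The events `{T_k = n}`, for `k ≥ 0`, are almost surely disjoint, so that their probabilities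
add up on `{R_n = 1}`. -/
lemma measure_renewalEvent_inter {P : Measure Ω} {L : ℕ → Ω → ℕ∞} (hL : ∀ k, Measurable (L k))
    (hpos : ∀ᵐ ω ∂P, ∀ j, L (j + 1) ω ≠ 0) (n : ℕ) {A : Set Ω} (hA : MeasurableSet A) :
    P (renewalEvent L n ∩ A) = ∑' k, P ({ω | renewalTime L k ω = n} ∩ A) := by
  rw [renewalEvent_eq_iUnion, Set.iUnion_inter]
  refine measure_iUnion₀ ?_ fun k =>
    ((measurableSet_renewalTime_eq hL k n).inter hA).nullMeasurableSet
  have hlt : ∀ᵐ ω ∂P, ∀ k l, k < l → renewalTime L k ω = n → renewalTime L l ω = n → False := by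
    filter_upwards [hpos] with ω hω k l hkl hk hl
    have h1 := renewalTime_mono L ω (Nat.succ_le_of_lt hkl)
    simp only [Nat.succ_eq_add_one, renewalTime_succ, hl, hk] at h1
    have h2 : (n : ℕ∞) + L (k + 1) ω ≤ n + 0 := by simpa using h1
    exact hω k (nonpos_iff_eq_zero.1 ((ENat.add_le_add_iff_left (ENat.natCast_ne_top n)).1 h2))
  intro k l hkl
  refine measure_eq_zero_iff_ae_notMem.2 ?_
  filter_upwards [hlt] with ω hω hmem
  rcases lt_or_gt_of_ne hkl with h | h
  · exact hω k l h hmem.1.1 hmem.2.1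
  · exact hω l k h hmem.2.1 hmem.1.1

/-- The time `T_k` is independent of the lengths of the later blocks. -/
lemma measure_renewalTime_inter_lengths {P : Measure Ω} [IsProbabilityMeasure P] {L : ℕ → Ω → ℕ∞}
    (hL : ∀ k, Measurable (L k)) (hind : iIndepFun L P) (k n : ℕ) (s : Finset ℕ)
    (hs : ∀ m ∈ s, k ≤ m) (B : ℕ → Set ℕ∞) :
    P ({ω | renewalTime L k ω = n} ∩ ⋂ m ∈ s, {ω | L (m + 1) ω ∈ B m})
      = P {ω | renewalTime L k ω = n} * ∏ m ∈ s, P {ω | L (m + 1) ω ∈ B m} := by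
  have hB : ∀ m, MeasurableSet (B m) := fun m => (Set.to_countable _).measurableSet
  have hdisj : Disjoint (Finset.range (k + 1)) (s.map ⟨Nat.succ, Nat.succ_injective⟩) := by
    refine Finset.disjoint_left.2 fun i hi hi' => ?_
    obtain ⟨m, hm, rfl⟩ := Finset.mem_map.1 hi'
    have := hs m hm
    simp only [Function.Embedding.coeFn_mk, Finset.mem_range] at hi
    omega
  have h1 := hind.indepFun_finset _ _ hdisj hL
  have hS : MeasurableSet {x : Finset.range (k + 1) → ℕ∞ | ∑ i, x i = n} :=
    (Finset.measurable_fun_sum _ fun i _ => measurable_pi_apply i) (measurableSet_singleton _)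
  have hT : MeasurableSet {x : (s.map ⟨Nat.succ, Nat.succ_injective⟩ : Finset ℕ) → ℕ∞ |
      ∀ i : (s.map ⟨Nat.succ, Nat.succ_injective⟩ : Finset ℕ), x i ∈ B (i - 1)} := by
    simp only [Set.ofPred_forall]
    exact MeasurableSet.iInter fun i => measurable_pi_apply i (hB _)
  have h2 := h1.measure_inter_preimage_eq_mul _ _ hS hT
  have e1 : (fun a (i : Finset.range (k + 1)) => L i a) ⁻¹' {x | ∑ i, x i = n}
      = {ω | renewalTime L k ω = n} := by
    ext ω
    simp only [Set.mem_preimage, Set.mem_ofPred_eq, renewalTime]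
    rw [Finset.sum_coe_sort (Finset.range (k + 1)) (fun i => L i ω)]
  have e2 : (fun a (i : (s.map ⟨Nat.succ, Nat.succ_injective⟩ : Finset ℕ)) => L i a) ⁻¹'
      {x | ∀ i : (s.map ⟨Nat.succ, Nat.succ_injective⟩ : Finset ℕ), x i ∈ B (i - 1)} =
        ⋂ m ∈ s, {ω | L (m + 1) ω ∈ B m} := by
    ext ω
    simp
  rw [e1, e2] at h2
  rw [h2]
  congr 1
  have h3 : iIndepFun (fun m => L (m + 1)) P :=
    hind.precomp (g := fun m : ℕ => m + 1) (fun a b h => by simpa using h)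
  exact h3.measure_inter_preimage_eq_mul s fun m _ => hB m

section Recurrent

variable {P : Measure Ω} [IsProbabilityMeasure P] {π : Ω → Equiv.Perm ℕ+} {L : ℕ → Ω → ℕ∞}
  {p : PMF ℕ+} {Q : ∀ n : ℕ, PMF (Equiv.Perm (Fin n))}

lemma IsRecurrentRegenerative.length_mem (h : IsRecurrentRegenerative P π L p Q) (k : ℕ) :
    ∀ᵐ ω ∂P, ∃ n : ℕ+, L (k + 1) ω = (n : ℕ) := by
  have hm : ∀ n : ℕ+, MeasurableSet {ω | L (k + 1) ω = ((n : ℕ) : ℕ∞)} := fun n =>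
    h.measurable _ (measurableSet_singleton _)
  have h1 : P (⋃ n : ℕ+, {ω | L (k + 1) ω = ((n : ℕ) : ℕ∞)}) = 1 := by
    rw [measure_iUnion _ hm, tsum_congr fun n => h.length_law k n, p.tsum_coe]
    intro n m hnm
    refine Set.disjoint_left.2 fun ω hn hm' => hnm ?_
    have := (hn : L (k + 1) ω = _).symm.trans hm'
    exact PNat.coe_injective (by exact_mod_cast this)
  have h2 := (prob_compl_eq_zero_iff (MeasurableSet.iUnion hm)).2 h1
  filter_upwards [mem_ae_iff.2 h2] with ω hω
  simpa using hω

lemma IsRecurrentRegenerative.length_pos (h : IsRecurrentRegenerative P π L p Q) :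
    ∀ᵐ ω ∂P, ∀ j, L (j + 1) ω ≠ 0 := by
  filter_upwards [ae_all_iff.2 h.length_mem] with ω hω j
  obtain ⟨n, hn⟩ := hω j
  rw [hn]
  exact_mod_cast n.pos.ne'

/-- Given a renewal time `T_k = n`, the next blocks are i.i.d. -/
lemma IsRecurrentRegenerative.measure_blocks (h : IsRecurrentRegenerative P π L p Q) (k n : ℕ)
    (b : ℕ → Block) (K : ℕ) :
    P ({ω | renewalTime L k ω = n} ∩
        {ω | ∀ i < K, ω ∈ blockEvent π L (k + i) (b i).len (b i).perm})
      = P {ω | renewalTime L k ω = n} * ∏ i ∈ Finset.range K, blockMeasure p Q {b i} := by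
  classical
  set S : Set Ω := {ω | renewalTime L k ω = n} with hSdef
  let s : Finset ℕ := (Finset.range K).map (addLeftEmbedding k)
  let N : ℕ → ℕ := fun m => (b (m - k)).len
  let τ : ∀ m, Equiv.Perm (Fin (N m)) := fun m => (b (m - k)).perm
  set A : Set Ω := ⋂ m ∈ s, blockEvent π L m (N m) (τ m) with hAdef
  have hA : {ω | ∀ i < K, ω ∈ blockEvent π L (k + i) (b i).len (b i).perm} = A := by
    ext ω
    simp only [hAdef, Set.mem_ofPred_eq, Set.mem_iInter, s, Finset.mem_map, Finset.mem_range,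
      addLeftEmbedding_apply, forall_exists_index, and_imp, forall_apply_eq_imp_iff₂, N, τ]
    refine forall₂_congr fun i _ => ?_
    rw [Nat.add_sub_cancel_left]
  have hAm : MeasurableSet A :=
    Finset.measurableSet_biInter _ fun m _ =>
      measurableSet_blockEvent h.randomPerm h.measurable _ _ _
  have hSm : MeasurableSet S := measurableSet_renewalTime_eq h.measurable k n
  have hle : lengthAlgebra L ≤ (inferInstance : MeasurableSpace Ω) :=
    (measurable_pi_lambda (fun ω k => L k ω) h.measurable).comap_le
  have hSL : MeasurableSet[lengthAlgebra L] S := by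
    refine @measurableSet_renewalTime_eq Ω (lengthAlgebra L) L (fun j => ?_) k n
    exact (measurable_pi_apply j).comp (comap_measurable fun ω k => L k ω)
  have hB : MeasurableSet (⋂ m ∈ s, {ω | L (m + 1) ω ∈ ({(N m : ℕ∞)} : Set ℕ∞)}) :=
    Finset.measurableSet_biInter _ fun m _ => h.measurable _ (measurableSet_singleton _)
  have h1 : (P (S ∩ A)).toReal = ∫ ω in S, A.indicator (fun _ => (1 : ℝ)) ω ∂P := by
    rw [integral_indicator hAm, Measure.restrict_restrict hAm, Set.inter_comm]
    simp [Measure.real]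
  have h2 : ∫ ω in S, A.indicator (fun _ => (1 : ℝ)) ω ∂P
      = ∫ ω in S, ∏ m ∈ s, (if L (m + 1) ω = N m then (Q (N m) (τ m)).toReal else 0) ∂P := by
    rw [← setIntegral_condExp hle ((integrable_const (1 : ℝ)).indicator hAm) hSL]
    exact integral_congr_ae (ae_restrict_of_ae (h.blocks s N τ))
  have h3 : ∀ ω, ∏ m ∈ s, (if L (m + 1) ω = N m then (Q (N m) (τ m)).toReal else 0)
      = (⋂ m ∈ s, {ω | L (m + 1) ω ∈ ({(N m : ℕ∞)} : Set ℕ∞)}).indicator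
        (fun _ => ∏ m ∈ s, (Q (N m) (τ m)).toReal) ω := by
    intro ω
    rw [Set.indicator_apply]
    split_ifs with hω
    · refine Finset.prod_congr rfl fun m hm => if_pos ?_
      simpa using Set.mem_iInter₂.1 hω m hm
    · obtain ⟨m, hm, hne⟩ : ∃ m ∈ s, L (m + 1) ω ≠ N m := by
        by_contra! hcon
        exact hω (Set.mem_iInter₂.2 fun m hm => hcon m hm)
      exact Finset.prod_eq_zero hm (if_neg hne)
  have h4 : (P (S ∩ A)).toReal = (P S * (∏ m ∈ s, P {ω | L (m + 1) ω ∈ ({(N m : ℕ∞)} : Set ℕ∞)})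
      * ∏ m ∈ s, Q (N m) (τ m)).toReal := by
    rw [h1, h2]
    simp_rw [h3]
    rw [integral_indicator hB, Measure.restrict_restrict hB, setIntegral_const, Set.inter_comm,
      Measure.real, measure_renewalTime_inter_lengths h.measurable h.indep k n s _ _,
      ENNReal.toReal_mul, smul_eq_mul, ENNReal.toReal_prod]
    · simp only [ENNReal.toReal_mul, ENNReal.toReal_prod, hSdef]
    · intro m hm
      obtain ⟨i, -, rfl⟩ := Finset.mem_map.1 hm
      simp
  have h5 : P (S ∩ A) = P S * (∏ m ∈ s, P {ω | L (m + 1) ω ∈ ({(N m : ℕ∞)} : Set ℕ∞)})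
      * ∏ m ∈ s, Q (N m) (τ m) := by
    refine (ENNReal.toReal_eq_toReal_iff' (measure_ne_top _ _) ?_).1 h4
    refine ENNReal.mul_ne_top (ENNReal.mul_ne_top (measure_ne_top _ _) ?_) ?_
    · exact ENNReal.prod_ne_top fun m _ => measure_ne_top _ _
    · exact ENNReal.prod_ne_top fun m _ => PMF.apply_ne_top _ _
  rw [hA, h5, mul_assoc, ← Finset.prod_mul_distrib, Finset.prod_map]
  congr 1
  refine Finset.prod_congr rfl fun i _ => ?_
  rw [blockMeasure_singleton]
  simp only [Set.mem_singleton_iff, N, h.length_law, τ]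
  have key : ∀ m, m = i →
      p (b m).len * Q (b m).len (b m).perm = p (b i).len * Q (b i).len (b i).perm := by
    rintro _ rfl; rfl
  exact key _ (Nat.add_sub_cancel_left k i)

/-- The block structure of the future after a renewal. -/
lemma IsRecurrentRegenerative.palmLaw_startsWith (h : IsRecurrentRegenerative P π L p Q) {n : ℕ}
    (hn : P (renewalEvent L n) ≠ 0) (b : ℕ → Block) (K : ℕ) :
    palmLaw P π L n (startsWith b K) = ∏ i ∈ Finset.range K, blockMeasure p Q {b i} := by
  have hfm := measurable_future h.randomPerm h.measurable n
  have hsm := hfm (measurableSet_startsWith b K)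
  have hkey : ∀ k, P ({ω | renewalTime L k ω = n} ∩ future π L n ⁻¹' startsWith b K)
      = P {ω | renewalTime L k ω = n} * ∏ i ∈ Finset.range K, blockMeasure p Q {b i} := by
    intro k
    rw [← h.measure_blocks k n b K]
    refine measure_congr ?_
    filter_upwards [h.length_pos] with ω hω
    refine propext (and_congr_right fun hk => ?_)
    exact startsWith_future_iff hω hk b K
  rw [palmLaw, Measure.map_apply hfm (measurableSet_startsWith b K),
    cond_apply (measurableSet_renewalEvent h.measurable n),
    measure_renewalEvent_inter h.measurable h.length_pos n hsm, tsum_congr hkey,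
    ENNReal.tsum_mul_right, ← mul_assoc]
  have h2 := measure_renewalEvent_inter h.measurable h.length_pos n MeasurableSet.univ
  simp only [Set.inter_univ] at h2
  rw [← h2, ENNReal.inv_mul_cancel hn (measure_ne_top _ _), one_mul]

lemma IsRecurrentRegenerative.exists_renewal (h : IsRecurrentRegenerative P π L p Q) :
    ∃ n, 0 < n ∧ P (renewalEvent L n) ≠ 0 := by
  by_contra! hcon
  have h0 : P (⋃ n : ℕ, {ω | 0 < n ∧ n ∈ renewalSet L ω}) = 0 := by
    refine measure_iUnion_null fun n => ?_
    rcases Nat.eq_zero_or_pos n with rfl | hn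
    · simp
    · exact measure_mono_null (fun ω hω => hω.2) (hcon n hn)
  have h1 : ∀ᵐ ω ∂P, False := by
    filter_upwards [measure_eq_zero_iff_ae_notMem.1 h0, h.delay_finite, h.length_mem 0]
      with ω hω hd ⟨m, hm⟩
    obtain ⟨d, hd⟩ := ENat.ne_top_iff_exists.1 hd
    refine hω (Set.mem_iUnion.2 ⟨d + m, by have := m.pos; omega, ?_⟩)
    exact mem_renewalSet_of_length_eq (k := 0) (by simp [renewalTime, hd]) hm
  rw [Filter.eventually_false_iff_eq_bot, ae_eq_bot] at h1
  exact IsProbabilityMeasure.ne_zero P h1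

end Recurrent

/-- Given a renewal at `n`, the time until the next renewal is distributed as `L 1`. -/
lemma IsDelayedRenewal.palmLaw_noRenewal {P : Measure Ω} [IsProbabilityMeasure P]
    {π : Ω → Equiv.Perm ℕ+} (hπ : IsRandomPerm π) {L : ℕ → Ω → ℕ∞} (h : IsDelayedRenewal P L)
    {n : ℕ} (hn : P (renewalEvent L n) ≠ 0) (j : ℕ) :
    palmLaw P π L n {x | ∀ i : ℕ+, (i : ℕ) ≤ j → ¬ x.2 i} = P {ω | (j : ℕ∞) < L 1 ω} := by
  have hpos : ∀ᵐ ω ∂P, ∀ j, L (j + 1) ω ≠ 0 := ae_all_iff.2 h.length_pos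
  have hfm := measurable_future hπ h.measurable n
  have hSm : MeasurableSet {x : Trajectory | ∀ i : ℕ+, (i : ℕ) ≤ j → ¬ x.2 i} := by
    simp only [Set.ofPred_forall]
    refine MeasurableSet.iInter fun i => MeasurableSet.iInter fun _ => ?_
    exact (measurableSet_setOfPred.2 ((measurable_pi_apply i).comp measurable_snd)).compl
  have hkey : ∀ k, P ({ω | renewalTime L k ω = n} ∩
      future π L n ⁻¹' {x | ∀ i : ℕ+, (i : ℕ) ≤ j → ¬ x.2 i})
      = P {ω | renewalTime L k ω = n} * P {ω | (j : ℕ∞) < L 1 ω} := by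
    intro k
    have h1 := measure_renewalTime_inter_lengths h.measurable h.indep k n {k} (by simp)
      fun _ => Set.Ioi (j : ℕ∞)
    simp only [Finset.mem_singleton, Set.iInter_iInter_eq_left, Finset.prod_singleton,
      Set.mem_Ioi] at h1
    have h2 : P {ω | (j : ℕ∞) < L (k + 1) ω} = P {ω | (j : ℕ∞) < L 1 ω} :=
      (h.identDistrib k).measure_mem_eq (s := Set.Ioi (j : ℕ∞)) (Set.to_countable _).measurableSet
    rw [← h2, ← h1]
    refine measure_congr ?_
    filter_upwards [hpos] with ω hω
    refine propext (and_congr_right fun hk => ?_)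
    change (∀ i : ℕ+, (i : ℕ) ≤ j → ¬ n + (i : ℕ) ∈ renewalSet L ω) ↔ (j : ℕ∞) < L (k + 1) ω
    constructor
    · intro hno
      by_contra! hle
      obtain ⟨l, hl⟩ := ENat.ne_top_iff_exists.1 (ne_top_of_le_ne_top (ENat.natCast_ne_top _) hle)
      have hl0 : 0 < l := by
        rcases Nat.eq_zero_or_pos l with rfl | h0
        · exact absurd hl.symm (hω k)
        · exact h0
      rw [← hl] at hle
      exact hno ⟨l, hl0⟩ (by exact_mod_cast hle) (mem_renewalSet_of_length_eq hk hl.symm)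
    · intro hlt i hij hmem
      have := length_le_of_mem_renewalSet hk i.pos hmem
      have h3 := hlt.trans_le this
      have : j < (i : ℕ) := by exact_mod_cast h3
      omega
  rw [palmLaw, Measure.map_apply hfm hSm, cond_apply (measurableSet_renewalEvent h.measurable n),
    measure_renewalEvent_inter h.measurable hpos n (hfm hSm), tsum_congr hkey,
    ENNReal.tsum_mul_right, ← mul_assoc]
  have h2 := measure_renewalEvent_inter h.measurable hpos n MeasurableSet.univ
  simp only [Set.inter_univ] at h2
  rw [← h2, ENNReal.inv_mul_cancel hn (measure_ne_top _ _), one_mul]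

lemma isProbabilityMeasure_palmLaw {P : Measure Ω} [IsProbabilityMeasure P]
    {π : Ω → Equiv.Perm ℕ+} (hπ : IsRandomPerm π) {L : ℕ → Ω → ℕ∞} (hL : ∀ k, Measurable (L k))
    {n : ℕ} (hn : P (renewalEvent L n) ≠ 0) : IsProbabilityMeasure (palmLaw P π L n) := by
  have := cond_isProbabilityMeasure hn
  exact Measure.isProbabilityMeasure_map (measurable_future hπ hL n).aemeasurable

end OneSidedLemmas

/-! ### Stationary regenerative permutations: renewal equations and uniqueness -/

section TwoSidedLemmas

/-- The trajectory seen after `n` more sites. -/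
def shiftTrajectory (n : ℕ) (x : Trajectory) : Trajectory :=
  (fun i => x.1 (shiftPNat n i) - n, fun i => x.2 (shiftPNat n i))

lemma measurable_shiftTrajectory (n : ℕ) : Measurable (shiftTrajectory n) := by
  refine Measurable.prodMk (measurable_pi_lambda _ fun i => ?_) (measurable_pi_lambda _ fun i => ?_)
  · exact ((measurable_pi_apply _).comp measurable_fst).sub_const _
  · exact (measurable_pi_apply _).comp measurable_snd

/-- The trajectories without a renewal at the sites `1, …, j`. -/
def noRenewal (j : ℕ) : Set Trajectory := {x | ∀ i : ℕ+, (i : ℕ) ≤ j → ¬ x.2 i}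

lemma measurableSet_noRenewal (j : ℕ) : MeasurableSet (noRenewal j) := by
  simp only [noRenewal, Set.ofPred_forall]
  refine MeasurableSet.iInter fun i => MeasurableSet.iInter fun _ => ?_
  exact (measurableSet_setOfPred.2 ((measurable_pi_apply i).comp measurable_snd)).compl

/-- The trajectories without a renewal at `1, …, j` which, seen after `j`, belong to `B`. -/
def gap (j : ℕ) (B : Set Trajectory) : Set Trajectory := noRenewal j ∩ shiftTrajectory j ⁻¹' B

lemma measurableSet_gap (j : ℕ) {B : Set Trajectory} (hB : MeasurableSet B) :
    MeasurableSet (gap j B) :=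
  (measurableSet_noRenewal j).inter (measurable_shiftTrajectory j hB)

variable {Ω : Type*} {π : Ω → Equiv.Perm ℤ} {T : ℤ → Ω → ℤ}

lemma futureInt_add (z : ℤ) (j : ℕ) (ω : Ω) :
    futureInt π T (z + j) ω = shiftTrajectory j (futureInt π T z ω) := by
  simp only [futureInt, shiftTrajectory, residualInt, shiftPNat, PNat.mk_coe, Nat.cast_add,
    add_assoc]
  congr 1
  funext i
  simp only [residualInt]
  ring_nf

/-- The event that `n - j` is the last renewal up to `n`. -/
def lastRenewal (T : ℤ → Ω → ℤ) (n : ℤ) (j : ℕ) : Set Ω :=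
  {ω | n - j ∈ renewalSetInt T ω ∧ ∀ i : ℕ, i < j → n - i ∉ renewalSetInt T ω}

lemma lastRenewal_inter (n : ℤ) (j : ℕ) (B : Set Trajectory) :
    lastRenewal T n j ∩ futureInt π T n ⁻¹' B
      = renewalEventInt T (n - j) ∩ futureInt π T (n - j) ⁻¹' gap j B := by
  have hn : n = n - j + j := by ring
  ext ω
  simp only [Set.mem_inter_iff, Set.mem_preimage, lastRenewal, Set.mem_ofPred_eq, gap,
    renewalEventInt, ← futureInt_add, ← hn, and_assoc]
  refine and_congr_right fun _ => and_congr_left fun _ => ?_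
  change _ ↔ ∀ i : ℕ+, (i : ℕ) ≤ j → ¬ (n - j + ((i : ℕ) : ℤ) ∈ renewalSetInt T ω)
  constructor
  · intro h i hi
    have := h (j - i) (by have := i.pos; omega)
    rwa [show n - j + ((i : ℕ) : ℤ) = n - ((j - i : ℕ) : ℤ) by omega]
  · intro h i hi
    have := h ⟨j - i, by omega⟩ (by simp)
    rw [PNat.mk_coe] at this
    rwa [show n - (i : ℤ) = n - j + ((j - i : ℕ) : ℤ) by omega]

variable [MeasurableSpace Ω]

lemma measurableSet_renewalEventInt (hT : ∀ k, Measurable (T k)) (z : ℤ) :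
    MeasurableSet (renewalEventInt T z) := by
  simp only [renewalEventInt, renewalSetInt, Set.mem_ofPred_eq]
  rw [Set.ofPred_exists]
  exact MeasurableSet.iUnion fun k => hT k (measurableSet_singleton _)

lemma measurable_futureInt (hπ : ∀ i, Measurable fun ω => π ω i) (hT : ∀ k, Measurable (T k))
    (z : ℤ) : Measurable (futureInt π T z) := by
  refine Measurable.prodMk (measurable_pi_lambda _ fun i => ?_) (measurable_pi_lambda _ fun i => ?_)
  · exact (hπ _).sub_const _
  · exact measurableSet_setOfPred.1 (measurableSet_renewalEventInt hT (z + (i : ℕ)))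

lemma measurable_pastInt (hT : ∀ k, Measurable (T k)) (z : ℤ) : Measurable (pastInt T z) :=
  measurable_pi_lambda _ fun i =>
    measurableSet_setOfPred.1 (measurableSet_renewalEventInt hT (z - (i : ℕ)))

lemma measurable_displacements (hπ : ∀ i, Measurable fun ω => π ω i)
    (hT : ∀ k, Measurable (T k)) (z : ℤ) : Measurable (displacements π T z) := by
  refine measurable_pi_lambda _ fun i => Measurable.prodMk ((hπ _).sub_const _) ?_
  exact measurableSet_setOfPred.1 (measurableSet_renewalEventInt hT (z + i))

lemma measurableSet_lastRenewal (hT : ∀ k, Measurable (T k)) (n : ℤ) (j : ℕ) :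
    MeasurableSet (lastRenewal T n j) := by
  refine (measurableSet_renewalEventInt hT (n - j)).inter ?_
  change MeasurableSet {ω | ∀ i : ℕ, i < j → n - i ∉ renewalSetInt T ω}
  simp only [Set.ofPred_forall]
  exact MeasurableSet.iInter fun i => MeasurableSet.iInter fun _ =>
    (measurableSet_renewalEventInt hT (n - i)).compl

/-- The future after a site as a function of the displacements seen from that site. -/
def futureOfDisplacements (d : ℤ → ℤ × Prop) : Trajectory :=
  (fun i => (d (i : ℕ)).1 + (i : ℕ), fun i => (d (i : ℕ)).2)

/-- The past of a site as a function of the displacements seen from that site. -/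
def pastOfDisplacements (d : ℤ → ℤ × Prop) : ℕ → Prop := fun j => (d (-j)).2

lemma measurable_futureOfDisplacements : Measurable futureOfDisplacements := by
  refine Measurable.prodMk (measurable_pi_lambda _ fun i => ?_) (measurable_pi_lambda _ fun i => ?_)
  · exact (measurable_fst.comp (measurable_pi_apply _)).add_const _
  · exact measurable_snd.comp (measurable_pi_apply _)

lemma measurable_pastOfDisplacements : Measurable pastOfDisplacements :=
  measurable_pi_lambda _ fun _ => measurable_snd.comp (measurable_pi_apply _)

omit [MeasurableSpace Ω] in
lemma futureOfDisplacements_displacements (z : ℤ) :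
    futureOfDisplacements ∘ displacements π T z = futureInt π T z := by
  funext ω
  simp only [Function.comp, futureOfDisplacements, displacements, futureInt]
  congr 1
  funext i
  simp only [residualInt]
  ring

omit [MeasurableSpace Ω] in
lemma pastOfDisplacements_displacements (z : ℤ) :
    pastOfDisplacements ∘ displacements π T z = pastInt T z := rfl

/-- The set of displacement sequences with a renewal at the origin. -/
def renewalAtOrigin : Set (ℤ → ℤ × Prop) := {d | (d 0).2}

lemma measurableSet_renewalAtOrigin : MeasurableSet renewalAtOrigin :=
  measurableSet_setOfPred.2 (measurable_snd.comp (measurable_pi_apply _))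

omit [MeasurableSpace Ω] in
lemma renewalEventInt_eq_preimage (z : ℤ) :
    renewalEventInt T z = displacements π T z ⁻¹' renewalAtOrigin := by
  ext ω
  simp [renewalEventInt, renewalAtOrigin, displacements]

variable {P : Measure Ω} [IsProbabilityMeasure P]

namespace IsStationaryRegenerative

variable (h : IsStationaryRegenerative P π T)

include h

omit [IsProbabilityMeasure P] in
lemma measure_preimage_displacements (z : ℤ) {G : Set (ℤ → ℤ × Prop)} (hG : MeasurableSet G) :
    P (displacements π T z ⁻¹' G) = P (displacements π T 0 ⁻¹' G) := by
  rw [← Measure.map_apply (measurable_displacements h.measurable_perm h.measurable_time z) hG,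
    h.stationary, Measure.map_apply
      (measurable_displacements h.measurable_perm h.measurable_time 0) hG]

omit [IsProbabilityMeasure P] in
lemma measure_renewalEventInt (z : ℤ) : P (renewalEventInt T z) = P (renewalEventInt T 0) := by
  rw [renewalEventInt_eq_preimage (π := π), renewalEventInt_eq_preimage (π := π),
    h.measure_preimage_displacements z measurableSet_renewalAtOrigin]

omit [IsProbabilityMeasure P] in
lemma measure_preimage_futureInt (z : ℤ) {B : Set Trajectory} (hB : MeasurableSet B) :
    P (futureInt π T z ⁻¹' B) = P (futureInt π T 0 ⁻¹' B) := by
  rw [← futureOfDisplacements_displacements, ← futureOfDisplacements_displacements,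
    Set.preimage_comp, Set.preimage_comp,
    h.measure_preimage_displacements z (measurable_futureOfDisplacements hB)]

lemma measure_renewalEventInt_ne_zero (z : ℤ) : P (renewalEventInt T z) ≠ 0 := by
  rw [h.measure_renewalEventInt z]
  intro h0
  have h1 : P (⋃ z, renewalEventInt T z) = 0 :=
    measure_iUnion_null fun z => by rw [h.measure_renewalEventInt z, h0]
  have h2 : (⋃ z, renewalEventInt T z) = Set.univ :=
    Set.eq_univ_of_forall fun ω => Set.mem_iUnion.2 ⟨T 0 ω, 0, rfl⟩
  rw [h2, measure_univ] at h1
  exact one_ne_zero h1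

lemma palmLawInt_eq (z : ℤ) : palmLawInt P π T z = palmLawInt P π T 0 := by
  obtain ⟨ρ, -, hρ⟩ := h.regenerates
  rw [(hρ z (h.measure_renewalEventInt_ne_zero z)).1,
    (hρ 0 (h.measure_renewalEventInt_ne_zero 0)).1]

lemma isProbabilityMeasure_palmLawInt : IsProbabilityMeasure (palmLawInt P π T 0) := by
  have := cond_isProbabilityMeasure (h.measure_renewalEventInt_ne_zero 0)
  exact Measure.isProbabilityMeasure_map
    (measurable_futureInt h.measurable_perm h.measurable_time 0).aemeasurable

lemma measure_renewal_inter_future (z : ℤ) {B : Set Trajectory} (hB : MeasurableSet B) :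
    P (renewalEventInt T z ∩ futureInt π T z ⁻¹' B)
      = P (renewalEventInt T 0) * palmLawInt P π T 0 B := by
  have hf := measurable_futureInt h.measurable_perm h.measurable_time z
  rw [← h.palmLawInt_eq z, palmLawInt, Measure.map_apply hf hB,
    cond_apply (measurableSet_renewalEventInt h.measurable_time z), ← mul_assoc,
    h.measure_renewalEventInt z, ENNReal.mul_inv_cancel (h.measure_renewalEventInt_ne_zero 0)
      (measure_ne_top _ _), one_mul]

lemma measure_two_renewals_inter_future (i : ℕ) {B : Set Trajectory} (hB : MeasurableSet B) :
    P (renewalEventInt T 0 ∩ (renewalEventInt T i ∩ futureInt π T i ⁻¹' B))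
      = P (renewalEventInt T 0 ∩ renewalEventInt T i) * palmLawInt P π T 0 B := by
  obtain ⟨ρ, -, hρ⟩ := h.regenerates
  have hi := h.measure_renewalEventInt_ne_zero i
  have hind := (hρ i hi).2.measure_inter_preimage_eq_mul {q | q i} B
    (measurableSet_setOfPred.2 (measurable_pi_apply i)) hB
  have hR := measurableSet_renewalEventInt h.measurable_time (i : ℤ)
  have hpast : pastInt T i ⁻¹' {q | q i} = renewalEventInt T 0 := by
    ext ω
    simp [pastInt, renewalEventInt]
  rw [hpast, ← Measure.map_apply (measurable_futureInt h.measurable_perm h.measurable_time i) hB,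
    ← palmLawInt, h.palmLawInt_eq i, cond_apply hR, cond_apply hR] at hind
  have h2 := congrArg (fun x => P (renewalEventInt T i) * x) hind
  simp only [← mul_assoc, ENNReal.mul_inv_cancel hi (measure_ne_top _ _), one_mul] at h2
  rw [Set.inter_left_comm, h2, Set.inter_comm]

omit [IsProbabilityMeasure P] in
/-- Decomposition according to the last renewal up to `n`. -/
lemma measure_eq_tsum_lastRenewal (n : ℕ) {A : Set Ω} (hA : MeasurableSet A) :
    P A = ∑' j, P (A ∩ lastRenewal T n j) := by
  have hdisj : Pairwise (Function.onFun Disjoint fun j => A ∩ lastRenewal T n j) := by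
    intro i j hij
    refine Set.disjoint_left.2 fun ω hi hj => ?_
    rcases lt_or_gt_of_ne hij with hlt | hlt
    · exact hj.2.2 i hlt hi.2.1
    · exact hi.2.2 j hlt hj.2.1
  rw [← measure_iUnion hdisj fun j => hA.inter (measurableSet_lastRenewal h.measurable_time n j),
    ← Set.inter_iUnion]
  refine (measure_inter_conull ?_).symm
  rw [← mem_ae_iff]
  filter_upwards [h.indexing] with ω hω
  have hex : ∃ j : ℕ, (n : ℤ) - j ∈ renewalSetInt T ω :=
    ⟨(n - T (-1) ω).toNat, -1, by have := hω.1; omega⟩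
  classical
  exact Set.mem_iUnion.2 ⟨Nat.find hex, Nat.find_spec hex, fun i hi => Nat.find_min hex hi⟩

lemma measure_future_eq_tsum {B : Set Trajectory} (hB : MeasurableSet B) :
    P (futureInt π T 0 ⁻¹' B)
      = ∑' j, P (renewalEventInt T 0) * palmLawInt P π T 0 (gap j B) := by
  have hf := measurable_futureInt h.measurable_perm h.measurable_time 0
  rw [h.measure_eq_tsum_lastRenewal 0 (hf hB)]
  refine tsum_congr fun j => ?_
  rw [Set.inter_comm]
  have := lastRenewal_inter (π := π) (T := T) 0 j B
  rw [Nat.cast_zero, this, h.measure_renewal_inter_future _ (measurableSet_gap j hB)]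

/-- The intensity of renewals is the inverse of the mean gap under the Palm law. -/
lemma intensity_mul_tsum :
    P (renewalEventInt T 0) * ∑' j, palmLawInt P π T 0 (noRenewal j) = 1 := by
  have := h.measure_future_eq_tsum MeasurableSet.univ
  simp only [Set.preimage_univ, measure_univ, gap, Set.inter_univ] at this
  rw [ENNReal.tsum_mul_left] at this
  exact this.symm

/-- The renewal equation for the future after `n`, given a renewal at the origin. -/
lemma renewal_equation (n : ℕ) {B : Set Trajectory} (hB : MeasurableSet B) :
    P (renewalEventInt T 0) * palmLawInt P π T 0 (shiftTrajectory n ⁻¹' B)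
      = ∑ j ∈ Finset.range (n + 1), P (renewalEventInt T 0 ∩ renewalEventInt T (n - j : ℕ)) *
        palmLawInt P π T 0 (gap j B) := by
  have hf := measurable_futureInt h.measurable_perm h.measurable_time n
  have hpre : futureInt π T 0 ⁻¹' (shiftTrajectory n ⁻¹' B) = futureInt π T n ⁻¹' B := by
    ext ω
    have := futureInt_add (π := π) (T := T) 0 n ω
    rw [zero_add] at this
    simp only [Set.mem_preimage, this]
  rw [← h.measure_renewal_inter_future 0 (measurable_shiftTrajectory n hB), hpre,
    h.measure_eq_tsum_lastRenewal n ((measurableSet_renewalEventInt h.measurable_time 0).inter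
      (hf hB)), tsum_eq_sum (s := Finset.range (n + 1))]
  · refine Finset.sum_congr rfl fun j hj => ?_
    have hjn : j ≤ n := Nat.lt_succ_iff.1 (Finset.mem_range.1 hj)
    rw [Set.inter_assoc, Set.inter_comm (futureInt π T n ⁻¹' B), lastRenewal_inter,
      ← Nat.cast_sub hjn, h.measure_two_renewals_inter_future _ (measurableSet_gap j hB)]
  · intro j hj
    have hjn : n < j := by simpa using hj
    convert measure_empty (μ := P)
    rw [Set.eq_empty_iff_forall_notMem]
    rintro ω ⟨⟨h0, -⟩, -, h2⟩
    exact h2 n hjn (by simpa [renewalEventInt] using h0)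

/-- The law of the future after a typical site is the Cesàro limit of the laws of the futures after
`0, 1, 2, …` given a renewal at the origin. -/
theorem tendsto_cesaro {B : Set Trajectory} (hB : MeasurableSet B) :
    Filter.Tendsto (fun N : ℕ => (N : ℝ)⁻¹ * ∑ n ∈ Finset.range N,
      (palmLawInt P π T 0).real (shiftTrajectory n ⁻¹' B)) Filter.atTop
      (nhds (P.real (futureInt π T 0 ⁻¹' B))) := by
  have := h.isProbabilityMeasure_palmLawInt
  set ρ := palmLawInt P π T 0 with hρ
  set c : ℝ := P.real (renewalEventInt T 0) with hc
  have hc0 : c ≠ 0 := by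
    rw [hc, Measure.real, ENNReal.toReal_ne_zero]
    exact ⟨h.measure_renewalEventInt_ne_zero 0, measure_ne_top _ _⟩
  set v : ℕ → ℝ := fun i => P.real (renewalEventInt T 0 ∩ renewalEventInt T (i : ℤ)) with hv
  have hsum : ∀ {A : Set Trajectory}, MeasurableSet A →
      HasSum (fun j => c * ρ.real (gap j A)) (P.real (futureInt π T 0 ⁻¹' A)) := by
    intro A hA
    have h1 := h.measure_future_eq_tsum hA
    have h2 := (ENNReal.hasSum_toReal (f := fun j => P (renewalEventInt T 0) * ρ (gap j A))
      (by rw [← h1]; exact measure_ne_top _ _))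
    rw [← ENNReal.tsum_toReal_eq (fun j => ENNReal.mul_ne_top (measure_ne_top _ _)
      (measure_ne_top _ _)), ← h1] at h2
    simp only [ENNReal.toReal_mul] at h2
    exact h2
  have hren : ∀ {A : Set Trajectory}, MeasurableSet A → ∀ n : ℕ,
      c * ρ.real (shiftTrajectory n ⁻¹' A)
        = ∑ i ∈ Finset.range (n + 1), v i * ρ.real (gap (n - i) A) := by
    intro A hA n
    have h1 := congrArg ENNReal.toReal (h.renewal_equation n hA)
    rw [ENNReal.toReal_mul, ENNReal.toReal_sum fun j _ => ENNReal.mul_ne_top (measure_ne_top _ _)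
      (measure_ne_top _ _)] at h1
    simp only [ENNReal.toReal_mul] at h1
    rw [← Finset.sum_range_reflect]
    refine h1.trans (Finset.sum_congr rfl fun j hj => ?_)
    have hjn : j ≤ n := Nat.lt_succ_iff.1 (Finset.mem_range.1 hj)
    have e1 : n + 1 - 1 - j = n - j := by omega
    have e2 : n - (n - j) = j := by omega
    rw [e1, e2]
    rfl
  set φ : ℝ := P.real (futureInt π T 0 ⁻¹' B) with hφ
  -- `e` compares the contributions of a gap of length `j` to the two renewal equations,
  -- for `B` and for the sure event; they cancel out in total.
  set e : ℕ → ℝ := fun j => φ * ρ.real (gap j Set.univ) - ρ.real (gap j B) with he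
  have he0 : HasSum e 0 := by
    have h1 := ((hsum MeasurableSet.univ).mul_left φ).sub (hsum hB)
    have h2 := h1.mul_left c⁻¹
    simp only [Set.preimage_univ, probReal_univ, mul_one, ← hφ, sub_self, mul_zero] at h2
    refine h2.congr_fun ?_ |> fun h3 => h3
    intro j
    simp only [he]
    field_simp
  have hdiff : ∀ n : ℕ, c * (φ - ρ.real (shiftTrajectory n ⁻¹' B))
      = ∑ i ∈ Finset.range (n + 1), v i * e (n - i) := by
    intro n
    have h1 := hren MeasurableSet.univ n
    rw [Set.preimage_univ, probReal_univ, mul_one] at h1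
    rw [mul_sub, hren hB n]
    nth_rw 1 [h1]
    rw [Finset.sum_mul, ← Finset.sum_sub_distrib]
    refine Finset.sum_congr rfl fun i _ => ?_
    simp only [he]
    ring
  have hbound : ∀ N : ℕ, |∑ n ∈ Finset.range N, c * (φ - ρ.real (shiftTrajectory n ⁻¹' B))|
      ≤ ∑ k ∈ Finset.range N, |∑ j ∈ Finset.range (k + 1), e j| := by
    intro N
    rw [Finset.sum_congr rfl fun n _ => hdiff n,
      Finset.sum_range_diag_flip N fun i j => v i * e j]
    refine (Finset.abs_sum_le_sum_abs _ _).trans ?_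
    rw [← Finset.sum_range_reflect]
    refine Finset.sum_le_sum fun i hi => ?_
    have hiN := Finset.mem_range.1 hi
    rw [← Finset.mul_sum, abs_mul, show N - (N - 1 - i) = i + 1 by omega]
    refine mul_le_of_le_one_left (abs_nonneg _) ?_
    rw [abs_of_nonneg measureReal_nonneg]
    exact measureReal_le_one
  have hD : Filter.Tendsto (fun k => |∑ j ∈ Finset.range (k + 1), e j|) Filter.atTop (nhds 0) := by
    have := ((Filter.tendsto_add_atTop_iff_nat 1).2 he0.tendsto_sum_nat).abs
    simpa using this
  have hcz := hD.cesaro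
  have hlim : Filter.Tendsto (fun N : ℕ => c⁻¹ * ((N : ℝ)⁻¹ * ∑ n ∈ Finset.range N,
      c * (φ - ρ.real (shiftTrajectory n ⁻¹' B)))) Filter.atTop (nhds 0) := by
    rw [← mul_zero c⁻¹]
    refine Filter.Tendsto.const_mul _ (squeeze_zero_norm (fun N => ?_) hcz)
    rw [norm_mul, Real.norm_eq_abs, Real.norm_eq_abs, abs_of_nonneg (by positivity)]
    exact mul_le_mul_of_nonneg_left (hbound N) (by positivity)
  have hfin := (tendsto_const_nhds (x := φ)).sub hlim
  rw [sub_zero] at hfin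
  refine hfin.congr' ?_
  filter_upwards [Filter.eventually_gt_atTop 0] with N hN
  have hN' : (N : ℝ) ≠ 0 := by positivity
  rw [← Finset.mul_sum, Finset.sum_sub_distrib, Finset.sum_const, Finset.card_range, nsmul_eq_mul]
  field_simp
  ring

end IsStationaryRegenerative

/-- The law of the future after a typical site is determined by the Palm law. -/
lemma measure_future_eq_of_palm {Ω' : Type*} [MeasurableSpace Ω'] {P' : Measure Ω'}
    [IsProbabilityMeasure P'] {π' : Ω' → Equiv.Perm ℤ} {T' : ℤ → Ω' → ℤ}
    (h : IsStationaryRegenerative P π T) (h' : IsStationaryRegenerative P' π' T')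
    {B : Set Trajectory} (hB : MeasurableSet B)
    (hpalm : ∀ n, palmLawInt P π T 0 (shiftTrajectory n ⁻¹' B)
      = palmLawInt P' π' T' 0 (shiftTrajectory n ⁻¹' B)) :
    P (futureInt π T 0 ⁻¹' B) = P' (futureInt π' T' 0 ⁻¹' B) := by
  have h1 := h.tendsto_cesaro hB
  have h2 := h'.tendsto_cesaro hB
  simp only [Measure.real, hpalm] at h1 h2
  exact (ENNReal.toReal_eq_toReal_iff' (measure_ne_top _ _) (measure_ne_top _ _)).1
    (tendsto_nhds_unique h1 h2)

omit [IsProbabilityMeasure P] in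
lemma IsStationaryRegenerative.measurable_perm_renewals (h : IsStationaryRegenerative P π T) :
    Measurable fun ω => ((fun z => π ω z : ℤ → ℤ), (fun z => z ∈ renewalSetInt T ω : ℤ → Prop)) :=
  Measurable.prodMk (measurable_pi_lambda _ fun z => h.measurable_perm z)
    (measurable_pi_lambda _ fun z =>
      measurableSet_setOfPred.1 (measurableSet_renewalEventInt h.measurable_time z))

/-- The trajectories with prescribed values and renewal indicators at the sites in `s + N`. -/
def trajectoryWindow (s : Finset ℤ) (N : ℕ) (l : ℤ → ℤ) (m : ℤ → Prop) : Set Trajectory :=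
  {x | ∀ i : ℕ+, ((i : ℕ) : ℤ) - N ∈ s → x.1 i = l ((i : ℕ) - N) + N ∧ x.2 i = m ((i : ℕ) - N)}

/-- The sequences of values which are prescribed at the sites in `s + N`. -/
def residualWindow (s : Finset ℤ) (N : ℕ) (l : ℤ → ℤ) : Set (ℕ+ → ℤ) :=
  {f | ∀ i : ℕ+, ((i : ℕ) : ℤ) - N ∈ s → f i = l ((i : ℕ) - N) + N}

lemma measurableSet_residualWindow (s : Finset ℤ) (N : ℕ) (l : ℤ → ℤ) :
    MeasurableSet (residualWindow s N l) := by
  simp only [residualWindow, Set.ofPred_forall]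
  exact MeasurableSet.iInter fun i => MeasurableSet.iInter fun _ =>
    measurable_pi_apply i (measurableSet_singleton _)

lemma measurableSet_trajectoryWindow (s : Finset ℤ) (N : ℕ) (l : ℤ → ℤ) (m : ℤ → Prop) :
    MeasurableSet (trajectoryWindow s N l m) := by
  simp only [trajectoryWindow, Set.ofPred_forall]
  refine MeasurableSet.iInter fun i => MeasurableSet.iInter fun _ => MeasurableSet.inter ?_ ?_
  · exact measurableSet_eq_fun ((measurable_pi_apply _).comp measurable_fst) measurable_const
  · exact measurableSet_eq_fun ((measurable_pi_apply _).comp measurable_snd) measurable_const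

lemma exists_neg_lt (s : Finset ℤ) : ∃ N : ℕ, ∀ z ∈ s, -(N : ℤ) < z := by
  refine ⟨(∑ z ∈ s, z.natAbs) + 1, fun z hz => ?_⟩
  have : z.natAbs ≤ ∑ z ∈ s, z.natAbs := Finset.single_le_sum (fun _ _ => Nat.zero_le _) hz
  omega

omit [MeasurableSpace Ω] in
lemma futureInt_mem_trajectoryWindow {s : Finset ℤ} {N : ℕ} (hN : ∀ z ∈ s, -(N : ℤ) < z)
    (l : ℤ → ℤ) (m : ℤ → Prop) (ω : Ω) :
    futureInt π T (-N) ω ∈ trajectoryWindow s N l m ↔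
      ∀ z ∈ s, π ω z = l z ∧ (z ∈ renewalSetInt T ω) = m z := by
  constructor
  · intro hw z hz
    have hpos := hN z hz
    have := hw ⟨(z + N).toNat, by omega⟩
      (by rwa [PNat.mk_coe, show (((z + N).toNat : ℕ) : ℤ) - N = z by omega])
    simp only [PNat.mk_coe, futureInt, residualInt] at this
    rw [show (((z + N).toNat : ℕ) : ℤ) - N = z by omega,
      show -(N : ℤ) + ((z + N).toNat : ℕ) = z by omega] at this
    exact ⟨by linarith [this.1], this.2⟩
  · intro hw i hi
    have := hw _ hi
    simp only [futureInt, residualInt]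
    rw [show -(N : ℤ) + ((i : ℕ) : ℤ) = (i : ℕ) - N by ring]
    exact ⟨by linarith [this.1], this.2⟩

omit [MeasurableSpace Ω] in
lemma futureInt_mem_residualWindow {s : Finset ℤ} {N : ℕ} (hN : ∀ z ∈ s, -(N : ℤ) < z)
    (l : ℤ → ℤ) (ω : Ω) :
    (futureInt π T (-N) ω).1 ∈ residualWindow s N l ↔ ∀ z ∈ s, π ω z = l z := by
  have := futureInt_mem_trajectoryWindow (π := π) (T := T) hN l (fun z => z ∈ renewalSetInt T ω) ω
  simp only [and_true] at this
  rw [← this]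
  refine forall₂_congr fun i _ => ?_
  rw [iff_self_and]
  intro _
  simp only [futureInt]
  rw [show -(N : ℤ) + ((i : ℕ) : ℤ) = (i : ℕ) - N by ring]

section Uniqueness

variable {Ω' : Type*} [MeasurableSpace Ω'] {P' : Measure Ω'} [IsProbabilityMeasure P']
  {π' : Ω' → Equiv.Perm ℤ} {T' : ℤ → Ω' → ℤ}

/-- The joint law is determined by the Palm law. -/
theorem jointLaw_eq_of_palm (h : IsStationaryRegenerative P π T)
    (h' : IsStationaryRegenerative P' π' T')
    (hpalm : palmLawInt P π T 0 = palmLawInt P' π' T' 0) :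
    jointLaw P π T = jointLaw P' π' T' := by
  have : IsProbabilityMeasure (jointLaw P π T) :=
    Measure.isProbabilityMeasure_map h.measurable_perm_renewals.aemeasurable
  have : IsProbabilityMeasure (jointLaw P' π' T') :=
    Measure.isProbabilityMeasure_map h'.measurable_perm_renewals.aemeasurable
  refine measure_ext_of_window_prod Set.univ (fun t => ⟨t, trivial, subset_rfl⟩)
    fun s _ l m => ?_
  have hm : MeasurableSet {x : (ℤ → ℤ) × (ℤ → Prop) | ∀ i ∈ s, x.1 i = l i ∧ x.2 i = m i} := by
    simp only [Set.ofPred_forall]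
    refine MeasurableSet.iInter fun i => MeasurableSet.iInter fun _ => MeasurableSet.inter ?_ ?_
    · exact measurableSet_eq_fun ((measurable_pi_apply _).comp measurable_fst) measurable_const
    · exact measurableSet_eq_fun ((measurable_pi_apply _).comp measurable_snd) measurable_const
  obtain ⟨N, hN⟩ := exists_neg_lt s
  have hB := measurableSet_trajectoryWindow s N l m
  rw [jointLaw, jointLaw, Measure.map_apply h.measurable_perm_renewals hm,
    Measure.map_apply h'.measurable_perm_renewals hm]
  have e1 : futureInt π T (-N) ⁻¹' trajectoryWindow s N l m =
      {ω | ∀ z ∈ s, π ω z = l z ∧ (z ∈ renewalSetInt T ω) = m z} :=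
    Set.ext fun ω => futureInt_mem_trajectoryWindow hN l m ω
  have e2 : futureInt π' T' (-N) ⁻¹' trajectoryWindow s N l m =
      {ω | ∀ z ∈ s, π' ω z = l z ∧ (z ∈ renewalSetInt T' ω) = m z} :=
    Set.ext fun ω => futureInt_mem_trajectoryWindow hN l m ω
  refine (congrArg P e1).symm.trans (Eq.trans ?_ (congrArg P' e2))
  rw [h.measure_preimage_futureInt _ hB, h'.measure_preimage_futureInt _ hB]
  exact measure_future_eq_of_palm h h' hB fun n => by rw [hpalm]

/-- The law of the permutation is determined by the law of its residual permutation given a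
renewal, even though the renewal processes may be different. -/
theorem permLaw_eq_of_palm (h : IsStationaryRegenerative P π T)
    (h' : IsStationaryRegenerative P' π' T')
    (hpalm : (palmLawInt P π T 0).map Prod.fst = (palmLawInt P' π' T' 0).map Prod.fst) :
    permLaw P π = permLaw P' π' := by
  have hm := measurable_pi_lambda (fun ω z => π ω z) h.measurable_perm
  have hm' := measurable_pi_lambda (fun ω z => π' ω z) h'.measurable_perm
  have : IsProbabilityMeasure (permLaw P π) :=
    Measure.isProbabilityMeasure_map hm.aemeasurable
  have : IsProbabilityMeasure (permLaw P' π') :=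
    Measure.isProbabilityMeasure_map hm'.aemeasurable
  refine measure_ext_of_window Set.univ (fun t => ⟨t, trivial, subset_rfl⟩) fun s _ l => ?_
  obtain ⟨N, hN⟩ := exists_neg_lt s
  have hB' := measurableSet_residualWindow s N l
  have hB : MeasurableSet (Prod.fst ⁻¹' residualWindow s N l : Set Trajectory) :=
    measurable_fst hB'
  rw [permLaw, permLaw, Measure.map_apply hm (measurableSet_window s l),
    Measure.map_apply hm' (measurableSet_window s l)]
  have e1 : futureInt π T (-N) ⁻¹' (Prod.fst ⁻¹' residualWindow s N l) =
      {ω | ∀ z ∈ s, π ω z = l z} :=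
    Set.ext fun ω => futureInt_mem_residualWindow hN l ω
  have e2 : futureInt π' T' (-N) ⁻¹' (Prod.fst ⁻¹' residualWindow s N l) =
      {ω | ∀ z ∈ s, π' ω z = l z} :=
    Set.ext fun ω => futureInt_mem_residualWindow hN l ω
  refine (congrArg P e1).symm.trans (Eq.trans ?_ (congrArg P' e2))
  rw [h.measure_preimage_futureInt _ hB, h'.measure_preimage_futureInt _ hB]
  refine measure_future_eq_of_palm h h' hB fun n => ?_
  have hshift : Measurable fun (f : ℕ+ → ℤ) (i : ℕ+) => f (shiftPNat n i) - n :=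
    measurable_pi_lambda _ fun i => (measurable_pi_apply _).sub_const _
  have h1 := congrArg (fun ρ : Measure (ℕ+ → ℤ) =>
    ρ ((fun (f : ℕ+ → ℤ) (i : ℕ+) => f (shiftPNat n i) - n) ⁻¹' residualWindow s N l)) hpalm
  rw [Measure.map_apply measurable_fst (hshift hB'),
    Measure.map_apply measurable_fst (hshift hB')] at h1
  exact h1

end Uniqueness

end TwoSidedLemmas

/-! ### Blocks of a permutation of the integers -/

section IntBlocks

variable {Ω : Type*} {π : Ω → Equiv.Perm ℤ} {T : ℤ → Ω → ℤ}

lemma length_le_of_mem_renewalSetInt {ω : Ω} (hmono : StrictMono fun k => T k ω) {k i : ℤ}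
    (hi : 0 < i) (h : T k ω + i ∈ renewalSetInt T ω) : T (k + 1) ω - T k ω ≤ i := by
  obtain ⟨l, hl⟩ := h
  have hkl : k < l := hmono.lt_iff_lt.1 (by simp only [hl]; omega)
  have := hmono.monotone (Int.add_one_le_iff.2 hkl)
  simp only [hl] at this
  omega

lemma mem_blockEventInt_succ (k : ℤ) (ω : Ω) (n : ℕ) (τ : Equiv.Perm (Fin n)) :
    ω ∈ blockEventInt π T (k + 1) n τ ↔
      T (k + 1) ω - T k ω = n ∧ HasReducedBlockInt (π ω) (T k ω) n τ := by
  simp only [blockEventInt, blockLength, Set.mem_ofPred_eq, add_sub_cancel_right]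

lemma blockAt_futureInt_iff {ω : Ω} (hmono : StrictMono fun k => T k ω) {k z : ℤ} {a : ℕ}
    (hk : T k ω = z + a) (β : Block) :
    BlockAt (futureInt π T z ω) a β ↔ ω ∈ blockEventInt π T (k + 1) β.len β.perm := by
  have hlen : (∀ j : Fin β.len, ((futureInt π T z ω).2 (shiftPNat a (Nat.succPNat j)) ↔
      (j : ℕ) + 1 = β.len)) ↔ T (k + 1) ω - T k ω = (β.len : ℕ) := by
    have hmem : ∀ j : ℕ, (futureInt π T z ω).2 (shiftPNat a (Nat.succPNat j)) ↔
        T k ω + (j + 1) ∈ renewalSetInt T ω := by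
      intro j
      simp [futureInt, shiftPNat, hk, add_assoc]
    have hself : T k ω + (T (k + 1) ω - T k ω) ∈ renewalSetInt T ω := ⟨k + 1, by ring⟩
    have hg : T k ω < T (k + 1) ω := hmono (by omega)
    constructor
    · intro h
      have hβ := β.len.pos
      have h1 := (h ⟨β.len - 1, by omega⟩).2 (by simp only; omega)
      rw [hmem] at h1
      have h2 := length_le_of_mem_renewalSetInt hmono (by omega) h1
      simp only at h2
      have h3 := (h ⟨(T (k + 1) ω - T k ω).toNat - 1, by omega⟩).1 (by
        rw [hmem]
        convert hself using 2
        simp only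
        omega)
      simp only at h3
      omega
    · intro h j
      rw [hmem]
      constructor
      · intro hj
        have := length_le_of_mem_renewalSetInt hmono (by omega) hj
        omega
      · intro hj
        convert hself using 2
        omega
  have hperm : (∀ j : Fin β.len, (futureInt π T z ω).1 (shiftPNat a (Nat.succPNat j)) =
      a + (((β.perm j : ℕ) : ℤ) + 1)) ↔ HasReducedBlockInt (π ω) (T k ω) β.len β.perm := by
    refine forall_congr' fun j => ?_
    have : z + ((shiftPNat a (Nat.succPNat j) : ℕ) : ℤ) = T k ω + ((j : ℕ) + 1) := by
      simp [shiftPNat, hk, add_assoc]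
    simp only [futureInt, residualInt, this]
    omega
  simp only [BlockAt, forall_and, hlen, hperm, mem_blockEventInt_succ]
  exact and_comm

lemma startsWith_futureInt_iff {ω : Ω} (hmono : StrictMono fun k => T k ω) {k z : ℤ}
    (hk : T k ω = z) (b : ℕ → Block) (K : ℕ) :
    futureInt π T z ω ∈ startsWith b K ↔
      ∀ i < K, ω ∈ blockEventInt π T (k + i + 1) (b i).len (b i).perm := by
  suffices H : (futureInt π T z ω ∈ startsWith b K ↔
      ∀ i < K, ω ∈ blockEventInt π T (k + i + 1) (b i).len (b i).perm) ∧
      ((∀ i < K, ω ∈ blockEventInt π T (k + i + 1) (b i).len (b i).perm) →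
        T (k + K) ω = z + offset b K) from H.1
  induction K with
  | zero => simp [startsWith, hk]
  | succ K ih =>
    rw [startsWith_succ, ih.1, Nat.forall_lt_succ_right]
    refine ⟨and_congr_right fun h => blockAt_futureInt_iff hmono (ih.2 h) _, fun h => ?_⟩
    have h1 := ((mem_blockEventInt_succ _ _ _ _).1 h.2).1
    have h2 := ih.2 h.1
    rw [offset_succ, Nat.cast_add, Nat.cast_one, ← add_assoc]
    push_cast
    linarith

/-- A block number determines the block. -/
lemma blockEventInt_unique {z : ℤ} {ω : Ω} {β β' : Block}
    (h : ω ∈ blockEventInt π T z β.len β.perm) (h' : ω ∈ blockEventInt π T z β'.len β'.perm) :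
    β = β' := by
  obtain ⟨h1, h2⟩ := h
  obtain ⟨h1', h2'⟩ := h'
  obtain ⟨n, σ⟩ := β
  obtain ⟨m, τ⟩ := β'
  obtain rfl : n = m := PNat.coe_injective (by exact_mod_cast h1.symm.trans h1')
  congr 1
  ext j
  have h3 := (h2 j).symm.trans (h2' j)
  simp only at h3
  omega

/-- A strictly increasing sequence of integers cuts `ℤ` into intervals. -/
lemma exists_mem_interval {f : ℤ → ℤ} (hf : StrictMono f) (z : ℤ) :
    ∃ k, f (k - 1) < z ∧ z ≤ f k := by
  have hmono : Monotone fun k => f k - k := by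
    refine monotone_int_of_le_succ fun k => ?_
    have := hf (Int.lt_add_one_iff.2 le_rfl : k < k + 1)
    omega
  have hbdd : ∀ k, z ≤ f k → min 0 (z - f 0) ≤ k := by
    intro k hk
    by_contra! hlt
    have := hmono (show k ≤ 0 by omega)
    simp only at this
    omega
  have hne : z ≤ f (max 0 (z - f 0)) := by
    have := hmono (show (0 : ℤ) ≤ max 0 (z - f 0) by omega)
    simp only at this
    omega
  obtain ⟨k, hk, hleast⟩ := Int.exists_least_of_bdd ⟨_, hbdd⟩ ⟨_, hne⟩
  refine ⟨k, ?_, hk⟩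
  by_contra! hcon
  have := hleast _ hcon
  omega

lemma interval_unique {f : ℤ → ℤ} (hf : StrictMono f) {z k k' : ℤ} (h1 : f (k - 1) < z)
    (h2 : z ≤ f k) (h1' : f (k' - 1) < z) (h2' : z ≤ f k') : k = k' := by
  have := hf.lt_iff_lt.1 (h1.trans_le h2')
  have := hf.lt_iff_lt.1 (h1'.trans_le h2)
  omega

end IntBlocks

/-! ### Concatenation of a doubly infinite sequence of blocks -/

/-- The right end of block number `k`, if block number `0` ends at `t`. -/
noncomputable def blockEnd (t : ℤ) (b : ℤ → Block) (k : ℤ) : ℤ :=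
  t + ∑ i ∈ Finset.Ioc 0 k, ((b i).len : ℤ) - ∑ i ∈ Finset.Ioc k 0, ((b i).len : ℤ)

@[simp] lemma blockEnd_zero (t : ℤ) (b : ℤ → Block) : blockEnd t b 0 = t := by
  simp [blockEnd]

lemma blockEnd_succ (t : ℤ) (b : ℤ → Block) (k : ℤ) :
    blockEnd t b (k + 1) = blockEnd t b k + (b (k + 1)).len := by
  unfold blockEnd
  rcases le_or_gt 0 k with hk | hk
  · have h1 : Finset.Ioc 0 (k + 1) = insert (k + 1) (Finset.Ioc 0 k) := by
      ext i; simp only [Finset.mem_Ioc, Finset.mem_insert]; omega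
    rw [h1, Finset.sum_insert (by simp), Finset.Ioc_eq_empty (show ¬ k < 0 by omega),
      Finset.Ioc_eq_empty (show ¬ k + 1 < 0 by omega), Finset.sum_empty]
    ring
  · have h1 : Finset.Ioc k 0 = insert (k + 1) (Finset.Ioc (k + 1) 0) := by
      ext i; simp only [Finset.mem_Ioc, Finset.mem_insert]; omega
    rw [h1, Finset.sum_insert (by simp), Finset.Ioc_eq_empty (show ¬ 0 < k by omega),
      Finset.Ioc_eq_empty (show ¬ 0 < k + 1 by omega), Finset.sum_empty]
    ring

lemma strictMono_blockEnd (t : ℤ) (b : ℤ → Block) : StrictMono (blockEnd t b) :=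
  strictMono_int_of_lt_succ fun k => by
    have : (0 : ℤ) < (b (k + 1)).len := by exact_mod_cast (b (k + 1)).len.pos
    rw [blockEnd_succ]; omega

/-- The ends of the blocks are determined by their recursion. -/
lemma eq_blockEnd {f : ℤ → ℤ} {b : ℤ → Block} (hf : ∀ k, f (k + 1) = f k + (b (k + 1)).len)
    (k : ℤ) : f k = blockEnd (f 0) b k := by
  induction k using Int.induction_on with
  | zero => simp
  | succ k ih => rw [hf, ih, blockEnd_succ]
  | pred k ih =>
    have h1 := hf (-k - 1)
    have h2 := blockEnd_succ (f 0) b (-k - 1)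
    rw [sub_add_cancel] at h1 h2
    omega

lemma blockEnd_sub_one (t : ℤ) (b : ℤ → Block) (k : ℤ) :
    blockEnd t b k = blockEnd t b (k - 1) + (b k).len := by
  have := blockEnd_succ t b (k - 1)
  rwa [sub_add_cancel] at this

/-- The integers as a disjoint union of blocks. -/
noncomputable def blockEquiv (t : ℤ) (b : ℤ → Block) : (Σ k : ℤ, Fin (b k).len) ≃ ℤ :=
  Equiv.ofBijective (fun x => blockEnd t b (x.1 - 1) + ((x.2 : ℕ) + 1)) <| by
    constructor
    · rintro ⟨k, j⟩ ⟨k', j'⟩ h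
      simp only at h
      have hk := blockEnd_sub_one t b k
      have hk' := blockEnd_sub_one t b k'
      have hj := j.2
      have hj' := j'.2
      obtain rfl : k = k' := interval_unique (strictMono_blockEnd t b)
        (z := blockEnd t b (k - 1) + ((j : ℕ) + 1)) (by omega) (by omega) (by omega) (by omega)
      congr 1
      ext
      omega
    · intro z
      obtain ⟨k, h1, h2⟩ := exists_mem_interval (strictMono_blockEnd t b) z
      have hk := blockEnd_sub_one t b k
      exact ⟨⟨k, ⟨(z - blockEnd t b (k - 1) - 1).toNat, by omega⟩⟩, by simp only; omega⟩

lemma blockEquiv_apply (t : ℤ) (b : ℤ → Block) (k : ℤ) (j : Fin (b k).len) :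
    blockEquiv t b ⟨k, j⟩ = blockEnd t b (k - 1) + ((j : ℕ) + 1) := rfl

/-- The concatenation of the blocks `b k`, where block number `0` ends at `t`. -/
noncomputable def concatPerm (t : ℤ) (b : ℤ → Block) : Equiv.Perm ℤ :=
  (blockEquiv t b).symm.trans
    ((Equiv.sigmaCongrRight fun k => (b k).perm).trans (blockEquiv t b))

lemma concatPerm_apply (t : ℤ) (b : ℤ → Block) (k : ℤ) (j : Fin (b k).len) :
    concatPerm t b (blockEnd t b (k - 1) + ((j : ℕ) + 1))
      = blockEnd t b (k - 1) + (((b k).perm j : ℕ) + 1) := by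
  rw [← blockEquiv_apply]
  simp only [concatPerm, Equiv.trans_apply, Equiv.symm_apply_apply]
  rfl

/-- Every site lies in a block. -/
lemma exists_block (t : ℤ) (b : ℤ → Block) (z : ℤ) :
    ∃ (k : ℤ) (j : Fin (b k).len), z = blockEnd t b (k - 1) + ((j : ℕ) + 1) := by
  obtain ⟨⟨k, j⟩, h⟩ := (blockEquiv t b).surjective z
  exact ⟨k, j, h.symm⟩

lemma block_site_le_iff (t : ℤ) (b : ℤ → Block) (k m : ℤ) (j : Fin (b k).len) :
    blockEnd t b (k - 1) + ((j : ℕ) + 1) ≤ blockEnd t b m ↔ k ≤ m := by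
  have hj := j.2
  have hk := blockEnd_sub_one t b k
  constructor
  · intro h
    have := (strictMono_blockEnd t b).lt_iff_lt.1
      (show blockEnd t b (k - 1) < blockEnd t b m by omega)
    omega
  · intro h
    have := (strictMono_blockEnd t b).monotone h
    omega

lemma splitsAtInt_concatPerm (t : ℤ) (b : ℤ → Block) (m : ℤ) :
    SplitsAtInt (concatPerm t b) (blockEnd t b m) := by
  intro z
  obtain ⟨k, j, rfl⟩ := exists_block t b z
  rw [concatPerm_apply, block_site_le_iff, block_site_le_iff]

/-- Translation by one site and renumbering of the blocks. -/
lemma concatPerm_translate {t t' s : ℤ} {b b' : ℤ → Block} (hb : ∀ k, b' k = b (k + s))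
    (ht : ∀ k, blockEnd t' b' k = blockEnd t b (k + s) - 1) (z : ℤ) :
    concatPerm t' b' z = concatPerm t b (z + 1) - 1 := by
  obtain rfl : b' = fun k => b (k + s) := funext hb
  obtain ⟨k, j, rfl⟩ := exists_block t' (fun k => b (k + s)) z
  have hks : k - 1 + s = k + s - 1 := by ring
  have h2 : blockEnd t' (fun k => b (k + s)) (k - 1) + ((j : ℕ) + 1) + 1
      = blockEnd t b (k + s - 1) + ((j : ℕ) + 1) := by
    rw [ht, hks]; ring
  rw [concatPerm_apply, h2, concatPerm_apply t b (k + s) j, ht, hks]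
  ring

/-- The space of pairs of the right end of block number `0` and of a sequence of blocks. -/
abbrev BlockSpace : Type := ℕ × (ℤ → Block)

/-- The random permutation of `ℤ` on `BlockSpace`. -/
noncomputable def blockPerm (ω : BlockSpace) : Equiv.Perm ℤ := concatPerm ω.1 ω.2

/-- The renewal times on `BlockSpace`. -/
noncomputable def blockTime (k : ℤ) (ω : BlockSpace) : ℤ := blockEnd ω.1 ω.2 k

lemma strictMono_blockTime (ω : BlockSpace) : StrictMono fun k => blockTime k ω :=
  strictMono_blockEnd _ _

lemma mem_blockEventInt_iff (z : ℤ) (ω : BlockSpace) (β : Block) :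
    ω ∈ blockEventInt blockPerm blockTime z β.len β.perm ↔ ω.2 z = β := by
  have hmem : ω ∈ blockEventInt blockPerm blockTime z (ω.2 z).len (ω.2 z).perm := by
    constructor
    · have := blockEnd_sub_one ω.1 ω.2 z
      simp only [blockLength, blockTime]
      omega
    · intro j
      exact concatPerm_apply _ _ _ _
  constructor
  · intro h
    exact blockEventInt_unique hmem h
  · rintro rfl
    exact hmem

lemma futureInt_mem_startsWith_iff (b : ℤ → Block) (b' : ℕ → Block) (K : ℕ) :
    futureInt blockPerm blockTime 0 (0, b) ∈ startsWith b' K ↔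
      ∀ i < K, b ((i : ℤ) + 1) = b' i := by
  rw [startsWith_futureInt_iff (strictMono_blockTime _) (k := 0) (by simp [blockTime])]
  refine forall₂_congr fun i _ => ?_
  rw [mem_blockEventInt_iff, zero_add]

lemma measurable_blockTime (k : ℤ) : Measurable (blockTime k) := by
  have hlen : ∀ i : ℤ, Measurable fun ω : BlockSpace => ((ω.2 i).len : ℤ) := fun i =>
    (measurable_of_countable fun β : Block => (β.len : ℤ)).comp
      ((measurable_pi_apply i).comp measurable_snd)
  unfold blockTime blockEnd
  refine Measurable.sub (Measurable.add ?_ ?_) ?_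
  · exact (measurable_of_countable fun n : ℕ => (n : ℤ)).comp measurable_fst
  · exact Finset.measurable_fun_sum _ fun i _ => hlen i
  · exact Finset.measurable_fun_sum _ fun i _ => hlen i

lemma measurable_blockPerm (i : ℤ) : Measurable fun ω => blockPerm ω i := by
  refine measurable_to_countable' fun x => ?_
  have : (fun ω => blockPerm ω i) ⁻¹' {x} = ⋃ k : ℤ, (fun ω : BlockSpace =>
      (blockTime (k - 1) ω, ω.2 k)) ⁻¹' {y : ℤ × Block | ∃ j : Fin y.2.len,
        i = y.1 + ((j : ℕ) + 1) ∧ x = y.1 + ((y.2.perm j : ℕ) + 1)} := by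
    ext ω
    simp only [Set.mem_preimage, Set.mem_singleton_iff, Set.mem_iUnion, Set.mem_ofPred_eq]
    constructor
    · intro h
      obtain ⟨k, j, hj⟩ := exists_block ω.1 ω.2 i
      refine ⟨k, j, hj, ?_⟩
      rw [← h, hj]
      exact concatPerm_apply _ _ _ _
    · rintro ⟨k, j, h1, rfl⟩
      rw [h1]
      exact concatPerm_apply _ _ _ _
  rw [this]
  refine MeasurableSet.iUnion fun k => ?_
  exact ((measurable_blockTime _).prodMk ((measurable_pi_apply k).comp measurable_snd))
    (Set.to_countable _).measurableSet

/-! ### The law of the future after a renewal -/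

section Canonical

variable (p : PMF ℕ+) (Q : ∀ n : ℕ, PMF (Equiv.Perm (Fin n)))

lemma tsum_ite_lt (n : ℕ) (x : ℝ≥0∞) : ∑' j : ℕ, (if j < n then x else 0) = n * x := by
  rw [tsum_eq_sum (s := Finset.range n) fun j hj => if_neg (by simpa using hj),
    Finset.sum_congr rfl fun j hj => if_pos (Finset.mem_range.1 hj), Finset.sum_const,
    Finset.card_range, nsmul_eq_mul]

lemma tsum_blockMeasure_lt :
    ∑' j : ℕ, blockMeasure p Q {β | j < (β.len : ℕ)} = meanLength p := by
  have h1 : ∀ j : ℕ, blockMeasure p Q {β | j < (β.len : ℕ)}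
      = ∑' n : ℕ+, if j < (n : ℕ) then p n else 0 := by
    intro j
    have : {β : Block | j < (β.len : ℕ)}
        = ⋃ n : ℕ+, {β : Block | β.len = n} ∩ {β | j < (β.len : ℕ)} := by
      ext β; simp
    rw [this, measure_iUnion _ fun n => MeasurableSet.of_discrete]
    · refine tsum_congr fun n => ?_
      split_ifs with hn
      · rw [← blockMeasure_len_eq p Q n]
        congr 1
        ext β
        simp only [Set.mem_inter_iff, Set.mem_ofPred_eq, and_iff_left_iff_imp]
        rintro rfl
        exact hn
      · convert measure_empty (μ := blockMeasure p Q)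
        rw [Set.eq_empty_iff_forall_notMem]
        rintro β ⟨rfl, h⟩
        exact hn h
    · intro n m hnm
      exact Set.disjoint_left.2 fun β h h' => hnm (h.1.symm.trans h'.1)
  rw [tsum_congr h1, ENNReal.tsum_comm]
  exact tsum_congr fun n => tsum_ite_lt n (p n)

lemma meanLength_ne_zero : meanLength p ≠ 0 := by
  intro h
  have h1 : ∀ n : ℕ+, p n = 0 := fun n => by
    have := ENNReal.tsum_eq_zero.1 h n
    rcases mul_eq_zero.1 this with h | h
    · simp at h
    · exact h
  have := p.tsum_coe
  simp [h1] at this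

lemma measurable_future_block :
    Measurable fun b : ℤ → Block => futureInt blockPerm blockTime 0 ((0, b) : BlockSpace) :=
  (measurable_futureInt measurable_blockPerm measurable_blockTime 0).comp measurable_prodMk_left

/-- The law of the concatenation of i.i.d. blocks, with its renewal indicators. -/
noncomputable def canonicalLaw : Measure Trajectory :=
  (iidBlocks p Q).map fun b => futureInt blockPerm blockTime 0 (0, b)

instance : IsProbabilityMeasure (canonicalLaw p Q) :=
  Measure.isProbabilityMeasure_map (measurable_future_block).aemeasurable

lemma canonicalLaw_startsWith (b : ℕ → Block) (K : ℕ) :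
    canonicalLaw p Q (startsWith b K) = ∏ i ∈ Finset.range K, blockMeasure p Q {b i} := by
  rw [canonicalLaw, Measure.map_apply measurable_future_block (measurableSet_startsWith b K)]
  let e : ℕ ↪ ℤ := ⟨fun i => (i : ℤ) + 1, fun i j h => by simpa using h⟩
  have he : ∀ i, e i = (i : ℤ) + 1 := fun _ => rfl
  have : (fun b' : ℤ → Block => futureInt blockPerm blockTime 0 ((0, b') : BlockSpace)) ⁻¹'
      startsWith b K = window ((Finset.range K).map e) fun z => b (z - 1).toNat := by
    ext b'
    rw [Set.mem_preimage, futureInt_mem_startsWith_iff]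
    simp [window, he]
  rw [this, iidBlocks_window, Finset.prod_map]
  refine Finset.prod_congr rfl fun i _ => ?_
  simp [he]

lemma ae_canonicalLaw_startsWith : ∀ᵐ x ∂(canonicalLaw p Q), ∀ K, ∃ b, x ∈ startsWith b K := by
  have hms : MeasurableSet {x : Trajectory | ∀ K, ∃ b, x ∈ startsWith b K} := by
    have : {x : Trajectory | ∀ K, ∃ b, x ∈ startsWith b K}
        = ⋂ K : ℕ, ⋃ a : Fin K → Block,
          startsWith (fun k => if hk : k < K then a ⟨k, hk⟩ else default) K := by
      ext x
      simp only [Set.mem_ofPred_eq, Set.mem_iInter, Set.mem_iUnion]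
      refine forall_congr' fun K => ⟨?_, fun ⟨a, ha⟩ => ⟨_, ha⟩⟩
      rintro ⟨b, hb⟩
      refine ⟨fun k => b k, ?_⟩
      rwa [startsWith_congr (b' := b)]
      intro k hk
      simp [hk]
    rw [this]
    exact MeasurableSet.iInter fun K => MeasurableSet.iUnion fun a => measurableSet_startsWith _ _
  rw [canonicalLaw, ae_map_iff measurable_future_block.aemeasurable hms]
  refine Filter.Eventually.of_forall fun b K => ⟨fun i => b (i + 1), ?_⟩
  rw [futureInt_mem_startsWith_iff]
  exact fun _ _ => rfl

variable {p Q}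

/-- Given a renewal, the future of a recurrent regenerative permutation is a concatenation of i.i.d.
blocks. -/
theorem IsRecurrentRegenerative.palmLaw_eq {Ω : Type*} [MeasurableSpace Ω] {P : Measure Ω}
    [IsProbabilityMeasure P] {π : Ω → Equiv.Perm ℕ+} {L : ℕ → Ω → ℕ∞}
    (h : IsRecurrentRegenerative P π L p Q) {n : ℕ} (hn : P (renewalEvent L n) ≠ 0) :
    palmLaw P π L n = canonicalLaw p Q := by
  have := isProbabilityMeasure_palmLaw h.randomPerm h.measurable hn
  refine trajectory_law_ext (fun b K => ?_) (ae_canonicalLaw_startsWith p Q)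
  rw [h.palmLaw_startsWith hn, canonicalLaw_startsWith]

lemma canonicalLaw_noRenewal (j : ℕ) :
    canonicalLaw p Q (noRenewal j) = blockMeasure p Q {β | j < (β.len : ℕ)} := by
  rw [canonicalLaw, Measure.map_apply measurable_future_block (measurableSet_noRenewal j)]
  have h1 := iidBlocks_box p Q {1} fun _ => {β : Block | j < (β.len : ℕ)}
  rw [Finset.prod_singleton] at h1
  rw [← h1]
  congr 1
  ext b
  have hmono := strictMono_blockTime (0, b)
  have h0 : blockTime 0 (0, b) = 0 := by simp [blockTime]
  have hT : blockTime 1 (0, b) = (b 1).len := by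
    have := blockEnd_succ 0 b 0
    simpa [blockTime] using this
  simp only [Set.mem_preimage, Finset.mem_singleton, forall_eq, Set.mem_ofPred_eq, noRenewal,
    futureInt, zero_add]
  constructor
  · intro h
    by_contra! hle
    exact h (b 1).len hle ⟨1, hT⟩
  · intro hlt i hi hmem
    have := length_le_of_mem_renewalSetInt hmono (k := 0) (i := (i : ℕ))
      (by exact_mod_cast i.pos) (by rwa [h0, zero_add])
    rw [zero_add, h0, hT] at this
    omega

/-- The positive integers as integers. -/
def pnatEquivPos : {z : ℤ // 0 < z} ≃ ℕ+ where
  toFun z := ⟨z.1.toNat, by have := z.2; omega⟩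
  invFun i := ⟨(i : ℕ), by exact_mod_cast i.pos⟩
  left_inv z := by ext; have := z.2; simp only [PNat.mk_coe]; omega
  right_inv i := by apply PNat.coe_injective; simp

lemma pnatEquivPos_apply (z : {z : ℤ // 0 < z}) : (pnatEquivPos z : ℕ) = z.1.toNat := rfl

lemma pnatEquivPos_symm_apply (i : ℕ+) : (pnatEquivPos.symm i : ℤ) = (i : ℕ) := rfl

lemma concatPerm_zero_pos (b : ℤ → Block) (z : ℤ) : 0 < concatPerm 0 b z ↔ 0 < z := by
  have := splitsAtInt_concatPerm 0 b 0 z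
  rw [blockEnd_zero] at this
  rw [← not_le, ← not_le, this]

/-- The concatenation of the blocks `b 1, b 2, …`, as a permutation of the positive integers. -/
noncomputable def concatPermPos (b : ℤ → Block) : Equiv.Perm ℕ+ :=
  pnatEquivPos.permCongr ((concatPerm 0 b).subtypePerm fun z => concatPerm_zero_pos b z)

lemma concatPermPos_apply (b : ℤ → Block) (i : ℕ+) :
    ((concatPermPos b i : ℕ) : ℤ) = concatPerm 0 b (i : ℕ) := by
  have h : 0 < concatPerm 0 b (i : ℕ) := (concatPerm_zero_pos b _).2 (by exact_mod_cast i.pos)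
  simp only [concatPermPos, Equiv.permCongr_apply, pnatEquivPos_apply,
    Equiv.Perm.subtypePerm_apply, pnatEquivPos_symm_apply]
  omega

/-- The lengths of the blocks `b 1, b 2, …`, preceded by zero delay. -/
def zeroDelayLengths : ℕ → (ℤ → Block) → ℕ∞
  | 0, _ => 0
  | k + 1, b => ((b (k + 1)).len : ℕ)

lemma renewalTime_zeroDelayLengths (b : ℤ → Block) (k : ℕ) :
    renewalTime zeroDelayLengths k b = ((blockEnd 0 b k).toNat : ℕ) ∧ 0 ≤ blockEnd 0 b k := by
  induction k with
  | zero => simp [renewalTime, zeroDelayLengths]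
  | succ k ih =>
    have h := blockEnd_succ 0 b k
    rw [renewalTime_succ, ih.1, zeroDelayLengths, Nat.cast_add, Nat.cast_one, h]
    refine ⟨?_, by have := ih.2; omega⟩
    rw [← Nat.cast_add]
    congr 1
    have := ih.2
    omega

lemma mem_renewalSet_zeroDelayLengths (b : ℤ → Block) (i : ℕ) :
    i ∈ renewalSet zeroDelayLengths b ↔ (i : ℤ) ∈ renewalSetInt blockTime (0, b) := by
  have h0 : blockTime 0 (0, b) = 0 := by simp [blockTime]
  constructor
  · rintro ⟨k, hk⟩
    obtain ⟨h1, h2⟩ := renewalTime_zeroDelayLengths b k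
    rw [h1] at hk
    have hk' : (blockEnd 0 b k).toNat = i := by exact_mod_cast hk
    exact ⟨k, by simp only [blockTime, Nat.cast_zero]; omega⟩
  · rintro ⟨k, hk⟩
    have hk0 : 0 ≤ k := (strictMono_blockTime (0, b)).le_iff_le.1 (by
      simp only [hk, h0]; omega)
    refine ⟨k.toNat, ?_⟩
    rw [(renewalTime_zeroDelayLengths b _).1, Int.toNat_of_nonneg hk0]
    congr 1
    simp only [blockTime, Nat.cast_zero] at hk
    omega

lemma future_zeroDelay (b : ℤ → Block) :
    future concatPermPos zeroDelayLengths 0 b = futureInt blockPerm blockTime 0 (0, b) := by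
  refine Prod.ext (funext fun i => ?_) (funext fun i => propext ?_)
  · simp only [future, residual, futureInt, residualInt, concatPermPos_apply]
    simp [shiftPNat, blockPerm]
  · simp only [future, futureInt, zero_add]
    exact mem_renewalSet_zeroDelayLengths b i

lemma isZeroDelayLaw_canonicalLaw : IsZeroDelayLaw (canonicalLaw p Q) := by
  have hlen : ∀ z : ℤ, Measurable fun b : ℤ → Block => (((b z).len : ℕ) : ℕ∞) := fun z =>
    (measurable_of_countable fun β : Block => ((β.len : ℕ) : ℕ∞)).comp (measurable_pi_apply z)
  refine ⟨ℤ → Block, inferInstance, iidBlocks p Q, concatPermPos, zeroDelayLengths, inferInstance,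
    ?_, ⟨?_, ?_, ?_, ?_, ?_⟩, ?_, ?_⟩
  · intro i
    have h1 : Measurable fun b : ℤ → Block => concatPerm 0 b (i : ℕ) := by
      have h : Measurable fun b : ℤ → Block => ((0, b) : BlockSpace) := measurable_prodMk_left
      have := (measurable_blockPerm (i : ℕ)).comp h
      simpa only [Function.comp_def, blockPerm, Nat.cast_zero] using this
    have h2 : (fun b => (concatPermPos b i : ℕ)) = fun b => (concatPerm 0 b (i : ℕ)).toNat := by
      funext b
      rw [← concatPermPos_apply, Int.toNat_natCast]
    rw [h2]
    exact (measurable_of_countable Int.toNat).comp h1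
  · rintro (_ | k)
    · exact measurable_const
    · exact hlen _
  · have h1 : iIndepFun (fun (z : ℤ) (b : ℤ → Block) => b z) (iidBlocks p Q) :=
      iIndepFun_infinitePi (X := fun _ => id) fun _ => measurable_id
    have h2 := h1.precomp (g := fun k : ℕ => (k : ℤ)) fun _ _ h => by simpa using h
    have h3 := h2.comp (fun k β => if k = 0 then (0 : ℕ∞) else ((β.len : ℕ) : ℕ∞))
      fun _ => measurable_of_countable _
    convert h3 using 1
    funext k b
    rcases k with _ | k
    · simp [zeroDelayLengths]
    · simp [zeroDelayLengths]
  · exact Filter.Eventually.of_forall fun b => by simp [zeroDelayLengths]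
  · exact fun k => Filter.Eventually.of_forall fun b => by simp [zeroDelayLengths]
  · intro k
    refine ⟨(hlen _).aemeasurable, (hlen _).aemeasurable, ?_⟩
    have h : ∀ z : ℤ, (iidBlocks p Q).map (fun b => (((b z).len : ℕ) : ℕ∞))
        = (blockMeasure p Q).map fun β => ((β.len : ℕ) : ℕ∞) := by
      intro z
      have h1 := Measure.map_map (μ := iidBlocks p Q) (f := fun b : ℤ → Block => b z)
        (g := fun β : Block => ((β.len : ℕ) : ℕ∞)) (measurable_of_countable _)
        (measurable_pi_apply z)
      have h2 : (iidBlocks p Q).map (fun b => b z) = blockMeasure p Q :=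
        Measure.infinitePi_map_eval (fun _ : ℤ => blockMeasure p Q) z
      rw [h2] at h1
      exact h1.symm
    exact (h _).trans (h _).symm
  · exact Filter.Eventually.of_forall fun b => rfl
  · rw [canonicalLaw]
    congr 1
    funext b
    exact (future_zeroDelay b).symm

end Canonical

/-! ### Construction of the stationary version -/

section Construction

variable (p : PMF ℕ+) (Q : ∀ n : ℕ, PMF (Equiv.Perm (Fin n)))

/-- The law of the stationary version on `BlockSpace`: the blocks are i.i.d. under counting measure
for the right end `j` of block number `0`, restricted to `j < len (b 0)` and normalized. -/
noncomputable def stationaryMeasure : Measure BlockSpace :=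
  (meanLength p)⁻¹ • Measure.sum fun j : ℕ =>
    ((iidBlocks p Q).restrict {b | j < ((b 0).len : ℕ)}).map (Prod.mk j)

lemma stationaryMeasure_apply {A : Set BlockSpace} (hA : MeasurableSet A) :
    stationaryMeasure p Q A = (meanLength p)⁻¹ *
      ∑' j : ℕ, iidBlocks p Q {b | j < ((b 0).len : ℕ) ∧ (j, b) ∈ A} := by
  rw [stationaryMeasure, Measure.smul_apply, smul_eq_mul, Measure.sum_apply _ hA]
  congr 1
  refine tsum_congr fun j => ?_
  have hm : Measurable (Prod.mk j : (ℤ → Block) → BlockSpace) := measurable_prodMk_left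
  rw [Measure.map_apply hm hA, Measure.restrict_apply (hm hA), Set.inter_comm]
  rfl

lemma iidBlocks_lt_len (j : ℕ) : iidBlocks p Q {b | j < ((b 0).len : ℕ)}
    = blockMeasure p Q {β | j < (β.len : ℕ)} := by
  have h1 := iidBlocks_box p Q {0} fun _ => {β : Block | j < (β.len : ℕ)}
  rw [Finset.prod_singleton] at h1
  rw [← h1]
  congr 1
  ext b
  simp

lemma isProbabilityMeasure_stationaryMeasure (hp : meanLength p ≠ ∞) :
    IsProbabilityMeasure (stationaryMeasure p Q) := by
  refine ⟨?_⟩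
  rw [stationaryMeasure_apply p Q MeasurableSet.univ]
  simp only [Set.mem_univ, and_true, iidBlocks_lt_len]
  rw [tsum_blockMeasure_lt, ENNReal.inv_mul_cancel (meanLength_ne_zero p) hp]

lemma ae_stationaryMeasure : ∀ᵐ ω ∂(stationaryMeasure p Q), ω.1 < ((ω.2 0).len : ℕ) := by
  have hm : MeasurableSet {ω : BlockSpace | ¬ ω.1 < ((ω.2 0).len : ℕ)} := by
    have h1 : Measurable fun ω : BlockSpace => ((ω.2 0).len : ℕ) :=
      (measurable_of_countable fun β : Block => (β.len : ℕ)).comp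
        ((measurable_pi_apply 0).comp measurable_snd)
    exact (measurableSet_lt measurable_fst h1).compl
  rw [ae_iff, stationaryMeasure_apply p Q hm, ENNReal.tsum_eq_zero.2, mul_zero]
  intro j
  convert measure_empty (μ := iidBlocks p Q)
  rw [Set.eq_empty_iff_forall_notMem]
  rintro b ⟨h1, h2⟩
  exact h2 h1

/-- The sequence of blocks numbered from the next one. -/
def shiftBlocks (b : ℤ → Block) : ℤ → Block := fun z => b (z + 1)

lemma measurePreserving_shiftBlocks :
    MeasurePreserving shiftBlocks (iidBlocks p Q) (iidBlocks p Q) := by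
  refine ⟨measurable_pi_lambda _ fun z => measurable_pi_apply _, ?_⟩
  exact Measure.map_infinitePi_infinitePi_of_inj (P := fun _ : ℤ => blockMeasure p Q)
    (f := fun z : ℤ => z + 1) fun _ _ h => by simpa using h

/-- The point of view from the next site: either the origin remains in the same block, or the next
block becomes block number `0`. -/
def translateOrigin : BlockSpace → BlockSpace
  | (0, b) => ((b 1).len - 1, shiftBlocks b)
  | (j + 1, b) => (j, b)

lemma measurable_translateOrigin : Measurable translateOrigin := by
  refine measurable_from_prod_countable_right fun j => ?_
  rcases j with _ | j
  · refine Measurable.prodMk ?_ (measurable_pi_lambda _ fun z => measurable_pi_apply _)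
    exact (measurable_of_countable fun β : Block => (β.len : ℕ) - 1).comp (measurable_pi_apply 1)
  · exact measurable_prodMk_left

lemma measurePreserving_translateOrigin :
    MeasurePreserving translateOrigin (stationaryMeasure p Q) (stationaryMeasure p Q) := by
  refine ⟨measurable_translateOrigin, Measure.ext fun A hA => ?_⟩
  rw [Measure.map_apply measurable_translateOrigin hA, stationaryMeasure_apply p Q hA,
    stationaryMeasure_apply p Q (measurable_translateOrigin hA)]
  congr 1
  have hsec : ∀ j : ℕ, MeasurableSet {b : ℤ → Block | (j, b) ∈ A} := fun j =>
    (measurable_prodMk_left : Measurable fun b : ℤ → Block => ((j, b) : BlockSpace)) hA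
  have hlen : ∀ S : ℕ → Set ℕ, ∀ j, MeasurableSet {b : ℤ → Block | ((b 0).len : ℕ) ∈ S j} :=
    fun S j => (measurable_pi_apply (0 : ℤ) : Measurable fun b : ℤ → Block => b 0)
      (MeasurableSet.of_discrete (s := {β : Block | (β.len : ℕ) ∈ S j}))
  rw [tsum_eq_zero_add' ENNReal.summable]
  -- the sites `j = 0`: a new block starts
  have h0 : iidBlocks p Q {b | 0 < ((b 0).len : ℕ) ∧ ((0, b) : BlockSpace) ∈ translateOrigin ⁻¹' A}
      = ∑' j : ℕ, iidBlocks p Q ({b | ((b 0).len : ℕ) ∈ ({j + 1} : Set ℕ)} ∩ {b | (j, b) ∈ A}) := by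
    rw [← measure_iUnion]
    · have hU : MeasurableSet (⋃ j : ℕ, {b : ℤ → Block | ((b 0).len : ℕ) ∈ ({j + 1} : Set ℕ)} ∩
          {b | (j, b) ∈ A}) :=
        MeasurableSet.iUnion fun j => (hlen (fun j => {j + 1}) j).inter (hsec j)
      rw [← (measurePreserving_shiftBlocks p Q).measure_preimage hU.nullMeasurableSet]
      congr 1
      ext b
      have hb1 := (b 1).len.pos
      simp only [PNat.pos, true_and, Set.mem_ofPred_eq, Set.mem_preimage, translateOrigin,
        Set.mem_iUnion, Set.mem_inter_iff, Set.mem_singleton_iff]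
      have hs : shiftBlocks b 0 = b 1 := rfl
      rw [hs]
      constructor
      · intro h
        exact ⟨_, by omega, h⟩
      · rintro ⟨j, hj, h⟩
        rwa [show ((b 1).len : ℕ) - 1 = j by omega]
    · intro i j hij
      refine Set.disjoint_left.2 fun b hi hj => hij ?_
      have h1 : ((b 0).len : ℕ) = i + 1 := hi.1
      have h2 : ((b 0).len : ℕ) = j + 1 := hj.1
      omega
    · exact fun j => (hlen (fun j => {j + 1}) j).inter (hsec j)
  rw [h0, ← ENNReal.tsum_add]
  refine tsum_congr fun j => ?_
  have hm2 : MeasurableSet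
      {b : ℤ → Block | j + 1 < ((b 0).len : ℕ) ∧ ((j, b) : BlockSpace) ∈ A} :=
    (hlen (fun j => Set.Ioi (j + 1)) j).inter (hsec j)
  have h2 : {b : ℤ → Block | j + 1 < ((b 0).len : ℕ) ∧
      ((j + 1, b) : BlockSpace) ∈ translateOrigin ⁻¹' A}
      = {b : ℤ → Block | j + 1 < ((b 0).len : ℕ) ∧ ((j, b) : BlockSpace) ∈ A} := rfl
  rw [h2, ← measure_union _ hm2]
  · congr 1
    ext b
    simp only [Set.mem_union, Set.mem_inter_iff, Set.mem_ofPred_eq, Set.mem_singleton_iff,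
      ← or_and_right]
    refine and_congr_left fun _ => ?_
    omega
  · refine Set.disjoint_left.2 fun b hb hb' => ?_
    have h1 : ((b 0).len : ℕ) = j + 1 := hb.1
    have := hb'.1
    omega

/-- How the block structure changes with the point of view. -/
lemma exists_renumbering (ω : BlockSpace) : ∃ s : ℤ,
    (∀ k, (translateOrigin ω).2 k = ω.2 (k + s)) ∧
    ∀ k, blockTime k (translateOrigin ω) = blockTime (k + s) ω - 1 := by
  obtain ⟨j, b⟩ := ω
  rcases j with _ | j
  · refine ⟨1, fun k => rfl, fun k => ?_⟩
    have h := eq_blockEnd (f := fun k => blockTime (k + 1) (0, b) - 1) (b := shiftBlocks b)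
      (fun k => ?_) k
    · refine Eq.trans ?_ h.symm
      have h1 := blockEnd_succ 0 b 0
      have hpos := (b 1).len.pos
      simp only [zero_add, blockEnd_zero] at h1
      simp only [blockTime, translateOrigin, Nat.cast_zero, zero_add, h1]
      congr 1
      omega
    · have h1 := blockEnd_succ 0 b (k + 1)
      simp only [blockTime, Nat.cast_zero, h1, shiftBlocks]
      ring
  · refine ⟨0, fun k => by rw [add_zero]; rfl, fun k => ?_⟩
    simp only [blockTime, translateOrigin, add_zero, blockEnd]
    push_cast
    ring

lemma displacements_translateOrigin (a : ℤ) (ω : BlockSpace) :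
    displacements blockPerm blockTime (a + 1) ω
      = displacements blockPerm blockTime a (translateOrigin ω) := by
  obtain ⟨s, hb, ht⟩ := exists_renumbering ω
  funext z
  refine Prod.ext ?_ (propext ?_)
  · have := concatPerm_translate hb ht (a + z)
    simp only [displacements, blockPerm, this]
    rw [show a + 1 + z = a + z + 1 by ring]
    ring
  · simp only [displacements, renewalSetInt, Set.mem_ofPred_eq]
    constructor
    · rintro ⟨k, hk⟩
      exact ⟨k - s, by rw [ht, sub_add_cancel, hk]; ring⟩
    · rintro ⟨k, hk⟩
      exact ⟨k + s, by have := ht k; omega⟩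

lemma stationaryMeasure_map_displacements (a : ℤ) :
    (stationaryMeasure p Q).map (displacements blockPerm blockTime a)
      = (stationaryMeasure p Q).map (displacements blockPerm blockTime 0) := by
  have hstep : ∀ a : ℤ, (stationaryMeasure p Q).map (displacements blockPerm blockTime (a + 1))
      = (stationaryMeasure p Q).map (displacements blockPerm blockTime a) := by
    intro a
    have hm := measurable_displacements measurable_blockPerm measurable_blockTime a
    rw [← (measurePreserving_translateOrigin p Q).map_eq,
      Measure.map_map hm measurable_translateOrigin, (measurePreserving_translateOrigin p Q).map_eq]
    congr 1
    funext ω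
    exact displacements_translateOrigin a ω
  induction a using Int.induction_on with
  | zero => rfl
  | succ k ih => rw [hstep, ih]
  | pred k ih => rw [← hstep, sub_add_cancel, ih]

lemma cond_renewalEventInt_zero (hp : meanLength p ≠ ∞) :
    (stationaryMeasure p Q)[|renewalEventInt blockTime 0] = (iidBlocks p Q).map (Prod.mk 0) := by
  have hR := measurableSet_renewalEventInt measurable_blockTime 0
  have hmk : Measurable (Prod.mk 0 : (ℤ → Block) → BlockSpace) := measurable_prodMk_left
  have key : ∀ A : Set BlockSpace, MeasurableSet A →
      stationaryMeasure p Q (renewalEventInt blockTime 0 ∩ A)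
        = (meanLength p)⁻¹ * (iidBlocks p Q).map (Prod.mk 0) A := by
    intro A hA
    rw [stationaryMeasure_apply p Q (hR.inter hA), tsum_eq_single 0, Measure.map_apply hmk hA]
    · congr 2
      ext b
      simp only [PNat.pos, Set.mem_inter_iff, true_and, Set.mem_preimage, Set.mem_ofPred_eq,
        and_iff_right_iff_imp]
      exact fun _ => ⟨0, by simp [blockTime]⟩
    · intro j hj
      convert measure_empty (μ := iidBlocks p Q)
      rw [Set.eq_empty_iff_forall_notMem]
      rintro b ⟨h1, ⟨k, hk⟩, -⟩
      -- the block which contains the origin is block number `0`, and it does not end there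
      have hT0 : blockTime 0 (j, b) = j := by simp [blockTime]
      have hT1 : blockTime (-1) (j, b) = j - (b 0).len := by
        have h := blockEnd_sub_one j b 0
        rw [blockEnd_zero, zero_sub] at h
        simp only [blockTime]
        omega
      have hlt : k < 0 := (strictMono_blockTime (j, b)).lt_iff_lt.1 (by simp only [hk, hT0]; omega)
      have hgt : -1 < k := (strictMono_blockTime (j, b)).lt_iff_lt.1 (by
        simp only [hk, hT1]; omega)
      omega
  have hc : stationaryMeasure p Q (renewalEventInt blockTime 0) = (meanLength p)⁻¹ := by
    have := key Set.univ MeasurableSet.univ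
    rwa [Set.inter_univ, Measure.map_apply hmk MeasurableSet.univ, Set.preimage_univ, measure_univ,
      mul_one] at this
  refine Measure.ext fun A hA => ?_
  rw [cond_apply hR, key A hA, hc, inv_inv, ← mul_assoc,
    ENNReal.mul_inv_cancel (meanLength_ne_zero p) hp, one_mul]

/-- The future and the past of the origin depend on disjoint sets of blocks. -/
lemma indepFun_past_future_block :
    IndepFun (fun b : ℤ → Block => pastInt blockTime 0 ((0, b) : BlockSpace))
      (fun b : ℤ → Block => futureInt blockPerm blockTime 0 ((0, b) : BlockSpace))
      (iidBlocks p Q) := by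
  classical
  let l : (ℤ → Block) → ℤ → Block := fun b z => if z ≤ 0 then b z else default
  let r : (ℤ → Block) → ℤ → Block := fun b z => if 0 < z then b z else default
  have hpast : (fun b : ℤ → Block => pastInt blockTime 0 ((0, b) : BlockSpace))
      = (fun b : ℤ → Block => pastInt blockTime 0 ((0, b) : BlockSpace)) ∘ l := by
    have hT : ∀ b : ℤ → Block, ∀ k ≤ 0, blockTime k (0, b) = blockTime k (0, l b) := by
      intro b k hk
      simp only [blockTime, blockEnd, Finset.Ioc_eq_empty (show ¬ (0 : ℤ) < k by omega)]
      congr 1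
      refine Finset.sum_congr rfl fun i hi => ?_
      simp [l, (Finset.mem_Ioc.1 hi).2]
    have hneg : ∀ b : ℤ → Block, ∀ (k : ℤ) (j : ℕ), blockTime k (0, b) = 0 - j → k ≤ 0 := by
      intro b k j h
      refine (strictMono_blockTime (0, b)).le_iff_le.1 ?_
      simp only [h]
      simp [blockTime]
    funext b
    funext j
    refine propext (exists_congr fun k => ⟨fun h => ?_, fun h => ?_⟩)
    · rwa [← hT b k (hneg b k j h)]
    · rwa [hT b k (hneg _ k j h)]
  have hfut : (fun b : ℤ → Block => futureInt blockPerm blockTime 0 ((0, b) : BlockSpace))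
      = (fun b : ℤ → Block => futureInt blockPerm blockTime 0 ((0, b) : BlockSpace)) ∘ r := by
    funext b
    have h1 : ∀ K, futureInt blockPerm blockTime 0 ((0, b) : BlockSpace) ∈
        startsWith (fun i => b (i + 1)) K := fun K =>
      (futureInt_mem_startsWith_iff b _ K).2 fun _ _ => rfl
    have h2 : ∀ K, futureInt blockPerm blockTime 0 ((0, r b) : BlockSpace) ∈
        startsWith (fun i => b (i + 1)) K := fun K =>
      (futureInt_mem_startsWith_iff (r b) _ K).2 fun i _ => if_pos (by omega)
    refine Prod.ext (funext fun i => ?_) (funext fun i => ?_)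
    · exact (startsWith_agree (h1 i) (h2 i) le_rfl).1
    · exact (startsWith_agree (h1 i) (h2 i) le_rfl).2
  have hind : iIndepFun (fun (z : ℤ) (b : ℤ → Block) => b z) (iidBlocks p Q) :=
    iIndepFun_infinitePi (X := fun _ => id) fun _ => measurable_id
  have hsup := indep_iSup_of_disjoint (fun z => (measurable_pi_apply z).comap_le) hind.iIndep
    (S := Set.Iic 0) (T := Set.Ioi 0)
    (Set.disjoint_left.2 fun z h1 h2 => not_lt.2 (Set.mem_Iic.1 h1) (Set.mem_Ioi.1 h2))
  have hlr : IndepFun l r (iidBlocks p Q) := by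
    rw [IndepFun_iff_Indep]
    refine indep_of_indep_of_le_left (indep_of_indep_of_le_right hsup ?_) ?_
    · rw [MeasurableSpace.pi, MeasurableSpace.comap_iSup]
      refine iSup_le fun z => ?_
      rw [MeasurableSpace.comap_comp]
      by_cases hz : 0 < z
      · have : (fun b : ℤ → Block => b z) ∘ r = fun b => b z := by funext b; simp [r, hz]
        rw [this]
        exact le_iSup₂_of_le z (Set.mem_Ioi.2 hz) le_rfl
      · have : (fun b : ℤ → Block => b z) ∘ r = fun _ => default := by funext b; simp [r, hz]
        rw [this, MeasurableSpace.comap_const]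
        exact bot_le
    · rw [MeasurableSpace.pi, MeasurableSpace.comap_iSup]
      refine iSup_le fun z => ?_
      rw [MeasurableSpace.comap_comp]
      by_cases hz : z ≤ 0
      · have : (fun b : ℤ → Block => b z) ∘ l = fun b => b z := by funext b; simp [l, hz]
        rw [this]
        exact le_iSup₂_of_le z (Set.mem_Iic.2 hz) le_rfl
      · have : (fun b : ℤ → Block => b z) ∘ l = fun _ => default := by funext b; simp [l, hz]
        rw [this, MeasurableSpace.comap_const]
        exact bot_le
  rw [hpast, hfut]
  exact hlr.comp ((measurable_pastInt measurable_blockTime 0).comp measurable_prodMk_left)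
    measurable_future_block

variable {p Q}

lemma indepFun_map_iff {Ω Ω' E F : Type*} [MeasurableSpace Ω] [MeasurableSpace Ω']
    [MeasurableSpace E] [MeasurableSpace F] {P : Measure Ω} {g : Ω → Ω'} (hg : Measurable g)
    {X : Ω' → E} {Y : Ω' → F} (hX : Measurable X) (hY : Measurable Y) :
    IndepFun X Y (P.map g) ↔ IndepFun (X ∘ g) (Y ∘ g) P := by
  simp only [indepFun_iff_measure_inter_preimage_eq_mul]
  refine forall₂_congr fun s t => forall₂_congr fun hs ht => ?_
  rw [Measure.map_apply hg ((hX hs).inter (hY ht)), Measure.map_apply hg (hX hs),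
    Measure.map_apply hg (hY ht)]
  rfl

/-- Conditioning on a renewal at `z` commutes with passing to the displacements seen from `z`. -/
lemma cond_map_displacements {Ω : Type*} [MeasurableSpace Ω] {P : Measure Ω}
    {π : Ω → Equiv.Perm ℤ} {T : ℤ → Ω → ℤ} (hπ : ∀ i, Measurable fun ω => π ω i)
    (hT : ∀ k, Measurable (T k)) (z : ℤ) :
    (P[|renewalEventInt T z]).map (displacements π T z)
      = (P.map (displacements π T z))[|renewalAtOrigin] := by
  have hD := measurable_displacements hπ hT z
  refine Measure.ext fun G hG => ?_
  rw [Measure.map_apply hD hG, cond_apply (measurableSet_renewalEventInt hT z),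
    cond_apply measurableSet_renewalAtOrigin, renewalEventInt_eq_preimage (π := π),
    Measure.map_apply hD measurableSet_renewalAtOrigin,
    Measure.map_apply hD (measurableSet_renewalAtOrigin.inter hG), Set.preimage_inter]

/-- The stationary version, with its Palm law. -/
theorem isStationaryRegenerative_block (hp : meanLength p ≠ ∞) :
    IsStationaryRegenerative (stationaryMeasure p Q) blockPerm blockTime ∧
      ∀ z, palmLawInt (stationaryMeasure p Q) blockPerm blockTime z = canonicalLaw p Q := by
  have hmk : Measurable (Prod.mk 0 : (ℤ → Block) → BlockSpace) := measurable_prodMk_left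
  have hcond : ∀ z, ((stationaryMeasure p Q)[|renewalEventInt blockTime z]).map
      (displacements blockPerm blockTime z) =
        ((stationaryMeasure p Q)[|renewalEventInt blockTime 0]).map
      (displacements blockPerm blockTime 0) := by
    intro z
    rw [cond_map_displacements measurable_blockPerm measurable_blockTime,
      cond_map_displacements measurable_blockPerm measurable_blockTime,
      stationaryMeasure_map_displacements]
  have hpalm : ∀ z, palmLawInt (stationaryMeasure p Q) blockPerm blockTime z
      = canonicalLaw p Q := by
    have hz : ∀ z, palmLawInt (stationaryMeasure p Q) blockPerm blockTime z
        = (((stationaryMeasure p Q)[|renewalEventInt blockTime z]).map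
            (displacements blockPerm blockTime z)).map futureOfDisplacements := by
      intro z
      rw [Measure.map_map measurable_futureOfDisplacements
        (measurable_displacements measurable_blockPerm measurable_blockTime z),
        futureOfDisplacements_displacements, palmLawInt]
    intro z
    rw [hz, hcond, ← hz, palmLawInt, cond_renewalEventInt_zero p Q hp,
      Measure.map_map (measurable_futureInt measurable_blockPerm measurable_blockTime 0) hmk]
    rfl
  refine ⟨⟨measurable_blockPerm, measurable_blockTime, ?_, ?_,
    stationaryMeasure_map_displacements p Q, ?_, canonicalLaw p Q, isZeroDelayLaw_canonicalLaw,
    fun z _ => ⟨hpalm z, ?_⟩⟩, hpalm⟩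
  · exact Filter.Eventually.of_forall strictMono_blockTime
  · filter_upwards [ae_stationaryMeasure p Q] with ω hω
    have h := blockEnd_sub_one ω.1 ω.2 0
    rw [blockEnd_zero, zero_sub] at h
    simp only [blockTime, blockEnd_zero]
    omega
  · refine Filter.Eventually.of_forall fun ω z hz => ?_
    obtain ⟨k, rfl⟩ := hz
    exact splitsAtInt_concatPerm _ _ _
  · have hind0 : IndepFun (pastInt blockTime 0) (futureInt blockPerm blockTime 0)
        ((stationaryMeasure p Q)[|renewalEventInt blockTime 0]) := by
      rw [cond_renewalEventInt_zero p Q hp, indepFun_map_iff hmk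
        (measurable_pastInt measurable_blockTime 0)
        (measurable_futureInt measurable_blockPerm measurable_blockTime 0)]
      exact indepFun_past_future_block p Q
    have hD := measurable_displacements measurable_blockPerm measurable_blockTime
    have h := fun z => indepFun_map_iff
      (P := (stationaryMeasure p Q)[|renewalEventInt blockTime z]) (hD z)
      measurable_pastOfDisplacements measurable_futureOfDisplacements
    simp only [futureOfDisplacements_displacements, pastOfDisplacements_displacements] at h
    rw [← h, hcond, h]
    exact hind0

end Construction

/-! ### The block structure of a stationary version -/

section BlockStructure

section Pointwise

variable {Ω : Type*} {π : Ω → Equiv.Perm ℤ} {T : ℤ → Ω → ℤ}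

lemma time_add_of_blocks {ω : Ω} {k : ℤ} {b : ℕ → Block} {K : ℕ}
    (h : ∀ i < K, ω ∈ blockEventInt π T (k + i + 1) (b i).len (b i).perm) :
    T (k + K) ω = T k ω + offset b K := by
  induction K with
  | zero => simp
  | succ K ih =>
    have h1 := ((mem_blockEventInt_succ _ _ _ _).1 (h K (by omega))).1
    have h2 := ih fun i hi => h i (by omega)
    rw [offset_succ, Nat.cast_add, Nat.cast_one, ← add_assoc]
    push_cast
    linarith

/-- A permutation which splits at both ends of an interval permutes that interval. -/
lemma exists_hasReducedBlockInt {σ : Equiv.Perm ℤ} {a : ℤ} {n : ℕ} (h1 : SplitsAtInt σ a)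
    (h2 : SplitsAtInt σ (a + n)) : ∃ τ, HasReducedBlockInt σ a n τ := by
  have hrange : ∀ j : Fin n, a < σ (a + ((j : ℕ) + 1)) ∧ σ (a + ((j : ℕ) + 1)) ≤ a + n := by
    intro j
    have hj := j.2
    have e1 := h1 (a + ((j : ℕ) + 1))
    have e2 := h2 (a + ((j : ℕ) + 1))
    constructor
    · by_contra! hle
      have := e1.2 hle
      omega
    · exact e2.1 (by omega)
  let f : Fin n → Fin n := fun j => ⟨(σ (a + ((j : ℕ) + 1)) - a - 1).toNat, by
    have := hrange j; omega⟩
  have hf : Function.Injective f := by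
    intro i j hij
    have h3 : (σ (a + ((i : ℕ) + 1)) - a - 1).toNat = (σ (a + ((j : ℕ) + 1)) - a - 1).toNat :=
      congrArg Fin.val hij
    have hi := hrange i
    have hj := hrange j
    have h4 : σ (a + ((i : ℕ) + 1)) = σ (a + ((j : ℕ) + 1)) := by omega
    have h5 := σ.injective h4
    ext
    omega
  refine ⟨Equiv.ofBijective f (Finite.injective_iff_bijective.1 hf), fun j => ?_⟩
  have hj := hrange j
  rw [Equiv.ofBijective_apply]
  simp only [f]
  omega

open Classical in
/-- The block number `z`; a junk value if there is no such block. -/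
noncomputable def blockOf (π : Ω → Equiv.Perm ℤ) (T : ℤ → Ω → ℤ) (z : ℤ) (ω : Ω) : Block :=
  if h : ∃ β : Block, ω ∈ blockEventInt π T z β.len β.perm then h.choose else default

lemma blockOf_eq {z : ℤ} {ω : Ω} {β : Block} (h : ω ∈ blockEventInt π T z β.len β.perm) :
    blockOf π T z ω = β := by
  have hex : ∃ β : Block, ω ∈ blockEventInt π T z β.len β.perm := ⟨β, h⟩
  rw [blockOf, dif_pos hex]
  exact blockEventInt_unique hex.choose_spec h

end Pointwise

variable {Ω : Type*} [MeasurableSpace Ω] {P : Measure Ω} [IsProbabilityMeasure P]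
  {π : Ω → Equiv.Perm ℤ} {T : ℤ → Ω → ℤ}

lemma measurableSet_blockEventInt (hπ : ∀ i, Measurable fun ω => π ω i)
    (hT : ∀ k, Measurable (T k)) (k : ℤ) (n : ℕ) (τ : Equiv.Perm (Fin n)) :
    MeasurableSet (blockEventInt π T k n τ) := by
  have : blockEventInt π T k n τ = {ω | blockLength T k ω = n} ∩
      ⋃ a : ℤ, ({ω | T (k - 1) ω = a} ∩ ⋂ j : Fin n,
        {ω | π ω (a + ((j : ℕ) + 1)) = a + (((τ j : ℕ) : ℤ) + 1)}) := by
    ext ω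
    simp [blockEventInt, HasReducedBlockInt]
  rw [this]
  refine ((hT k).sub (hT (k - 1)) (measurableSet_singleton _)).inter (MeasurableSet.iUnion fun a =>
    (hT (k - 1) (measurableSet_singleton _)).inter (MeasurableSet.iInter fun j =>
      hπ _ (measurableSet_singleton _)))

lemma measurable_blockOf (hπ : ∀ i, Measurable fun ω => π ω i) (hT : ∀ k, Measurable (T k))
    (z : ℤ) : Measurable (blockOf π T z) := by
  have hev := fun β : Block => measurableSet_blockEventInt hπ hT z β.len β.perm
  refine measurable_to_countable' fun β => ?_
  by_cases hβ : β = default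
  · have : blockOf π T z ⁻¹' {β} = blockEventInt π T z β.len β.perm ∪
        (⋃ β' : Block, blockEventInt π T z β'.len β'.perm)ᶜ := by
      ext ω
      simp only [Set.mem_preimage, Set.mem_singleton_iff, Set.mem_union, Set.mem_compl_iff,
        Set.mem_iUnion]
      constructor
      · intro h
        by_cases hex : ∃ β' : Block, ω ∈ blockEventInt π T z β'.len β'.perm
        · left
          obtain ⟨β', hβ'⟩ := hex
          rw [blockOf_eq hβ'] at h
          rwa [← h]
        · exact Or.inr hex
      · rintro (h | h)
        · exact blockOf_eq h
        · rw [blockOf, dif_neg h, hβ]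
    rw [this]
    exact (hev β).union (MeasurableSet.iUnion hev).compl
  · have : blockOf π T z ⁻¹' {β} = blockEventInt π T z β.len β.perm := by
      ext ω
      simp only [Set.mem_preimage, Set.mem_singleton_iff]
      constructor
      · intro h
        by_cases hex : ∃ β' : Block, ω ∈ blockEventInt π T z β'.len β'.perm
        · obtain ⟨β', hβ'⟩ := hex
          rw [blockOf_eq hβ'] at h
          rwa [← h]
        · rw [blockOf, dif_neg hex] at h
          exact absurd h.symm hβ
      · exact blockOf_eq
    rw [this]
    exact hev β

omit [IsProbabilityMeasure P] in
lemma IsStationaryRegenerative.ae_mem_blockEventInt_iff (h : IsStationaryRegenerative P π T) :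
    ∀ᵐ ω ∂P, ∀ z (β : Block), ω ∈ blockEventInt π T z β.len β.perm ↔ blockOf π T z ω = β := by
  filter_upwards [h.strictMono, h.splits] with ω hmono hsplit z β
  refine ⟨blockOf_eq, ?_⟩
  rintro rfl
  have hlt : T (z - 1) ω < T z ω := hmono (by omega)
  obtain ⟨n, hn⟩ : ∃ n : ℕ+, T z ω = T (z - 1) ω + (n : ℕ) :=
    ⟨⟨(T z ω - T (z - 1) ω).toNat, by omega⟩, by rw [PNat.mk_coe]; omega⟩
  obtain ⟨τ, hτ⟩ := exists_hasReducedBlockInt (hsplit _ ⟨z - 1, rfl⟩)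
    (n := n) (by rw [← hn]; exact hsplit _ ⟨z, rfl⟩)
  have hmem : ω ∈ blockEventInt π T z (⟨n, τ⟩ : Block).len (⟨n, τ⟩ : Block).perm :=
    ⟨by simp only [blockLength]; omega, hτ⟩
  rwa [blockOf_eq hmem]

omit [IsProbabilityMeasure P] in
lemma IsStationaryRegenerative.ae_blockLength_eq (h : IsStationaryRegenerative P π T) :
    ∀ᵐ ω ∂P, ∀ z, blockLength T z ω = ((blockOf π T z ω).len : ℕ) := by
  filter_upwards [h.ae_mem_blockEventInt_iff] with ω hω z
  exact ((hω z _).2 rfl).1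

variable {p : PMF ℕ+} {Q : ∀ n : ℕ, PMF (Equiv.Perm (Fin n))}

/-- A renewal occurs at a given site with probability the inverse of the mean block length. -/
lemma IsStationaryRegenerative.intensity (h : IsStationaryRegenerative P π T)
    (hpalm : palmLawInt P π T 0 = canonicalLaw p Q) :
    P (renewalEventInt T 0) = (meanLength p)⁻¹ := by
  have h1 := h.intensity_mul_tsum
  rw [hpalm] at h1
  simp only [canonicalLaw_noRenewal, tsum_blockMeasure_lt] at h1
  exact ENNReal.eq_inv_of_mul_eq_one_left h1

/-- The joint law of `T 0` and the blocks with numbers `-m, …, m`: these blocks are the given ones if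
and only if there is a renewal at the left end of the first of them, followed by these blocks. -/
lemma IsStationaryRegenerative.measure_blocks (h : IsStationaryRegenerative P π T)
    (hpalm : palmLawInt P π T 0 = canonicalLaw p Q) (j m : ℕ) (b : ℤ → Block)
    (hj : j < ((b 0).len : ℕ)) :
    P {ω | T 0 ω = j ∧ ∀ z ∈ Finset.Icc (-(m : ℤ)) m,
        ω ∈ blockEventInt π T z (b z).len (b z).perm}
      = (meanLength p)⁻¹ * ∏ z ∈ Finset.Icc (-(m : ℤ)) m, blockMeasure p Q {b z} := by
  let e : ℕ ↪ ℤ := ⟨fun i => (i : ℤ) - m, fun i j h => by simpa using h⟩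
  have he : ∀ i, e i = (i : ℤ) - m := fun _ => rfl
  have hIcc : Finset.Icc (-(m : ℤ)) m = (Finset.range (2 * m + 1)).map e := by
    ext z
    simp only [Finset.mem_Icc, Finset.mem_map, Finset.mem_range, he]
    constructor
    · intro hz
      exact ⟨(z + m).toNat, by omega, by omega⟩
    · rintro ⟨i, hi, rfl⟩
      omega
  let b' : ℕ → Block := fun i => b ((i : ℤ) - m)
  set a : ℤ := j - offset b' (m + 1) with ha
  have hset : P {ω | T 0 ω = j ∧ ∀ z ∈ Finset.Icc (-(m : ℤ)) m,
      ω ∈ blockEventInt π T z (b z).len (b z).perm}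
      = P (renewalEventInt T a ∩ futureInt π T a ⁻¹' startsWith b' (2 * m + 1)) := by
    refine measure_congr ?_
    filter_upwards [h.strictMono, h.indexing] with ω hmono hidx
    refine propext ?_
    change (T 0 ω = j ∧ ∀ z ∈ Finset.Icc (-(m : ℤ)) m,
      ω ∈ blockEventInt π T z (b z).len (b z).perm) ↔
      (a ∈ renewalSetInt T ω ∧ futureInt π T a ω ∈ startsWith b' (2 * m + 1))
    have hblocks : (∀ z ∈ Finset.Icc (-(m : ℤ)) m, ω ∈ blockEventInt π T z (b z).len (b z).perm) ↔
        ∀ i < 2 * m + 1, ω ∈ blockEventInt π T (-(m : ℤ) - 1 + i + 1) (b' i).len (b' i).perm := by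
      rw [hIcc]
      simp only [Finset.mem_map, Finset.mem_range, forall_exists_index, and_imp,
        forall_apply_eq_imp_iff₂, he]
      refine forall₂_congr fun i _ => ?_
      rw [show -(m : ℤ) - 1 + i + 1 = i - m by ring]
    constructor
    · rintro ⟨h0, hb⟩
      rw [hblocks] at hb
      have h1 := time_add_of_blocks (K := m + 1) fun i hi => hb i (by omega)
      rw [show -(m : ℤ) - 1 + ((m + 1 : ℕ) : ℤ) = 0 by push_cast; ring] at h1
      have h2 : T (-(m : ℤ) - 1) ω = a := by omega
      exact ⟨⟨_, h2⟩, (startsWith_futureInt_iff hmono h2 _ _).2 hb⟩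
    · rintro ⟨⟨k, hk⟩, hb⟩
      rw [startsWith_futureInt_iff hmono hk] at hb
      have h1 := time_add_of_blocks (K := m + 1) fun i hi => hb i (by omega)
      have h2 := time_add_of_blocks (K := m) fun i hi => hb i (by omega)
      rw [offset_succ] at ha h1
      have hb0 : b' m = b 0 := by simp [b']
      rw [hb0] at ha h1
      have hlt : -1 < k + ((m + 1 : ℕ) : ℤ) := hmono.lt_iff_lt.1 (by omega)
      have hgt : k + (m : ℤ) < 0 := hmono.lt_iff_lt.1 (by omega)
      obtain rfl : k = -(m : ℤ) - 1 := by omega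
      refine ⟨?_, hblocks.2 hb⟩
      rw [show -(m : ℤ) - 1 + ((m + 1 : ℕ) : ℤ) = 0 by push_cast; ring] at h1
      omega
  rw [hset, h.measure_renewal_inter_future _ (measurableSet_startsWith _ _), hpalm,
    canonicalLaw_startsWith, h.intensity hpalm, hIcc, Finset.prod_map]
  rfl

/-- The law of the blocks on the event `{T 0 = j}`. -/
lemma IsStationaryRegenerative.map_blockOf (h : IsStationaryRegenerative P π T)
    (hpalm : palmLawInt P π T 0 = canonicalLaw p Q) (j : ℕ) :
    (P.restrict {ω | T 0 ω = j}).map (fun ω z => blockOf π T z ω)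
      = (meanLength p)⁻¹ • (iidBlocks p Q).restrict {b | j < ((b 0).len : ℕ)} := by
  have hfin : (meanLength p)⁻¹ ≠ ∞ := ENNReal.inv_ne_top.2 (meanLength_ne_zero p)
  have : IsFiniteMeasure ((meanLength p)⁻¹ • (iidBlocks p Q).restrict
      {b : ℤ → Block | j < ((b 0).len : ℕ)}) := Measure.smul_finite _ hfin
  have hm : Measurable fun ω z => blockOf π T z ω :=
    measurable_pi_lambda _ fun z => measurable_blockOf h.measurable_perm h.measurable_time z
  refine measure_ext_of_window {s | ∃ m : ℕ, s = Finset.Icc (-(m : ℤ)) m} (fun t => ?_) ?_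
  · refine ⟨_, ⟨∑ z ∈ t, z.natAbs, rfl⟩, fun z hz => ?_⟩
    have : z.natAbs ≤ ∑ z ∈ t, z.natAbs := Finset.single_le_sum (fun _ _ => Nat.zero_le _) hz
    rw [Finset.mem_Icc]
    omega
  · rintro _ ⟨m, rfl⟩ b
    set s := Finset.Icc (-(m : ℤ)) m with hs
    have h0s : (0 : ℤ) ∈ s := by rw [hs, Finset.mem_Icc]; omega
    have hw := measurableSet_window s b
    rw [Measure.map_apply hm hw, Measure.restrict_apply (hm hw), Measure.smul_apply, smul_eq_mul,
      Measure.restrict_apply hw]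
    by_cases hj : j < ((b 0).len : ℕ)
    · have h1 := h.measure_blocks hpalm j m b hj
      have h2 : window s b ∩ {b | j < ((b 0).len : ℕ)} = window s b := by
        refine Set.inter_eq_left.2 fun x hx => ?_
        have : x 0 = b 0 := hx 0 h0s
        simpa [this] using hj
      rw [h2, iidBlocks_window, ← h1]
      refine measure_congr ?_
      filter_upwards [h.ae_mem_blockEventInt_iff] with ω hω
      refine propext (and_comm.trans (and_congr_right fun _ => ?_))
      exact forall₂_congr fun z _ => (hω z (b z)).symm
    · have h2 : window s b ∩ {b | j < ((b 0).len : ℕ)} = ∅ := by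
        rw [Set.eq_empty_iff_forall_notMem]
        rintro x ⟨hx, hx'⟩
        have : x 0 = b 0 := hx 0 h0s
        exact hj (by simpa [this] using hx')
      rw [h2, measure_empty, mul_zero]
      refine measure_eq_zero_iff_ae_notMem.2 ?_
      filter_upwards [h.ae_blockLength_eq, h.indexing] with ω hω hidx ⟨hx, hT⟩
      have h3 : blockOf π T 0 ω = b 0 := hx 0 h0s
      have h4 := hω 0
      have h5 : T 0 ω = j := hT
      rw [h3, blockLength, zero_sub] at h4
      omega

lemma IsStationaryRegenerative.measure_blockOf_box (h : IsStationaryRegenerative P π T)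
    (hpalm : palmLawInt P π T 0 = canonicalLaw p Q) (j : ℕ) (s : Finset ℤ) (A : ℤ → Set Block) :
    P {ω | T 0 ω = j ∧ ∀ z ∈ s, blockOf π T z ω ∈ A z}
      = (meanLength p)⁻¹ * iidBlocks p Q {b | j < ((b 0).len : ℕ) ∧ ∀ z ∈ s, b z ∈ A z} := by
  have hm : Measurable fun ω z => blockOf π T z ω :=
    measurable_pi_lambda _ fun z => measurable_blockOf h.measurable_perm h.measurable_time z
  have hA : MeasurableSet {b : ℤ → Block | ∀ z ∈ s, b z ∈ A z} := by
    simp only [Set.ofPred_forall]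
    exact MeasurableSet.iInter fun z => MeasurableSet.iInter fun _ =>
      measurable_pi_apply z MeasurableSet.of_discrete
  have h1 := congrArg (fun μ : Measure (ℤ → Block) => μ {b | ∀ z ∈ s, b z ∈ A z})
    (h.map_blockOf hpalm j)
  rw [Measure.map_apply hm hA, Measure.restrict_apply (hm hA), Measure.smul_apply, smul_eq_mul,
    Measure.restrict_apply hA] at h1
  rw [Set.inter_comm, Set.inter_comm _ {b : ℤ → Block | j < ((b 0).len : ℕ)}] at h1
  exact h1

omit [IsProbabilityMeasure P] in
lemma IsStationaryRegenerative.measure_eq_tsum_time (h : IsStationaryRegenerative P π T)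
    {A : Set Ω} (hA : MeasurableSet A) : P A = ∑' j : ℕ, P {ω | T 0 ω = j ∧ ω ∈ A} := by
  have hms : ∀ j : ℕ, MeasurableSet {ω | T 0 ω = j ∧ ω ∈ A} := fun j =>
    (h.measurable_time 0 (measurableSet_singleton (j : ℤ))).inter hA
  rw [← measure_iUnion _ hms]
  · refine measure_congr ?_
    filter_upwards [h.indexing] with ω hω
    refine propext ⟨fun hA => ?_, fun hU => ?_⟩
    · exact Set.mem_iUnion.2 ⟨(T 0 ω).toNat, by have := hω.2; omega, hA⟩
    · obtain ⟨j, hj⟩ := Set.mem_iUnion.1 hU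
      exact hj.2
  · intro i j hij
    refine Set.disjoint_left.2 fun ω hi hj => hij ?_
    have := hi.1.symm.trans hj.1
    omega

omit [IsProbabilityMeasure P] in
lemma measurableSet_blockOf_box (h : IsStationaryRegenerative P π T) (s : Finset ℤ)
    (A : ℤ → Set Block) : MeasurableSet {ω | ∀ z ∈ s, blockOf π T z ω ∈ A z} := by
  simp only [Set.ofPred_forall]
  exact MeasurableSet.iInter fun z => MeasurableSet.iInter fun _ =>
    measurable_blockOf h.measurable_perm h.measurable_time z MeasurableSet.of_discrete

/-- The joint law of `T 0` and finitely many blocks, where the length of block number `0` is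
prescribed. -/
lemma IsStationaryRegenerative.measure_time_blockOf (h : IsStationaryRegenerative P π T)
    (hpalm : palmLawInt P π T 0 = canonicalLaw p Q) (j : ℕ) {s : Finset ℤ} (hs : 0 ∈ s)
    {A : ℤ → Set Block} {n : ℤ} (hA : ∀ β ∈ A 0, ((β.len : ℕ) : ℤ) = n) :
    P {ω | T 0 ω = j ∧ ∀ z ∈ s, blockOf π T z ω ∈ A z}
      = if (j : ℤ) < n then (meanLength p)⁻¹ * ∏ z ∈ s, blockMeasure p Q (A z) else 0 := by
  rw [h.measure_blockOf_box hpalm]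
  split_ifs with hj
  · rw [← iidBlocks_box]
    congr 2
    ext b
    simp only [Set.mem_ofPred_eq, and_iff_right_iff_imp]
    intro hb
    have := hA _ (hb 0 hs)
    omega
  · convert mul_zero _
    convert measure_empty (μ := iidBlocks p Q)
    rw [Set.eq_empty_iff_forall_notMem]
    rintro b ⟨h1, h2⟩
    have := hA _ (h2 0 hs)
    omega

lemma IsStationaryRegenerative.measure_blockOf (h : IsStationaryRegenerative P π T)
    (hpalm : palmLawInt P π T 0 = canonicalLaw p Q) {s : Finset ℤ} (hs : 0 ∈ s)
    {A : ℤ → Set Block} {n : ℤ} (hA : ∀ β ∈ A 0, ((β.len : ℕ) : ℤ) = n) :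
    P {ω | ∀ z ∈ s, blockOf π T z ω ∈ A z}
      = n.toNat * ((meanLength p)⁻¹ * ∏ z ∈ s, blockMeasure p Q (A z)) := by
  rw [h.measure_eq_tsum_time (measurableSet_blockOf_box h s A), ← tsum_ite_lt]
  refine tsum_congr fun j => ?_
  refine (h.measure_time_blockOf hpalm j hs hA).trans ?_
  by_cases hj : (j : ℤ) < n
  · rw [if_pos hj, if_pos (by omega)]
  · rw [if_neg hj, if_neg (by omega)]

omit [IsProbabilityMeasure P] in
lemma IsStationaryRegenerative.measure_blockLength_window (h : IsStationaryRegenerative P π T)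
    (s : Finset ℤ) (l : ℤ → ℤ) :
    P {ω | ∀ z ∈ s, blockLength T z ω = l z}
      = P {ω | ∀ z ∈ s, blockOf π T z ω ∈ {β : Block | ((β.len : ℕ) : ℤ) = l z}} := by
  refine measure_congr ?_
  filter_upwards [h.ae_blockLength_eq] with ω hω
  refine propext (forall₂_congr fun z _ => ?_)
  rw [hω z]

lemma IsStationaryRegenerative.measure_blockLength_zero (h : IsStationaryRegenerative P π T)
    (hpalm : palmLawInt P π T 0 = canonicalLaw p Q) (n : ℤ) :
    P {ω | blockLength T 0 ω = n}
      = n.toNat * ((meanLength p)⁻¹ * blockMeasure p Q {β | ((β.len : ℕ) : ℤ) = n}) := by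
  have h1 := h.measure_blockLength_window {0} fun _ => n
  rw [h.measure_blockOf hpalm (Finset.mem_singleton_self 0) (n := n) fun β hβ => hβ,
    Finset.prod_singleton] at h1
  simpa using h1

lemma IsStationaryRegenerative.measure_blockLength_of_ne (h : IsStationaryRegenerative P π T)
    (hpalm : palmLawInt P π T 0 = canonicalLaw p Q) (hp : meanLength p ≠ ∞) {z : ℤ} (hz : z ≠ 0)
    (n : ℤ) :
    P {ω | blockLength T z ω = n} = blockMeasure p Q {β | ((β.len : ℕ) : ℤ) = n} := by
  have h1 := h.measure_blockLength_window {z} fun _ => n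
  simp only [Finset.mem_singleton, forall_eq] at h1
  have h2 : ∀ j : ℕ, P {ω | T 0 ω = j ∧ ω ∈ {ω | ∀ y ∈ ({z} : Finset ℤ), blockOf π T y ω ∈
      {β : Block | ((β.len : ℕ) : ℤ) = n}}} = (meanLength p)⁻¹ *
      (blockMeasure p Q {β | j < (β.len : ℕ)} * blockMeasure p Q {β | ((β.len : ℕ) : ℤ) = n}) := by
    intro j
    refine (h.measure_blockOf_box hpalm j {z} fun _ => _).trans ?_
    have h3 := iidBlocks_box p Q {0, z} fun y => if y = 0 then {β : Block | j < (β.len : ℕ)} else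
      {β : Block | ((β.len : ℕ) : ℤ) = n}
    rw [Finset.prod_pair hz.symm, if_pos rfl, if_neg hz] at h3
    rw [← h3]
    congr 2
    ext b
    simp [hz]
  have h4 := h.measure_eq_tsum_time (measurableSet_blockOf_box h {z} fun _ =>
    {β : Block | ((β.len : ℕ) : ℤ) = n})
  rw [tsum_congr h2, ENNReal.tsum_mul_left, ENNReal.tsum_mul_right, tsum_blockMeasure_lt,
    ← mul_assoc, ENNReal.inv_mul_cancel (meanLength_ne_zero p) hp, one_mul] at h4
  rw [h1, ← h4]
  simp only [Finset.mem_singleton, forall_eq]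

lemma blockMeasure_len_eq_cast (n : ℕ+) :
    blockMeasure p Q {β | ((β.len : ℕ) : ℤ) = (n : ℕ)} = p n := by
  rw [← blockMeasure_len_eq p Q n]
  congr 1
  ext β
  simp only [Set.mem_ofPred_eq, Nat.cast_inj]
  exact PNat.coe_inj

lemma IsStationaryRegenerative.iIndepFun_blockLength (h : IsStationaryRegenerative P π T)
    (hpalm : palmLawInt P π T 0 = canonicalLaw p Q) (hp : meanLength p ≠ ∞) :
    iIndepFun (blockLength T) P := by
  have hm : ∀ z, Measurable (blockLength T z) := fun z =>
    (h.measurable_time z).sub (h.measurable_time (z - 1))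
  have hm' := measurable_pi_lambda (fun ω z => blockLength T z ω) hm
  have : ∀ z, IsProbabilityMeasure (P.map (blockLength T z)) := fun z =>
    Measure.isProbabilityMeasure_map (hm z).aemeasurable
  rw [iIndepFun_iff_map_fun_eq_infinitePi_map hm]
  refine measure_ext_of_window {s | 0 ∈ s} (fun t => ⟨insert 0 t, Finset.mem_insert_self _ _,
    Finset.subset_insert _ _⟩) fun s hs l => ?_
  have hs : (0 : ℤ) ∈ s := hs
  have hinf : Measure.infinitePi (fun z => P.map (blockLength T z)) (window s l)
      = ∏ z ∈ s, P {ω | blockLength T z ω = l z} := by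
    have h1 := Measure.infinitePi_pi (fun z => P.map (blockLength T z)) (s := s)
      (t := fun z => {l z}) fun z _ => measurableSet_singleton _
    have h2 : ((s : Set ℤ).pi fun z => {l z}) = window s l := by
      ext x; simp [window]
    rw [h2] at h1
    rw [h1]
    refine Finset.prod_congr rfl fun z _ => ?_
    rw [Measure.map_apply (hm z) (measurableSet_singleton _)]
    rfl
  rw [hinf, Measure.map_apply hm' (measurableSet_window s l)]
  refine (h.measure_blockLength_window s l).trans ?_
  rw [h.measure_blockOf hpalm hs (n := l 0) fun β hβ => hβ, ← Finset.mul_prod_erase s _ hs,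
    ← Finset.mul_prod_erase s _ hs, h.measure_blockLength_zero hpalm, mul_assoc, mul_assoc]
  congr 3
  refine Finset.prod_congr rfl fun z hz => ?_
  rw [h.measure_blockLength_of_ne hpalm hp (Finset.ne_of_mem_erase hz)]

lemma IsStationaryRegenerative.condExp_delay (h : IsStationaryRegenerative P π T)
    (hpalm : palmLawInt P π T 0 = canonicalLaw p Q) (j : ℕ) :
    P⟦{ω | T 0 ω = j} | lengthAlgebraInt T⟧ =ᵐ[P]
      fun ω => if (j : ℤ) < blockLength T 0 ω then 1 / (blockLength T 0 ω : ℝ) else 0 := by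
  have hm : ∀ z, Measurable (blockLength T z) := fun z =>
    (h.measurable_time z).sub (h.measurable_time (z - 1))
  refine condExp_eq_of_window (X := fun ω z => blockLength T z ω) (measurable_pi_lambda _ hm)
    (A := {ω | T 0 ω = j}) (g := fun x => if (j : ℤ) < x 0 then 1 / (x 0 : ℝ) else 0)
    (h.measurable_time 0 (measurableSet_singleton (j : ℤ))).nullMeasurableSet ?_ ?_ {0} ?_ ?_
  · intro x
    split_ifs with hx
    · have : (0 : ℝ) < x 0 := by exact_mod_cast (by omega : 0 < x 0)
      positivity
    · exact le_rfl
  · intro x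
    split_ifs with hx
    · have : (1 : ℝ) ≤ x 0 := by exact_mod_cast (by omega : 1 ≤ x 0)
      rw [div_le_one (by linarith)]
      exact this
    · exact zero_le_one
  · intro x y hxy
    simp only [hxy 0 (Finset.mem_singleton_self 0)]
  · intro s hs l
    have hs : (0 : ℤ) ∈ s := hs (Finset.mem_singleton_self 0)
    have e1 : P ({ω | T 0 ω = j} ∩ (fun ω z => blockLength T z ω) ⁻¹' window s l)
        = P {ω | T 0 ω = j ∧ ∀ z ∈ s, blockOf π T z ω ∈ {β : Block | ((β.len : ℕ) : ℤ) = l z}} := by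
      refine measure_congr ?_
      filter_upwards [h.ae_blockLength_eq] with ω hω
      refine propext (and_congr_right fun _ => forall₂_congr fun z _ => ?_)
      change blockLength T z ω = l z ↔ _
      rw [hω z]
    rw [e1, h.measure_time_blockOf hpalm j hs (n := l 0) fun β hβ => hβ]
    have e2 := h.measure_blockLength_window s l
    rw [h.measure_blockOf hpalm hs (n := l 0) fun β hβ => hβ] at e2
    refine Eq.trans ?_ (congrArg (fun x => _ * x) e2.symm)
    split_ifs with hj
    · have hl : (0 : ℝ) < l 0 := by exact_mod_cast (by omega : 0 < l 0)
      have hcast : (((l 0).toNat : ℕ) : ℝ≥0∞) = ENNReal.ofReal (l 0) := by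
        rw [← ENNReal.ofReal_natCast]
        congr 1
        exact_mod_cast Int.toNat_of_nonneg (by omega)
      rw [hcast, ← mul_assoc, ← ENNReal.ofReal_mul (by positivity), one_div,
        inv_mul_cancel₀ hl.ne', ENNReal.ofReal_one, one_mul]
    · simp

/-- The set which consists of the block with length `n` and permutation `τ`; it is empty if
`n = 0`. -/
def singleBlock (n : ℕ) (τ : Equiv.Perm (Fin n)) : Set Block :=
  {β | ∃ h : 0 < n, β = ⟨⟨n, h⟩, τ⟩}

omit [IsProbabilityMeasure P] in
lemma IsStationaryRegenerative.ae_mem_blockEventInt_iff_singleBlock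
    (h : IsStationaryRegenerative P π T) :
    ∀ᵐ ω ∂P, ∀ z (n : ℕ) (τ : Equiv.Perm (Fin n)),
      ω ∈ blockEventInt π T z n τ ↔ blockOf π T z ω ∈ singleBlock n τ := by
  filter_upwards [h.ae_mem_blockEventInt_iff, h.ae_blockLength_eq] with ω hω hlen z n τ
  constructor
  · intro hmem
    have h1 : blockLength T z ω = n := hmem.1
    have hn : 0 < n := by
      have := (blockOf π T z ω).len.pos
      have := hlen z
      omega
    exact ⟨hn, (hω z ⟨⟨n, hn⟩, τ⟩).1 hmem⟩
  · rintro ⟨hn, hβ⟩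
    exact (hω z ⟨⟨n, hn⟩, τ⟩).2 hβ

open Classical in
lemma blockMeasure_singleBlock_inter (n : ℕ) (τ : Equiv.Perm (Fin n)) (l : ℤ) :
    blockMeasure p Q ({β | ((β.len : ℕ) : ℤ) = l} ∩ singleBlock n τ)
      = (if l = n then Q n τ else 0) * blockMeasure p Q {β | ((β.len : ℕ) : ℤ) = l} := by
  rcases Nat.eq_zero_or_pos n with rfl | hn
  · have h1 : singleBlock 0 τ = ∅ := by
      rw [Set.eq_empty_iff_forall_notMem]
      rintro β ⟨h, -⟩
      exact lt_irrefl _ h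
    rw [h1, Set.inter_empty, measure_empty]
    split_ifs with hl
    · have h2 : {β : Block | ((β.len : ℕ) : ℤ) = l} = ∅ := by
        rw [Set.eq_empty_iff_forall_notMem]
        intro β hβ
        have h3 : ((β.len : ℕ) : ℤ) = l := hβ
        have := β.len.pos
        omega
      rw [h2, measure_empty, mul_zero]
    · rw [zero_mul]
  · have hs : singleBlock n τ = {(⟨⟨n, hn⟩, τ⟩ : Block)} := by
      ext β
      exact ⟨fun ⟨_, h⟩ => h, fun h => ⟨hn, h⟩⟩
    rw [hs]
    split_ifs with hl
    · have h1 : {β : Block | ((β.len : ℕ) : ℤ) = l} ∩ {(⟨⟨n, hn⟩, τ⟩ : Block)}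
          = {(⟨⟨n, hn⟩, τ⟩ : Block)} := by
        refine Set.inter_eq_right.2 ?_
        rintro _ rfl
        exact hl.symm
      have h2 := blockMeasure_len_eq_cast (p := p) (Q := Q) ⟨n, hn⟩
      rw [h1, blockMeasure_singleton, mul_comm, hl, ← h2]
      rfl
    · rw [zero_mul]
      convert measure_empty (μ := blockMeasure p Q)
      rw [Set.eq_empty_iff_forall_notMem]
      rintro _ ⟨h1, rfl⟩
      exact hl h1.symm

open Classical in
lemma IsStationaryRegenerative.condExp_blocks (h : IsStationaryRegenerative P π T)
    (hpalm : palmLawInt P π T 0 = canonicalLaw p Q) (s : Finset ℤ) (n : ℤ → ℕ)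
    (τ : ∀ k, Equiv.Perm (Fin (n k))) :
    P⟦⋂ k ∈ s, blockEventInt π T k (n k) (τ k) | lengthDelayAlgebra T⟧ =ᵐ[P]
      fun ω => ∏ k ∈ s, if blockLength T k ω = n k then (Q (n k) (τ k)).toReal else 0 := by
  have hm : ∀ z, Measurable (blockLength T z) := fun z =>
    (h.measurable_time z).sub (h.measurable_time (z - 1))
  -- the delay has index `none`, the length of block number `z` has index `some z`
  let X : Ω → Option ℤ → ℤ := fun ω o => o.elim (T 0 ω) fun z => blockLength T z ω
  have hX : Measurable X := by
    refine measurable_pi_lambda _ fun o => ?_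
    rcases o with _ | z
    · exact h.measurable_time 0
    · exact hm z
  have halg : lengthDelayAlgebra T = MeasurableSpace.comap X MeasurableSpace.pi := by
    simp only [lengthDelayAlgebra, lengthAlgebraInt, MeasurableSpace.pi,
      MeasurableSpace.comap_iSup, MeasurableSpace.comap_comp]
    rw [iSup_option, sup_comm]
    rfl
  let w : (Option ℤ → ℤ) → ℤ → ℝ := fun x k =>
    if x (some k) = n k then (Q (n k) (τ k)).toReal else 0
  have hw0 : ∀ x k, 0 ≤ w x k := by
    intro x k
    simp only [w]
    split_ifs
    · exact ENNReal.toReal_nonneg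
    · exact le_rfl
  have hw1 : ∀ x k, w x k ≤ 1 := by
    intro x k
    simp only [w]
    split_ifs
    · exact ENNReal.toReal_le_of_le_ofReal zero_le_one (by simpa using PMF.coe_le_one _ _)
    · exact zero_le_one
  rw [halg]
  refine condExp_eq_of_window hX (A := ⋂ k ∈ s, blockEventInt π T k (n k) (τ k))
    (g := fun x => ∏ k ∈ s, w x k)
    (Finset.measurableSet_biInter _ fun k _ => measurableSet_blockEventInt h.measurable_perm
      h.measurable_time k (n k) (τ k)).nullMeasurableSet
    (fun x => Finset.prod_nonneg fun k _ => hw0 x k)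
    (fun x => Finset.prod_le_one (fun k _ => hw0 x k) fun k _ => hw1 x k)
    (Finset.insertNone (insert 0 s)) ?_ ?_
  · intro x y hxy
    refine Finset.prod_congr rfl fun k hk => ?_
    simp only [w, hxy (some k) (by simp [hk])]
  · intro s' hs' l
    set t : Finset ℤ := Finset.eraseNone s' with ht
    have hmem : ∀ z, z ∈ t ↔ some z ∈ s' := fun z => by rw [ht, Finset.mem_eraseNone]
    have hnone : none ∈ s' := hs' (by simp)
    have h0t : (0 : ℤ) ∈ t := (hmem 0).2 (hs' (by simp))
    have hst : s ⊆ t := fun z hz => (hmem z).2 (hs' (by simp [hz]))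
    have hXw : ∀ ω, X ω ∈ window s' l ↔
        T 0 ω = l none ∧ ∀ z ∈ t, blockLength T z ω = l (some z) := by
      intro ω
      constructor
      · exact fun hx => ⟨hx none hnone, fun z hz => hx (some z) ((hmem z).1 hz)⟩
      · rintro ⟨h1, h2⟩ (_ | z) ho
        · exact h1
        · exact h2 z ((hmem z).2 ho)
    rcases lt_or_ge (l none) 0 with hneg | hpos
    · have hnull : P (X ⁻¹' window s' l) = 0 := by
        refine measure_eq_zero_iff_ae_notMem.2 ?_
        filter_upwards [h.indexing] with ω hω hx
        have := ((hXw ω).1 hx).1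
        omega
      rw [hnull, mul_zero]
      exact measure_mono_null Set.inter_subset_right hnull
    · obtain ⟨j, hj⟩ := Int.eq_ofNat_of_zero_le hpos
      have e1 : P (X ⁻¹' window s' l) = P {ω | T 0 ω = j ∧ ∀ z ∈ t, blockOf π T z ω ∈
          {β : Block | ((β.len : ℕ) : ℤ) = l (some z)}} := by
        refine measure_congr ?_
        filter_upwards [h.ae_blockLength_eq] with ω hω
        refine propext ((hXw ω).trans ?_)
        rw [hj]
        refine and_congr_right fun _ => forall₂_congr fun z _ => ?_
        rw [hω z]
      have e2 : P ((⋂ k ∈ s, blockEventInt π T k (n k) (τ k)) ∩ X ⁻¹' window s' l)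
          = P {ω | T 0 ω = j ∧ ∀ z ∈ t, blockOf π T z ω ∈
            {β : Block | ((β.len : ℕ) : ℤ) = l (some z)} ∩
              if z ∈ s then singleBlock (n z) (τ z) else Set.univ} := by
        refine measure_congr ?_
        filter_upwards [h.ae_blockLength_eq, h.ae_mem_blockEventInt_iff_singleBlock] with ω hω hω'
        refine propext ?_
        change (ω ∈ ⋂ k ∈ s, blockEventInt π T k (n k) (τ k)) ∧ X ω ∈ window s' l ↔
          T 0 ω = j ∧ ∀ z ∈ t, blockOf π T z ω ∈ {β : Block | ((β.len : ℕ) : ℤ) = l (some z)} ∩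
              if z ∈ s then singleBlock (n z) (τ z) else Set.univ
        rw [hXw, hj]
        simp only [Set.mem_iInter, hω', Set.mem_inter_iff, Set.mem_ofPred_eq, hω]
        constructor
        · rintro ⟨h1, h2, h3⟩
          refine ⟨h2, fun z hz => ⟨h3 z hz, ?_⟩⟩
          split_ifs with hzs
          · exact h1 z hzs
          · trivial
        · rintro ⟨h1, h2⟩
          refine ⟨fun z hz => ?_, h1, fun z hz => (h2 z hz).1⟩
          have := (h2 z (hst hz)).2
          rwa [if_pos hz] at this
      rw [e1, e2, h.measure_time_blockOf hpalm j h0t (n := l (some 0)) fun β hβ => hβ.1,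
        h.measure_time_blockOf hpalm j h0t (n := l (some 0)) fun β hβ => hβ]
      split_ifs with hlt
      · rw [mul_left_comm, ENNReal.ofReal_prod_of_nonneg fun k _ => hw0 l k]
        congr 1
        have e3 : ∀ z ∈ t, blockMeasure p Q ({β : Block | ((β.len : ℕ) : ℤ) = l (some z)} ∩
            if z ∈ s then singleBlock (n z) (τ z) else Set.univ)
            = (if z ∈ s then ENNReal.ofReal (w l z) else 1) *
              blockMeasure p Q {β : Block | ((β.len : ℕ) : ℤ) = l (some z)} := by
          intro z _
          split_ifs with hzs
          · rw [blockMeasure_singleBlock_inter]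
            congr 1
            simp only [w]
            split_ifs
            · rw [ENNReal.ofReal_toReal (PMF.apply_ne_top _ _)]
            · rw [ENNReal.ofReal_zero]
          · rw [Set.inter_univ, one_mul]
        rw [Finset.prod_congr rfl e3, Finset.prod_mul_distrib, Finset.prod_ite_mem,
          Finset.inter_eq_right.2 hst]
      · rw [mul_zero]

/-- The block structure of a stationary regenerative permutation whose Palm law is that of a
concatenation of i.i.d. blocks. -/
theorem IsStationaryRegenerative.hasBlockStructure (h : IsStationaryRegenerative P π T)
    (hpalm : palmLawInt P π T 0 = canonicalLaw p Q) (hp : meanLength p ≠ ∞) :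
    HasBlockStructure P π T p Q where
  indep := h.iIndepFun_blockLength hpalm hp
  length_law z hz n := by
    rw [h.measure_blockLength_of_ne hpalm hp hz, blockMeasure_len_eq_cast]
  size_biased n := by
    rw [h.measure_blockLength_zero hpalm, blockMeasure_len_eq_cast, Int.toNat_natCast,
      div_eq_mul_inv, mul_assoc, mul_comm (p n)]
  delay_uniform := h.condExp_delay hpalm
  blocks s n τ := by
    convert h.condExp_blocks hpalm s n τ

end BlockStructure

/-! ### Positive recurrence -/

/-- The mean of a random variable with values in `{0, 1, …, ∞}` as a sum of tail probabilities. -/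
lemma lintegral_eq_tsum_lt {Ω : Type*} [MeasurableSpace Ω] (P : Measure Ω) {Y : Ω → ℕ∞}
    (hY : Measurable Y) : ∫⁻ ω, (Y ω : ℝ≥0∞) ∂P = ∑' j : ℕ, P {ω | (j : ℕ∞) < Y ω} := by
  have hm : ∀ j : ℕ, MeasurableSet {ω | (j : ℕ∞) < Y ω} := fun j =>
    hY (Set.to_countable (Set.Ioi (j : ℕ∞))).measurableSet
  have hpt : ∀ ω, (Y ω : ℝ≥0∞)
      = ∑' j : ℕ, {ω | (j : ℕ∞) < Y ω}.indicator (fun _ => (1 : ℝ≥0∞)) ω := by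
    have key : ∀ y : ℕ∞, (y : ℝ≥0∞)
        = ∑' j : ℕ, {y : ℕ∞ | (j : ℕ∞) < y}.indicator (fun _ => (1 : ℝ≥0∞)) y := by
      intro y
      simp only [Set.indicator_apply, Set.mem_ofPred_eq]
      induction y using ENat.recTopCoe with
      | top => simp
      | coe n =>
        have := tsum_ite_lt n 1
        rw [mul_one] at this
        simpa using this.symm
    exact fun ω => key (Y ω)
  simp_rw [hpt]
  rw [lintegral_tsum fun j => (measurable_const.indicator (hm j)).aemeasurable]
  exact tsum_congr fun j => lintegral_indicator_one (hm j)

/-- If a stationary regenerative permutation of `ℤ` has the Palm law of a regenerative permutation,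
then the mean block length is the inverse of the positive intensity of renewals. -/
theorem isPositiveRecurrent_of_palm {Ω Ω' : Type*} [MeasurableSpace Ω] [MeasurableSpace Ω']
    {P : Measure Ω} [IsProbabilityMeasure P] {π : Ω → Equiv.Perm ℕ+} {L : ℕ → Ω → ℕ∞}
    (hπ : IsRandomPerm π) (hL : IsDelayedRenewal P L) {n : ℕ} (hn : P (renewalEvent L n) ≠ 0)
    {P' : Measure Ω'} [IsProbabilityMeasure P'] {π' : Ω' → Equiv.Perm ℤ} {T' : ℤ → Ω' → ℤ}
    (h : IsStationaryRegenerative P' π' T') (hpalm : palmLawInt P' π' T' 0 = palmLaw P π L n) :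
    IsPositiveRecurrent P L := by
  have h1 := h.intensity_mul_tsum
  simp only [hpalm, noRenewal, hL.palmLaw_noRenewal hπ hn] at h1
  rw [← lintegral_eq_tsum_lt P (hL.measurable 1)] at h1
  have hlt : ∫⁻ ω, (L 1 ω : ℝ≥0∞) ∂P ≠ ∞ := by
    intro htop
    rw [htop, ENNReal.mul_top (h.measure_renewalEventInt_ne_zero 0)] at h1
    exact ENNReal.top_ne_one h1
  refine ⟨?_, lt_top_iff_ne_top.2 hlt⟩
  have hm : Measurable fun ω => (L 1 ω : ℝ≥0∞) :=
    (measurable_of_countable fun y : ℕ∞ => (y : ℝ≥0∞)).comp (hL.measurable 1)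
  filter_upwards [ae_lt_top hm hlt] with ω hω htop
  rw [htop] at hω
  simp at hω

end RegenPerm

theorem mainTheorem1
    {Ω : Type*} [MeasurableSpace Ω] (P : Measure Ω) [IsProbabilityMeasure P]
    (π : Ω → Equiv.Perm ℕ+) (L : ℕ → Ω → ℕ∞) :
    -- the direct part
    (∀ (p : PMF ℕ+) (Q : ∀ n : ℕ, PMF (Equiv.Perm (Fin n))),
      RegenPerm.IsRecurrentRegenerative P π L p Q → RegenPerm.meanLength p ≠ ⊤ →
      -- existence
      (∃ (Ω' : Type) (_ : MeasurableSpace Ω') (P' : Measure Ω') (π' : Ω' → Equiv.Perm ℤ)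
          (T' : ℤ → Ω' → ℤ),
        IsProbabilityMeasure P' ∧ RegenPerm.IsStationaryVersion P π L P' π' T') ∧
      -- uniqueness of the joint law of the permutation and its renewal indicators
      (∀ (Ω₁ Ω₂ : Type*) [MeasurableSpace Ω₁] [MeasurableSpace Ω₂]
          (P₁ : Measure Ω₁) (P₂ : Measure Ω₂) [IsProbabilityMeasure P₁] [IsProbabilityMeasure P₂]
          (π₁ : Ω₁ → Equiv.Perm ℤ) (π₂ : Ω₂ → Equiv.Perm ℤ)
          (T₁ : ℤ → Ω₁ → ℤ) (T₂ : ℤ → Ω₂ → ℤ),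
        RegenPerm.IsStationaryVersion P π L P₁ π₁ T₁ →
        RegenPerm.IsStationaryVersion P π L P₂ π₂ T₂ →
        RegenPerm.jointLaw P₁ π₁ T₁ = RegenPerm.jointLaw P₂ π₂ T₂) ∧
      -- uniqueness of the law of the permutation, if only residual permutations are compared
      (∀ (Ω₁ Ω₂ : Type*) [MeasurableSpace Ω₁] [MeasurableSpace Ω₂]
          (P₁ : Measure Ω₁) (P₂ : Measure Ω₂) [IsProbabilityMeasure P₁] [IsProbabilityMeasure P₂]
          (π₁ : Ω₁ → Equiv.Perm ℤ) (π₂ : Ω₂ → Equiv.Perm ℤ)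
          (T₁ : ℤ → Ω₁ → ℤ) (T₂ : ℤ → Ω₂ → ℤ),
        RegenPerm.IsWeakStationaryVersion P π L P₁ π₁ T₁ →
        RegenPerm.IsWeakStationaryVersion P π L P₂ π₂ T₂ →
        RegenPerm.permLaw P₁ π₁ = RegenPerm.permLaw P₂ π₂) ∧
      -- properties of the stationary version
      (∀ (Ω' : Type*) [MeasurableSpace Ω'] (P' : Measure Ω') [IsProbabilityMeasure P']
          (π' : Ω' → Equiv.Perm ℤ) (T' : ℤ → Ω' → ℤ),
        RegenPerm.IsStationaryVersion P π L P' π' T' →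
        (∀ z : ℤ, P' (RegenPerm.renewalEventInt T' z) = (RegenPerm.meanLength p)⁻¹) ∧
        -- the Palm version is the recurrent regenerative permutation with zero delay
        (∀ (Ω₀ : Type*) [MeasurableSpace Ω₀] (P₀ : Measure Ω₀) [IsProbabilityMeasure P₀]
            (π₀ : Ω₀ → Equiv.Perm ℕ+) (L₀ : ℕ → Ω₀ → ℕ∞),
          RegenPerm.IsRecurrentRegenerative P₀ π₀ L₀ p Q → (∀ᵐ ω ∂P₀, L₀ 0 ω = 0) →
          ∀ z : ℤ, RegenPerm.palmLawInt P' π' T' z = P₀.map (RegenPerm.future π₀ L₀ 0)) ∧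
        RegenPerm.HasBlockStructure P' π' T' p Q)) ∧
    -- the converse
    (RegenPerm.IsRegenerative P π L →
      ∀ (Ω' : Type*) [MeasurableSpace Ω'] (P' : Measure Ω') [IsProbabilityMeasure P']
        (π' : Ω' → Equiv.Perm ℤ) (T' : ℤ → Ω' → ℤ),
      RegenPerm.IsStationaryRegenerative P' π' T' →
      ∀ n : ℕ, P (RegenPerm.renewalEvent L n) ≠ 0 →
        (∀ z : ℤ, RegenPerm.palmLawInt P' π' T' z = RegenPerm.palmLaw P π L n) →
      RegenPerm.IsPositiveRecurrent P L) := by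
  classical
  refine ⟨fun p Q hrec hp => ?_, fun hreg Ω' _ P' _ π' T' hst n hn hpalm => ?_⟩
  · obtain ⟨n₀, hn₀, hR⟩ := hrec.exists_renewal
    -- the Palm law of every stationary version is that of a concatenation of i.i.d. blocks
    have hver : ∀ {Ω' : Type _} [MeasurableSpace Ω'] {P' : Measure Ω'}
        {π' : Ω' → Equiv.Perm ℤ} {T' : ℤ → Ω' → ℤ},
        RegenPerm.IsStationaryVersion P π L P' π' T' →
        ∀ z, RegenPerm.palmLawInt P' π' T' z = RegenPerm.canonicalLaw p Q :=
      fun h z => (h.2 z n₀ hn₀ hR).trans (hrec.palmLaw_eq hR)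
    refine ⟨?_, ?_, ?_, ?_⟩
    · obtain ⟨h1, h2⟩ := RegenPerm.isStationaryRegenerative_block (p := p) (Q := Q) hp
      exact ⟨RegenPerm.BlockSpace, inferInstance, RegenPerm.stationaryMeasure p Q,
        RegenPerm.blockPerm, RegenPerm.blockTime,
        RegenPerm.isProbabilityMeasure_stationaryMeasure p Q hp, h1, fun z n _ hn =>
          (h2 z).trans (hrec.palmLaw_eq hn).symm⟩
    · intro Ω₁ Ω₂ _ _ P₁ P₂ _ _ π₁ π₂ T₁ T₂ h₁ h₂
      exact RegenPerm.jointLaw_eq_of_palm h₁.1 h₂.1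
        ((h₁.2 0 n₀ hn₀ hR).trans (h₂.2 0 n₀ hn₀ hR).symm)
    · intro Ω₁ Ω₂ _ _ P₁ P₂ _ _ π₁ π₂ T₁ T₂ h₁ h₂
      exact RegenPerm.permLaw_eq_of_palm h₁.1 h₂.1
        ((h₁.2 0 n₀ hn₀ hR).trans (h₂.2 0 n₀ hn₀ hR).symm)
    · intro Ω' _ P' _ π' T' h
      refine ⟨fun z => ?_, ?_, h.1.hasBlockStructure (hver h 0) hp⟩
      · rw [h.1.measure_renewalEventInt z, h.1.intensity (hver h 0)]
      · intro Ω₀ _ P₀ _ π₀ L₀ h₀ hdelay z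
        have hone : ∀ᵐ ω ∂P₀, ω ∈ RegenPerm.renewalEvent L₀ 0 := by
          filter_upwards [hdelay] with ω hω
          exact ⟨0, by simp [RegenPerm.renewalTime, hω]⟩
        have hP : P₀ (RegenPerm.renewalEvent L₀ 0) = 1 :=
          (MeasureTheory.prob_compl_eq_zero_iff
            (RegenPerm.measurableSet_renewalEvent h₀.measurable 0)).1 hone
        rw [hver h z, ← h₀.palmLaw_eq (n := 0) (by rw [hP]; exact one_ne_zero),
          RegenPerm.palmLaw, ProbabilityTheory.cond, hP, inv_one, one_smul,
          Measure.restrict_eq_self_of_ae_mem hone]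
  · exact RegenPerm.isPositiveRecurrent_of_palm hreg.randomPerm hreg.renewal hn hst (hpalm 0)
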